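/- **Theorem 1.** Consider the problem *Vertex Cover Above Tight Lower Bound-1* (VCL1): an instance consists of a positive integer $B$, a positive integer $k$ and a finite simple graph $G$ with $n$ vertices and $m$ edges in which every vertex has degree at most $B$; the question is whether $G$ has a vertex cover (a set of vertices that meets every edge) with at most $m/B+k$ vertices. VCL1 can be solved in time $O(2^{kB}n^{O(1)})$. Precisely: there are an algorithm (a program for a random access machine with logarithmic cost, given $n$, $B$, $k$ and the adjacency matrix of $G$) and absolute constants $a,e$ such that on every instance the algorithm halts with the correct answer after time at most $a\cdot 2^{kB}(n+1)^{e}$. In particular, VCL1 is fixed-parameter tractable with respect to the two parameters $k$ and $B$: it is decided by one algorithm in time $O(f(k,B)\,|I|^{O(1)})$ with a computable function $f$, where $|I|$ is the size of the instance in bits. -/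

import Mathlib

/-! ### Random access machines with logarithmic cost

The registers `R 0, R 1, R 2, …` hold natural numbers. A program is a finite list of instructions;
the machine halts when the program counter leaves the list. Every instruction is charged the
total bit length of the addresses and the numbers it handles. -/

namespace RAM

/-- The instructions. `sub` is truncated subtraction; there is no multiplication. -/
inductive Instr : Type
  /-- `R d := c` -/
  | const (d c : ℕ)
  /-- `R d := R s` -/
  | copy (d s : ℕ)
  /-- `R d := R d + 1` -/
  | succ (d : ℕ)
  /-- `R d := R a + R b` -/
  | add (d a b : ℕ)
  /-- `R d := R a - R b` -/
  | sub (d a b : ℕ)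
  /-- `R d := R (R a)` -/
  | load (d a : ℕ)
  /-- `R (R a) := R s` -/
  | store (a s : ℕ)
  /-- continue at instruction number `l` -/
  | jump (l : ℕ)
  /-- continue at instruction number `l` if `R a = 0`, else at the next instruction -/
  | jzero (a l : ℕ)

/-- A program is a finite list of instructions, numbered from `0`. -/
abbrev Program : Type := List Instr

/-- A configuration: the program counter and the contents of all registers. -/
@[ext] structure Config : Type where
  pc : ℕ
  reg : ℕ → ℕ

/-- The charge for handling the number `x`: its bit length plus one. -/
def len (x : ℕ) : ℕ := Nat.size x + 1

/-- The configuration after executing an instruction. -/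
def Instr.exec (i : Instr) (c : Config) : Config :=
  match i with
  | .const d v => ⟨c.pc + 1, Function.update c.reg d v⟩
  | .copy d s => ⟨c.pc + 1, Function.update c.reg d (c.reg s)⟩
  | .succ d => ⟨c.pc + 1, Function.update c.reg d (c.reg d + 1)⟩
  | .add d a b => ⟨c.pc + 1, Function.update c.reg d (c.reg a + c.reg b)⟩
  | .sub d a b => ⟨c.pc + 1, Function.update c.reg d (c.reg a - c.reg b)⟩
  | .load d a => ⟨c.pc + 1, Function.update c.reg d (c.reg (c.reg a))⟩
  | .store a s => ⟨c.pc + 1, Function.update c.reg (c.reg a) (c.reg s)⟩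
  | .jump l => ⟨l, c.reg⟩
  | .jzero a l => ⟨if c.reg a = 0 then l else c.pc + 1, c.reg⟩

/-- The logarithmic cost of executing an instruction. -/
def Instr.cost (i : Instr) (c : Config) : ℕ :=
  match i with
  | .const d v => len d + len v
  | .copy d s => len d + len s + len (c.reg s)
  | .succ d => len d + len (c.reg d)
  | .add d a b => len d + len a + len b + len (c.reg a) + len (c.reg b)
  | .sub d a b => len d + len a + len b + len (c.reg a) + len (c.reg b)
  | .load d a => len d + len a + len (c.reg a) + len (c.reg (c.reg a))
  | .store a s => len a + len s + len (c.reg a) + len (c.reg s)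
  | .jump l => len l
  | .jzero a l => len a + len l + len (c.reg a)

/-- `Runs P c t c'`: the program `P` leads from `c` to `c'` with total cost `t`. -/
inductive Runs (P : Program) : Config → ℕ → Config → Prop
  | refl (c : Config) : Runs P c 0 c
  | step {c c' : Config} {i : Instr} {t : ℕ} (hi : P[c.pc]? = some i)
      (h : Runs P (i.exec c) t c') : Runs P c (i.cost c + t) c'

/-- The initial configuration: the input stands in the registers `0, 1, …`, all others are `0`. -/
def init (input : List ℕ) : Config := ⟨0, fun i => input.getD i 0⟩

/-- Started on `input`, the program `P` halts within time `T` and leaves `1` in register `0` if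
`A` holds and `0` if `A` does not hold. -/
def DecidesWithin (P : Program) (input : List ℕ) (A : Prop) (T : ℕ) : Prop :=
  ∃ (t : ℕ) (c : Config), Runs P (init input) t c ∧ P.length ≤ c.pc ∧ t ≤ T ∧
    ((A ∧ c.reg 0 = 1) ∨ (¬ A ∧ c.reg 0 = 0))

/-- The size of an input: the total length of its numbers in binary. -/
def inputSize (input : List ℕ) : ℕ := (input.map len).sum

/-- Fixed-parameter tractability of the problem `yes` on instances `I`, written down for the
machine by `enc`, with two parameters `κ`: one program decides all instances `x` in time
`O(f(κ x) |x|^{O(1)})` for a computable function `f`. -/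
def FPT {I : Type} (enc : I → List ℕ) (κ : I → ℕ × ℕ) (yes : I → Prop) : Prop :=
  ∃ f : ℕ × ℕ → ℕ, Computable f ∧ ∃ (P : Program) (a e : ℕ), ∀ x : I,
    DecidesWithin P (enc x) (yes x) (a * f (κ x) * inputSize (enc x) ^ e)

end RAM

/-! ### Vertex Cover Above Tight Lower Bound-1 -/

open scoped Classical in
/-- An instance: positive integers `B` and `k` and a graph on `n` vertices all of whose degrees are
at most `B`. -/
structure VCL1 : Type where
  n : ℕ
  B : ℕ
  k : ℕ
  B_pos : 0 < B
  k_pos : 0 < k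
  G : SimpleGraph (Fin n)
  degree_le : ∀ v, G.degree v ≤ B

namespace VCL1

open scoped Classical in
/-- The question: does `G` have a vertex cover with at most `m / B + k` vertices, where `m` is the
number of edges and `/` is the division of rational numbers? -/
def IsYes (x : VCL1) : Prop :=
  ∃ C : Finset (Fin x.n), x.G.IsVertexCover (C : Set (Fin x.n)) ∧
    (C.card : ℚ) ≤ (x.G.edgeFinset.card : ℚ) / (x.B : ℚ) + (x.k : ℚ)

open scoped Classical in
/-- The input for the machine: `n`, `B`, `k` and the rows of the adjacency matrix of `G`. -/
noncomputable def encode (x : VCL1) : List ℕ :=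
  [x.n, x.B, x.k] ++ (List.finRange x.n).flatMap fun i =>
    (List.finRange x.n).map fun j => if x.G.Adj i j then 1 else 0

end VCL1

/-! Let tau(S) be twice the least weight of a half-integral vertex cover of the graph induced on S.
Adding the inequalities of such a cover over all edges counts each vertex at most B times, so m/B is
at most half of tau of the whole graph (`pairs_le_mul_tau`). With b = k + ⌊m/B⌋, the budget 2b
therefore exceeds tau by at most 2k, and it is enough to search in terms of this gap.

The search decides for each vertex v whether v or all its neighbours enter the cover. If one of the
two choices is compatible with an optimal half-integral cover, an exchange argument in the style of
Nemhauser and Trotter (`persistency`) shows that it can be made without loss. If neither is, each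
choice pays more than tau loses, so the gap 2b - 2c - tau(S), where c vertices have been chosen so
far, drops by at least one. A cover with at most b vertices, if there is one, thus leads to a run
with at most 2k open questions (`branch_complete`), while every run produces a genuine cover
(`branch_sound`). Trying the 4^k strings of answers settles the problem, and 4^k ≤ 2^(kB) when B ≥
2. If m ≤ b, one endpoint of each edge already gives a cover, and the answer is yes without a
search. This disposes of B = 1, and otherwise leaves 2k ≤ n², so that k is polynomial in n whenever
a search takes place.

The value tau(S) is the size of a maximum matching in the bipartite double cover of the induced
graph. It is found by an auction: left vertices bid in unit steps for their cheapest neighbours.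
With more price levels than vertices some level is unused, and splitting the prices there yields a
cover that certifies optimality, as in König's theorem (`Auction.isTau`).

For the machine, the algorithm is written in a language of bounded loops and compiled
(`Layout.runsLe_code`). Values grow by at most one unit per charged step, which bounds the contents
of all registers and hence the logarithmic cost. The final estimate (`cost_le_mul`, `mul_rounds_le`)
must also absorb the bit lengths of B and k, which need not be bounded in terms of n, into 2^(kB).
-/

/-! ### Half-integral vertex covers and persistency -/

namespace HalfCover

variable {E : ℕ → ℕ → Prop}

/-- `C` meets every edge inside `S`. -/
def Covers (E : ℕ → ℕ → Prop) (S C : Finset ℕ) : Prop :=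
  ∀ u ∈ S, ∀ w ∈ S, E u w → u ∈ C ∨ w ∈ C

/-- `z / 2` is a fractional vertex cover of the graph induced on `S`. -/
def Feasible (E : ℕ → ℕ → Prop) (S : Finset ℕ) (z : ℕ → ℕ) : Prop :=
  ∀ u ∈ S, ∀ w ∈ S, E u w → 2 ≤ z u + z w

/-- `t` is twice the least weight of a half-integral vertex cover of the graph induced on `S`. -/
def IsTau (E : ℕ → ℕ → Prop) (S : Finset ℕ) (t : ℕ) : Prop :=
  (∃ z, Feasible E S z ∧ ∑ v ∈ S, z v = t) ∧ ∀ z, Feasible E S z → t ≤ ∑ v ∈ S, z v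

theorem IsTau.le_two_mul_card {S C : Finset ℕ} {t : ℕ} (ht : IsTau E S t) (hC : Covers E S C) :
    t ≤ 2 * C.card := by
  classical
  have hf : Feasible E S (fun v => if v ∈ C then 2 else 0) := by
    intro u hu w hw h
    rcases hC u hu w hw h with h | h <;> simp [h]
  refine (ht.2 _ hf).trans ?_
  rw [← Finset.sum_filter, Finset.sum_const, smul_eq_mul, mul_comm]
  refine Nat.mul_le_mul_left _ (Finset.card_le_card ?_)
  intro v hv
  exact (Finset.mem_filter.1 hv).2

theorem IsTau.mono {S S' : Finset ℕ} {t t' : ℕ} (ht : IsTau E S t) (ht' : IsTau E S' t')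
    (h : S' ⊆ S) : t' ≤ t := by
  obtain ⟨⟨z, hz, rfl⟩, -⟩ := ht
  exact (ht'.2 z fun u hu w hw => hz u (h hu) w (h hw)).trans (Finset.sum_le_sum_of_subset h)

/-- Persistency: an optimal half-integral cover `z` is respected by some cover that is not larger
than a given cover `C`. -/
theorem persistency {S C : Finset ℕ} {z : ℕ → ℕ} (hz : Feasible E S z)
    (hmin : ∀ z', Feasible E S z' → ∑ v ∈ S, z v ≤ ∑ v ∈ S, z' v) (hC : Covers E S C) :
    ∃ D ⊆ S, Covers E S D ∧ D.card ≤ C.card ∧ (∀ v ∈ S, 2 ≤ z v → v ∈ D) ∧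
      ∀ v ∈ S, z v = 0 → v ∉ D := by
  classical
  -- Move `z` one unit towards `C`: raise the zeros in `C` and lower the values at least 2 outside
  -- `C`. An edge with a lowered end has its other end in `C`, so both ends keep a value of at least
  -- 1. Optimality of `z` then says that at least as many vertices are raised (`X`) as lowered
  -- (`Y`).
  set z' : ℕ → ℕ := fun v =>
    if v ∈ C then (if z v = 0 then 1 else z v) else (if 2 ≤ z v then z v - 1 else z v) with hz'
  have hf : Feasible E S z' := by
    intro u hu w hw h
    have h1 := hz u hu w hw h
    have h2 := hC u hu w hw h
    simp only [hz']
    split_ifs <;> first | omega | (exfalso; tauto)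
  have hsum := hmin z' hf
  set X := S.filter (fun v => v ∈ C ∧ z v = 0)
  set Y := S.filter (fun v => v ∉ C ∧ 2 ≤ z v)
  have hid : ∑ v ∈ S, z' v + Y.card = ∑ v ∈ S, z v + X.card := by
    simp only [X, Y, Finset.card_filter, ← Finset.sum_add_distrib]
    refine Finset.sum_congr rfl fun v _ => ?_
    simp only [hz']
    split_ifs <;> first | omega | (exfalso; tauto)
  have hYX : Y.card ≤ X.card := by omega
  -- The exchange: drop `X` from `C` and add `Y`. An edge uncovered by dropping a vertex of value 0
  -- has its other end of value at least 2, and that end belongs to the new set.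
  refine ⟨S.filter (fun v => (v ∈ C ∧ z v ≠ 0) ∨ 2 ≤ z v), Finset.filter_subset _ _, ?_, ?_, ?_, ?_⟩
  · intro u hu w hw h
    have h1 := hz u hu w hw h
    have h2 := hC u hu w hw h
    simp only [Finset.mem_filter, hu, hw, true_and]
    by_cases hu0 : z u = 0
    · right; right; omega
    by_cases hw0 : z w = 0
    · left; right; omega
    tauto
  · have h1 : S.filter (fun v => (v ∈ C ∧ z v ≠ 0) ∨ 2 ≤ z v) ⊆ (C \ X) ∪ Y := by
      intro v hv
      simp only [Finset.mem_filter, Finset.mem_union, Finset.mem_sdiff, X, Y] at hv ⊢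
      by_cases hvC : v ∈ C
      · left
        refine ⟨hvC, fun h => ?_⟩
        rcases hv.2 with h2 | h2 <;> omega
      · right
        refine ⟨hv.1, hvC, ?_⟩
        tauto
    have hX : X ⊆ C := fun v hv => (Finset.mem_filter.1 hv).2.1
    have h2 := (Finset.card_le_card h1).trans (Finset.card_union_le _ _)
    have h3 := Finset.card_sdiff_add_card_eq_card hX
    omega
  · intro v hv h
    simp [hv, h]
  · intro v hv h
    simp [h]

/-- The neighbours of `v` in `S`. -/
noncomputable def nbrs (E : ℕ → ℕ → Prop) (S : Finset ℕ) (v : ℕ) : Finset ℕ :=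
  open scoped Classical in S.filter (E v)

theorem mem_nbrs {S : Finset ℕ} {v w : ℕ} : w ∈ nbrs E S v ↔ w ∈ S ∧ E v w := by
  simp [nbrs]

/-- The vertices of `S` other than `v` and its neighbours. -/
noncomputable def rest (E : ℕ → ℕ → Prop) (S : Finset ℕ) (v : ℕ) : Finset ℕ :=
  (S.erase v) \ nbrs E S v

theorem mem_rest {S : Finset ℕ} {v w : ℕ} : w ∈ rest E S v ↔ w ∈ S ∧ w ≠ v ∧ ¬ E v w := by
  simp only [rest, Finset.mem_sdiff, Finset.mem_erase, mem_nbrs]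
  tauto

/-- Extending an optimal solution by 2 at `v` shows that deleting `v` lowers tau by at most 2. If
the drop is exactly 2, the extension is itself optimal on `S`, and `persistency` applies to it. -/
theorem IsTau.exists_feasible_of_erase {S : Finset ℕ} {v t₁ : ℕ} (hv : v ∈ S)
    (ht₁ : IsTau E (S.erase v) t₁) :
    ∃ z, Feasible E S z ∧ ∑ u ∈ S, z u = t₁ + 2 ∧ z v = 2 := by
  obtain ⟨⟨z, hz, hzt⟩, -⟩ := ht₁
  refine ⟨Function.update z v 2, ?_, ?_, by simp⟩
  · intro u hu w hw huw
    by_cases h1 : u = v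
    · simp [h1]
    by_cases h2 : w = v
    · simp [h2]
    rw [Function.update_of_ne h1, Function.update_of_ne h2]
    exact hz u (Finset.mem_erase.2 ⟨h1, hu⟩) w (Finset.mem_erase.2 ⟨h2, hw⟩) huw
  · rw [← Finset.sum_erase_add _ _ hv, Function.update_self, ← hzt]
    congr 1
    refine Finset.sum_congr rfl fun u hu => ?_
    rw [Function.update_of_ne (Finset.mem_erase.1 hu).1]

/-- The hypothesis `h` makes the extended solution, with value 2 at `v`, optimal on `S`. Persistency
then exchanges `C` for a cover through `v` that is no larger. -/
theorem Covers.exists_erase_of_tau {S C : Finset ℕ} {v t t₁ : ℕ} (hv : v ∈ S)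
    (ht : IsTau E S t) (ht₁ : IsTau E (S.erase v) t₁) (h : t₁ + 2 ≤ t)
    (hC : Covers E S C) : ∃ D, Covers E (S.erase v) D ∧ D.card + 1 ≤ C.card := by
  obtain ⟨z, hf, hsum, hzv⟩ := ht₁.exists_feasible_of_erase hv
  obtain ⟨D, -, hD, hcard, hmem, -⟩ :=
    persistency hf (fun z' hz' => by rw [hsum]; exact h.trans (ht.2 z' hz')) hC
  have hvD : v ∈ D := hmem v hv hzv.ge
  refine ⟨D.erase v, ?_, ?_⟩
  · intro u hu w hw huw
    rw [Finset.mem_erase] at hu hw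
    rcases hD u hu.2 w hw.2 huw with h | h
    · exact Or.inl (Finset.mem_erase.2 ⟨hu.1, h⟩)
    · exact Or.inr (Finset.mem_erase.2 ⟨hw.1, h⟩)
  · rw [Finset.card_erase_add_one hvD]
    exact hcard

theorem Covers.exists_rest {S D : Finset ℕ} {v : ℕ}
    (hD : Covers E S D) (hN : nbrs E S v ⊆ D) :
    ∃ D', Covers E (rest E S v) D' ∧ D'.card + (nbrs E S v).card ≤ D.card := by
  refine ⟨D \ nbrs E S v, ?_, (Finset.card_sdiff_add_card_eq_card hN).le⟩
  intro u hu w hw huw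
  rw [mem_rest] at hu hw
  simp only [Finset.mem_sdiff, mem_nbrs]
  have := hD u hu.1 w hw.1 huw
  tauto

/-- Counterpart of the deletion of `v` alone: the extension takes 0 at `v` and 2 at its neighbours.
A loop at `v` would spoil feasibility there, and symmetry is needed for edges that enter `v`. -/
theorem IsTau.exists_feasible_of_rest {S : Finset ℕ} {v t₂ : ℕ} (hv : v ∈ S)
    (hsymm : ∀ u w, E u w → E w u) (hE : ¬ E v v) (ht₂ : IsTau E (rest E S v) t₂) :
    ∃ z, Feasible E S z ∧ ∑ u ∈ S, z u = t₂ + 2 * (nbrs E S v).card ∧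
      ∀ u ∈ nbrs E S v, z u = 2 := by
  classical
  obtain ⟨⟨z, hz, hzt⟩, -⟩ := ht₂
  set z' : ℕ → ℕ := fun u => if u = v then 0 else if E v u then 2 else z u with hz'
  have hnb : ∀ u ∈ nbrs E S v, z' u = 2 := by
    intro u hu
    rw [mem_nbrs] at hu
    have : u ≠ v := fun e => hE (e ▸ hu.2)
    simp [hz', this, hu.2]
  refine ⟨z', ?_, ?_, hnb⟩
  · intro u hu w hw huw
    have h1 : u ≠ v → w ≠ v → ¬ E v u → ¬ E v w → 2 ≤ z u + z w := fun a b c d =>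
      hz u (mem_rest.2 ⟨hu, a, c⟩) w (mem_rest.2 ⟨hw, b, d⟩) huw
    have h2 : u = v → E v w := fun a => a ▸ huw
    have h3 : w = v → E v u := fun a => hsymm _ _ (a ▸ huw)
    have h4 : u = v → w ≠ v := fun a b => hE (by rw [a, b] at huw; exact huw)
    simp only [hz']
    split_ifs <;> first | omega | (exfalso; tauto) | tauto
  · have hsub : nbrs E S v ⊆ S.erase v := fun u hu => by
      rw [mem_nbrs] at hu
      exact Finset.mem_erase.2 ⟨fun e => hE (e ▸ hu.2), hu.1⟩
    rw [← Finset.sum_erase_add _ _ hv, ← Finset.sum_sdiff hsub, ← hzt]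
    have h1 : z' v = 0 := by simp [hz']
    have h2 : ∑ u ∈ nbrs E S v, z' u = 2 * (nbrs E S v).card := by
      rw [mul_comm, ← smul_eq_mul, ← Finset.sum_const]
      exact Finset.sum_congr rfl hnb
    rw [h1, h2, add_zero]
    congr 1
    refine Finset.sum_congr rfl fun u hu => ?_
    obtain ⟨-, h3, h4⟩ := mem_rest.1 hu
    simp [hz', h3, h4]

theorem Covers.exists_rest_of_tau {S C : Finset ℕ} {v t t₂ : ℕ} (hv : v ∈ S)
    (hsymm : ∀ u w, E u w → E w u) (hE : ¬ E v v)
    (ht : IsTau E S t) (ht₂ : IsTau E (rest E S v) t₂) (h : t₂ + 2 * (nbrs E S v).card ≤ t)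
    (hC : Covers E S C) :
    ∃ D, Covers E (rest E S v) D ∧ D.card + (nbrs E S v).card ≤ C.card := by
  obtain ⟨z, hf, hsum, hnb⟩ := ht₂.exists_feasible_of_rest hv hsymm hE
  obtain ⟨D, -, hD, hcard, hmem, -⟩ :=
    persistency hf (fun z' hz' => by rw [hsum]; exact h.trans (ht.2 z' hz')) hC
  obtain ⟨D', h1, h2⟩ := hD.exists_rest (v := v) fun u hu =>
    hmem u (mem_nbrs.1 hu).1 (hnb u hu).ge
  exact ⟨D', h1, h2.trans hcard⟩

/-! ### The branching procedure -/

open scoped Classical in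
/-- Go through the vertices `vs`, putting each one into the cover or putting its neighbours into
the cover; `b` answers the questions, in order, which `τ` leaves open. The result is the number of
vertices put into the cover in addition to `c`. -/
noncomputable def branch (E : ℕ → ℕ → Prop) (τ : Finset ℕ → ℕ) :
    List ℕ → Finset ℕ → ℕ → (ℕ → Prop) → ℕ
  | [], _, c, _ => c
  | v :: vs, S, c, b =>
    if v ∈ S then
      if τ (S.erase v) + 2 ≤ τ S then branch E τ vs (S.erase v) (c + 1) b
      else if τ (rest E S v) + 2 * (nbrs E S v).card ≤ τ S then
        branch E τ vs (rest E S v) (c + (nbrs E S v).card) b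
      else if b 0 then branch E τ vs (rest E S v) (c + (nbrs E S v).card) (fun i => b (i + 1))
      else branch E τ vs (S.erase v) (c + 1) (fun i => b (i + 1))
    else branch E τ vs S c b

/-- Nothing is assumed about `τ` or about the answers: each move is legitimate in itself, since
after it the removed vertices touch no uncovered edge. Misguided answers can only make the cover
larger. -/
theorem branch_sound {τ : Finset ℕ → ℕ} (hsymm : ∀ u w, E u w → E w u)
    (vs : List ℕ) : ∀ (S : Finset ℕ) (c : ℕ) (b : ℕ → Prop), (∀ v ∈ S, v ∈ vs) →
      ∃ C : Finset ℕ, Covers E S C ∧ c + C.card ≤ branch E τ vs S c b := by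
  induction vs with
  | nil =>
    intro S c b hS
    refine ⟨∅, fun u hu => ?_, by simp [branch]⟩
    exact absurd (hS u hu) (by simp)
  | cons v vs ih =>
    intro S c b hS
    have hin : ∀ b', ∃ C : Finset ℕ, Covers E S C ∧
        c + C.card ≤ branch E τ vs (S.erase v) (c + 1) b' := by
      intro b'
      obtain ⟨C, hC, hc⟩ := ih (S.erase v) (c + 1) b' (fun w hw => by
        rw [Finset.mem_erase] at hw
        exact (List.mem_cons.1 (hS w hw.2)).resolve_left hw.1)
      refine ⟨insert v C, ?_, ?_⟩
      · intro u hu w hw huw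
        by_cases h1 : u = v
        · left; simp [h1]
        by_cases h2 : w = v
        · right; simp [h2]
        have := hC u (Finset.mem_erase.2 ⟨h1, hu⟩) w (Finset.mem_erase.2 ⟨h2, hw⟩) huw
        simp only [Finset.mem_insert]
        tauto
      · have := Finset.card_insert_le v C
        omega
    have hout : ∀ b', ∃ C : Finset ℕ, Covers E S C ∧
        c + C.card ≤ branch E τ vs (rest E S v) (c + (nbrs E S v).card) b' := by
      intro b'
      obtain ⟨C, hC, hc⟩ := ih (rest E S v) (c + (nbrs E S v).card) b' (fun w hw => by
        rw [mem_rest] at hw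
        exact (List.mem_cons.1 (hS w hw.1)).resolve_left hw.2.1)
      refine ⟨nbrs E S v ∪ C, ?_, ?_⟩
      · intro u hu w hw huw
        simp only [Finset.mem_union, mem_nbrs, hu, hw, true_and]
        by_cases h1 : E v u
        · tauto
        by_cases h2 : E v w
        · tauto
        have h3 : u ≠ v := fun e => h2 (e ▸ huw)
        have h4 : w ≠ v := fun e => h1 (hsymm _ _ (e ▸ huw))
        have := hC u (mem_rest.2 ⟨hu, h3, h1⟩) w (mem_rest.2 ⟨hw, h4, h2⟩) huw
        tauto
      · have := Finset.card_union_le (nbrs E S v) C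
        omega
    rw [branch]
    split_ifs with h1
    · exact hin _
    · exact hout _
    · exact hout _
    · exact hin _
    · refine ih S c b fun w hw => (List.mem_cons.1 (hS w hw)).resolve_left ?_
      rintro rfl
      exact h1 hw

/-- The potential `2 * bound - 2 * c - τ S` is at most `μ`. A forced move does not raise it, because
`τ` loses at most what `2 * c` gains. At an open question both tests have failed, so `τ` loses
strictly less and the potential falls. The cover `C` serves as a guide: it is exchanged by
persistency at forced moves and followed at open questions. The quantification over all `b` that
agree with `g` below `μ` is needed because the entries of the answer array beyond the enumerated
ones are not controlled. -/
theorem branch_complete {τ : Finset ℕ → ℕ} (hτ : ∀ S, IsTau E S (τ S))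
    (hsymm : ∀ u w, E u w → E w u) (hE : ∀ v, ¬ E v v) (bound : ℕ) (vs : List ℕ) :
    ∀ (S C : Finset ℕ) (c μ : ℕ), Covers E S C → c + C.card ≤ bound →
      2 * bound ≤ μ + 2 * c + τ S →
      ∃ g : ℕ → Prop, ∀ b : ℕ → Prop, (∀ i < μ, b i ↔ g i) → branch E τ vs S c b ≤ bound := by
  induction vs with
  | nil =>
    intro S C c μ _ hc _
    exact ⟨fun _ => True, fun b _ => by rw [branch]; omega⟩
  | cons v vs ih =>
    intro S C c μ hC hc hμ
    by_cases hv : v ∈ S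
    swap
    · simpa only [branch, hv, if_false] using ih S C c μ hC hc hμ
    simp only [branch, hv, if_true]
    by_cases h1 : τ (S.erase v) + 2 ≤ τ S
    · simp only [h1, if_true]
      obtain ⟨D, hD, hcard⟩ := hC.exists_erase_of_tau hv (hτ _) (hτ _) h1
      refine ih _ D _ _ hD (by omega) ?_
      obtain ⟨z, hz, hsum, -⟩ := (hτ (S.erase v)).exists_feasible_of_erase hv
      have := (hτ S).2 z hz
      omega
    simp only [h1, if_false]
    by_cases h2 : τ (rest E S v) + 2 * (nbrs E S v).card ≤ τ S
    · simp only [h2, if_true]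
      obtain ⟨D, hD, hcard⟩ := hC.exists_rest_of_tau hv hsymm (hE v) (hτ _) (hτ _) h2
      refine ih _ D _ _ hD (by omega) ?_
      obtain ⟨z, hz, hsum, -⟩ := (hτ (rest E S v)).exists_feasible_of_rest hv hsymm (hE v)
      have := (hτ S).2 z hz
      omega
    simp only [h2, if_false]
    by_cases hvC : v ∈ C
    · have hD : Covers E (S.erase v) (C.erase v) := by
        intro u hu w hw huw
        rw [Finset.mem_erase] at hu hw
        have := hC u hu.2 w hw.2 huw
        simp only [Finset.mem_erase]
        tauto
      have hcard := Finset.card_erase_add_one hvC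
      -- This lower bound on the remaining cover forces `1 ≤ μ`, so that the question asked here is
      -- among the first `μ` and `μ - 1` is a true predecessor.
      have hle := (hτ (S.erase v)).le_two_mul_card hD
      obtain ⟨g, hg⟩ := ih _ _ (c + 1) (μ - 1) hD (by omega) (by omega)
      refine ⟨fun i => match i with | 0 => False | i + 1 => g i, fun b hb => ?_⟩
      have h0 : ¬ b 0 := (hb 0 (by omega)).1
      simp only [h0, if_false]
      exact hg _ fun i hi => hb (i + 1) (by omega)
    · obtain ⟨D, hD, hcard⟩ := hC.exists_rest (v := v) (fun u hu => by
        rw [mem_nbrs] at hu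
        exact (hC v hv u hu.1 hu.2).resolve_left hvC)
      have hle := (hτ (rest E S v)).le_two_mul_card hD
      obtain ⟨g, hg⟩ := ih _ _ (c + (nbrs E S v).card) (μ - 1) hD (by omega) (by omega)
      refine ⟨fun i => match i with | 0 => True | i + 1 => g i, fun b hb => ?_⟩
      have h0 : b 0 := (hb 0 (by omega)).2 trivial
      simp only [h0, if_true]
      exact hg _ fun i hi => hb (i + 1) (by omega)

theorem exists_isTau (E : ℕ → ℕ → Prop) (S : Finset ℕ) : ∃ t, IsTau E S t := by
  classical
  have h : ∃ t, ∃ z, Feasible E S z ∧ ∑ v ∈ S, z v = t :=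
    ⟨_, fun _ => 2, fun _ _ _ _ _ => by norm_num, rfl⟩
  exact ⟨Nat.find h, Nat.find_spec h, fun z hz => Nat.find_min' h ⟨z, hz, rfl⟩⟩

/-- Twice the least weight of a half-integral vertex cover of the graph induced on `S`. -/
noncomputable def tau (E : ℕ → ℕ → Prop) (S : Finset ℕ) : ℕ := (exists_isTau E S).choose

theorem isTau_tau (E : ℕ → ℕ → Prop) (S : Finset ℕ) : IsTau E S (tau E S) :=
  (exists_isTau E S).choose_spec

theorem IsTau.eq_tau {S : Finset ℕ} {t : ℕ} (h : IsTau E S t) : t = tau E S :=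
  le_antisymm ((isTau_tau E S).mono h subset_rfl) (h.mono (isTau_tau E S) subset_rfl)

/-! ### The auction -/

/-- The state of an auction in which the vertices of `U` have been bidding for their neighbours in
`T`: `p` are the prices, at most `L`, and the vertices with positive price are sold to `mate`. -/
structure Auction (E : ℕ → ℕ → Prop) (T : Finset ℕ) (L : ℕ) (p mate : ℕ → ℕ) (U : Finset ℕ) :
    Prop where
  price_le : ∀ w ∈ T, p w ≤ L
  mate_mem : ∀ w ∈ T, 0 < p w → mate w ∈ U
  mate_adj : ∀ w ∈ T, 0 < p w → E (mate w) w
  mate_inj : ∀ w ∈ T, ∀ w' ∈ T, 0 < p w → 0 < p w' → mate w = mate w' → w = w'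
  slack : ∀ w ∈ T, 0 < p w → ∀ w' ∈ T, E (mate w) w' → p w ≤ p w' + 1
  placed : ∀ u ∈ U, (∃ w ∈ T, 0 < p w ∧ mate w = u) ∨ ∀ w ∈ T, E u w → L ≤ p w

namespace Auction

variable {T U : Finset ℕ} {L : ℕ} {p mate : ℕ → ℕ}

theorem start (hp : ∀ w ∈ T, p w = 0) : Auction E T L p mate ∅ where
  price_le w hw := by simp [hp w hw]
  mate_mem w hw h := by simp [hp w hw] at h
  mate_adj w hw h := by simp [hp w hw] at h
  mate_inj w hw _ _ h := by simp [hp w hw] at h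
  slack w hw h := by simp [hp w hw] at h
  placed u hu := by simp at hu

theorem give_up (h : Auction E T L p mate U) {u : ℕ} (hu : ∀ w ∈ T, E u w → L ≤ p w) :
    Auction E T L p mate (insert u U) where
  price_le := h.price_le
  mate_mem w hw h0 := Finset.mem_insert_of_mem (h.mate_mem w hw h0)
  mate_adj := h.mate_adj
  mate_inj := h.mate_inj
  slack := h.slack
  placed u' hu' := by
    rcases Finset.mem_insert.1 hu' with rfl | hu'
    · exact Or.inr hu
    · exact h.placed u' hu'

/-- The bid of `u` for `w`. The vertex which loses `w`, if any, has to bid again. -/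
theorem bid (h : Auction E T L p mate U) {u w : ℕ} (huU : u ∉ U) (hw : w ∈ T) (huw : E u w)
    (hL : p w < L) (hmin : ∀ w' ∈ T, E u w' → p w ≤ p w') {U' : Finset ℕ}
    (hU' : ∀ x, x ∈ U' ↔ x = u ∨ x ∈ U ∧ ¬ (0 < p w ∧ x = mate w)) :
    Auction E T L (Function.update p w (p w + 1)) (Function.update mate w u) U' where
  price_le x hx := by
    by_cases e : x = w
    · subst e; simp; omega
    · simpa [e] using h.price_le x hx
  mate_mem x hx h0 := by
    rw [hU']
    by_cases e : x = w
    · simp [e]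
    · simp only [Function.update_of_ne e] at h0 ⊢
      refine Or.inr ⟨h.mate_mem x hx h0, fun h1 => e (h.mate_inj x hx w hw h0 h1.1 h1.2)⟩
  mate_adj x hx h0 := by
    by_cases e : x = w
    · subst e; simpa
    · simp only [Function.update_of_ne e] at h0 ⊢
      exact h.mate_adj x hx h0
  mate_inj x hx y hy hx0 hy0 hxy := by
    by_cases ex : x = w <;> by_cases ey : y = w
    · rw [ex, ey]
    · simp only [ex, Function.update_self, Function.update_of_ne ey] at hy0 hxy
      -- The bidder is not yet placed, so it owns nothing else and the new assignment stays
      -- injective.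
      exact absurd (hxy ▸ h.mate_mem y hy hy0) huU
    · simp only [ey, Function.update_self, Function.update_of_ne ex] at hx0 hxy
      exact absurd (hxy ▸ h.mate_mem x hx hx0) huU
    · simp only [Function.update_of_ne ex, Function.update_of_ne ey] at hx0 hy0 hxy
      exact h.mate_inj x hx y hy hx0 hy0 hxy
  slack x hx hx0 y hy hxy := by
    have hmono : p y ≤ Function.update p w (p w + 1) y := by
      by_cases ey : y = w
      · subst ey; simp
      · simp [ey]
    by_cases ex : x = w
    · subst ex
      simp only [Function.update_self] at hxy ⊢
      -- Bidding for a cheapest neighbour is what keeps the slack condition at the new price;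
      -- elsewhere prices only rise on the right-hand side.
      have := hmin y hy hxy
      omega
    · simp only [Function.update_of_ne ex] at hx0 hxy ⊢
      have := h.slack x hx hx0 y hy hxy
      omega
  placed x hx := by
    have hmono : ∀ y, p y ≤ Function.update p w (p w + 1) y := by
      intro y
      by_cases ey : y = w
      · subst ey; simp
      · simp [ey]
    by_cases exu : x = u
    · exact Or.inl ⟨w, hw, by simp, by simp [exu]⟩
    obtain ⟨hxU, hx1⟩ := ((hU' x).1 hx).resolve_left exu
    rcases h.placed x hxU with ⟨y, hy, hy0, hyx⟩ | h1
    · left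
      have : y ≠ w := by
        rintro rfl
        exact hx1 ⟨hy0, hyx.symm⟩
      exact ⟨y, hy, by simpa [this] using hy0, by simpa [this] using hyx⟩
    · right
      exact fun y hy hxy => (h1 y hy hxy).trans (hmono y)

/-- When all vertices have been placed, the sold vertices are matched by an optimal matching of the
bipartite double cover. -/
theorem isTau (h : Auction E T L p mate T) (hsymm : ∀ u w, E u w → E w u) (hL : T.card < L) :
    IsTau E T (T.filter (fun w => 0 < p w)).card := by
  classical
  set M := T.filter (fun w => 0 < p w) with hM
  have hMT : M ⊆ T := Finset.filter_subset _ _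
  have hmemM : ∀ w, w ∈ M ↔ w ∈ T ∧ 0 < p w := fun w => by simp [hM]
  have hinj : Set.InjOn mate (M : Set ℕ) := by
    intro w hw w' hw' e
    rw [Finset.mem_coe, hmemM] at hw hw'
    exact h.mate_inj w hw.1 w' hw'.1 hw.2 hw'.2 e
  -- Weak duality: each of the matched edges contributes at least 2, and each vertex is counted at
  -- most twice, once as a sold vertex and once as a mate.
  have hlow : ∀ z, Feasible E T z → M.card ≤ ∑ v ∈ T, z v := by
    intro z hz
    have h1 : ∑ w ∈ M, z w ≤ ∑ v ∈ T, z v := Finset.sum_le_sum_of_subset hMT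
    have h2 : ∑ w ∈ M, z (mate w) ≤ ∑ v ∈ T, z v := by
      rw [← Finset.sum_image (f := z) hinj]
      refine Finset.sum_le_sum_of_subset fun u hu => ?_
      obtain ⟨w, hw, rfl⟩ := Finset.mem_image.1 hu
      rw [hmemM] at hw
      exact h.mate_mem w hw.1 hw.2
    have h3 : ∑ w ∈ M, 2 ≤ ∑ w ∈ M, (z (mate w) + z w) := by
      refine Finset.sum_le_sum fun w hw => ?_
      rw [hmemM] at hw
      exact hz _ (h.mate_mem w hw.1 hw.2) _ hw.1 (h.mate_adj w hw.1 hw.2)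
    rw [Finset.sum_add_distrib, Finset.sum_const, smul_eq_mul] at h3
    omega
  refine ⟨?_, hlow⟩
  -- Pigeonhole: fewer than `L` vertices cannot take all the `L` price values from 1 to `L`, so one
  -- of them is unused.
  obtain ⟨l, hl, hgap⟩ : ∃ l ∈ Finset.Icc 1 L, l ∉ T.image p := by
    by_contra! hcon
    have := Finset.card_le_card (s := Finset.Icc 1 L) (t := T.image p) hcon
    have h2 := Finset.card_image_le (s := T) (f := p)
    simp only [Nat.card_Icc] at this
    omega
  rw [Finset.mem_Icc] at hl
  have hne : ∀ w ∈ T, p w ≠ l := fun w hw e => hgap (Finset.mem_image.2 ⟨w, hw, e⟩)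
  -- König cover of the bipartite double cover: sold vertices above the gap on the right, mates of
  -- those below it on the left. Every matched edge has exactly one end in it. By slack, a mate of a
  -- vertex above the gap has no neighbour below it, since prices among its neighbours are at most
  -- one lower and the level `l` is empty.
  set Y := T.filter (fun w => l < p w) with hY
  set X := (M \ Y).image mate with hX
  have hXT : X ⊆ T := by
    intro u hu
    obtain ⟨w, hw, rfl⟩ := Finset.mem_image.1 hu
    rw [Finset.mem_sdiff, hmemM] at hw
    exact h.mate_mem w hw.1.1 hw.1.2
  have hYM : Y ⊆ M := fun w hw => by
    rw [hY, Finset.mem_filter] at hw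
    exact (hmemM w).2 ⟨hw.1, by omega⟩
  have hcov : ∀ u ∈ T, ∀ w ∈ T, E u w → u ∈ X ∨ w ∈ Y := by
    intro u hu w hw huw
    by_cases hwY : w ∈ Y
    · exact Or.inr hwY
    have hpw : p w < l := by
      have : ¬ l < p w := fun hlt => hwY (Finset.mem_filter.2 ⟨hw, hlt⟩)
      have := hne w hw
      omega
    left
    rcases h.placed u hu with ⟨y, hy, hy0, rfl⟩ | h1
    · refine Finset.mem_image_of_mem _ (Finset.mem_sdiff.2 ⟨(hmemM y).2 ⟨hy, hy0⟩, fun hyY => ?_⟩)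
      have h2 := h.slack y hy hy0 w hw huw
      have h3 := (Finset.mem_filter.1 hyY).2
      omega
    · have := h1 w hw huw
      omega
  -- Adding the two sides of the cover gives a half-integral cover of the original graph: by
  -- symmetry an edge appears in the double cover in both directions, and each copy contributes 1.
  refine ⟨fun v => (if v ∈ X then 1 else 0) + (if v ∈ Y then 1 else 0), ?_, ?_⟩
  · intro u hu w hw huw
    have h1 := hcov u hu w hw huw
    have h2 := hcov w hw u hu (hsymm _ _ huw)
    dsimp only
    split_ifs <;> first | omega | (exfalso; tauto)
  · have hYT : Y ⊆ T := Finset.filter_subset _ _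
    rw [Finset.sum_add_distrib, Finset.sum_ite_mem, Finset.sum_ite_mem,
      Finset.inter_eq_right.2 hXT, Finset.inter_eq_right.2 hYT]
    simp only [Finset.sum_const, smul_eq_mul, mul_one]
    rw [hX, Finset.card_image_of_injOn (hinj.mono (by simp)),
      Finset.card_sdiff_add_card_eq_card hYM]

end Auction

end HalfCover

/-! ### A language of bounded loops -/

/-- Commands over variables `V` and infinite arrays `A` of natural numbers. -/
inductive Cmd (V A : Type) : Type
  | skip
  /-- `x := c` -/
  | const (x : V) (c : ℕ)
  /-- `x := y` -/
  | copy (x y : V)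
  /-- `x := x + 1` -/
  | succ (x : V)
  /-- `x := y - z` -/
  | sub (x y z : V)
  /-- `x := c[i]` -/
  | load (x : V) (c : A) (i : V)
  /-- `c[i] := y` -/
  | store (c : A) (i y : V)
  | seq (s t : Cmd V A)
  /-- `s` if `x = 0`, else `t` -/
  | ifz (x : V) (s t : Cmd V A)
  /-- repeat `s` as often as the value of `x` says before the loop -/
  | loop (x : V) (s : Cmd V A)

/-- The values of the variables and the arrays. -/
@[ext] structure Store (V A : Type) : Type where
  v : V → ℕ
  a : A → ℕ → ℕ

namespace Cmd

variable {V A : Type}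

/-- Run the commands of a list one after the other. -/
def block (l : List (Cmd V A)) : Cmd V A := l.foldr seq skip

/-- The effect of a command. -/
def eval [DecidableEq V] [DecidableEq A] : Cmd V A → Store V A → Store V A
  | skip, σ => σ
  | const x c, σ => ⟨Function.update σ.v x c, σ.a⟩
  | copy x y, σ => ⟨Function.update σ.v x (σ.v y), σ.a⟩
  | succ x, σ => ⟨Function.update σ.v x (σ.v x + 1), σ.a⟩
  | sub x y z, σ => ⟨Function.update σ.v x (σ.v y - σ.v z), σ.a⟩
  | load x c i, σ => ⟨Function.update σ.v x (σ.a c (σ.v i)), σ.a⟩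
  | store c i y, σ => ⟨σ.v, Function.update σ.a c (Function.update (σ.a c) (σ.v i) (σ.v y))⟩
  | seq s t, σ => t.eval (s.eval σ)
  | ifz x s t, σ => if σ.v x = 0 then s.eval σ else t.eval σ
  | loop x s, σ => s.eval^[σ.v x] σ

section

variable [DecidableEq V] [DecidableEq A] (σ : Store V A)

@[simp] theorem eval_skip : (skip : Cmd V A).eval σ = σ := rfl

@[simp] theorem eval_const (x : V) (c : ℕ) :
    (const x c).eval σ = ⟨Function.update σ.v x c, σ.a⟩ := rfl

@[simp] theorem eval_copy (x y : V) :
    (copy x y).eval σ = ⟨Function.update σ.v x (σ.v y), σ.a⟩ := rfl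

@[simp] theorem eval_succ (x : V) :
    (succ x).eval σ = ⟨Function.update σ.v x (σ.v x + 1), σ.a⟩ := rfl

@[simp] theorem eval_sub (x y z : V) :
    (sub x y z).eval σ = ⟨Function.update σ.v x (σ.v y - σ.v z), σ.a⟩ := rfl

@[simp] theorem eval_load (x : V) (c : A) (i : V) :
    (load x c i).eval σ = ⟨Function.update σ.v x (σ.a c (σ.v i)), σ.a⟩ := rfl

@[simp] theorem eval_store (c : A) (i y : V) : (store c i y).eval σ =
    ⟨σ.v, Function.update σ.a c (Function.update (σ.a c) (σ.v i) (σ.v y))⟩ := rfl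

@[simp] theorem eval_ifz (x : V) (s t : Cmd V A) :
    (ifz x s t).eval σ = if σ.v x = 0 then s.eval σ else t.eval σ := rfl

@[simp] theorem eval_block_nil : (block ([] : List (Cmd V A))).eval σ = σ := rfl

@[simp] theorem eval_block_cons (s : Cmd V A) (l : List (Cmd V A)) :
    (block (s :: l)).eval σ = (block l).eval (s.eval σ) := rfl

end

/-- The running time of a command; assigning the constant `c` takes `c + 1` steps. -/
def steps [DecidableEq V] [DecidableEq A] : Cmd V A → Store V A → ℕ
  | skip, _ => 0
  | const _ c, _ => c + 1
  | copy _ _, _ => 1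
  | succ _, _ => 1
  | sub _ _ _, _ => 1
  | load _ _ _, _ => 1
  | store _ _ _, _ => 1
  | seq s t, σ => s.steps σ + t.steps (s.eval σ)
  | ifz x s t, σ => 1 + if σ.v x = 0 then s.steps σ else t.steps σ
  | loop x s, σ => 1 + ∑ i ∈ Finset.range (σ.v x), (1 + s.steps (s.eval^[i] σ))

/-- Does the command assign to the variable `x`? -/
def writesVar [DecidableEq V] : Cmd V A → V → Bool
  | const y _, x | copy y _, x | succ y, x | sub y _ _, x | load y _ _, x => x = y
  | seq s t, x | ifz _ s t, x => s.writesVar x || t.writesVar x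
  | loop _ s, x => s.writesVar x
  | _, _ => false

/-- Does the command assign to the array `c`? -/
def writesArr [DecidableEq A] : Cmd V A → A → Bool
  | store d _ _, c => c = d
  | seq s t, c | ifz _ s t, c => s.writesArr c || t.writesArr c
  | loop _ s, c => s.writesArr c
  | _, _ => false

theorem eval_v_of_not_writesVar [DecidableEq V] [DecidableEq A] {s : Cmd V A} {x : V}
    (h : s.writesVar x = false) :
    ∀ σ, (s.eval σ).v x = σ.v x := by
  induction s with
  | seq s t ihs iht =>
    simp only [writesVar, Bool.or_eq_false_iff] at h
    intro σ
    rw [eval, iht h.2, ihs h.1]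
  | ifz y s t ihs iht =>
    simp only [writesVar, Bool.or_eq_false_iff] at h
    intro σ
    rw [eval]
    split_ifs
    · exact ihs h.1 σ
    · exact iht h.2 σ
  | loop y s ih =>
    intro σ
    rw [eval]
    generalize σ.v y = m
    induction m with
    | zero => rfl
    | succ m ihm => rw [Function.iterate_succ_apply', ih h, ihm]
  | _ => simp_all [writesVar, eval]

theorem eval_a_of_not_writesArr [DecidableEq V] [DecidableEq A] {s : Cmd V A} {c : A}
    (h : s.writesArr c = false) :
    ∀ σ, (s.eval σ).a c = σ.a c := by
  induction s with
  | seq s t ihs iht =>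
    simp only [writesArr, Bool.or_eq_false_iff] at h
    intro σ
    rw [eval, iht h.2, ihs h.1]
  | ifz y s t ihs iht =>
    simp only [writesArr, Bool.or_eq_false_iff] at h
    intro σ
    rw [eval]
    split_ifs
    · exact ihs h.1 σ
    · exact iht h.2 σ
  | loop y s ih =>
    intro σ
    rw [eval]
    generalize σ.v y = m
    induction m with
    | zero => rfl
    | succ m ihm => rw [Function.iterate_succ_apply', ih h, ihm]
  | _ => simp_all [writesArr, eval]

theorem eval_loop_induction [DecidableEq V] [DecidableEq A] {x : V} {s : Cmd V A}
    (I : ℕ → Store V A → Prop) {σ : Store V A}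
    (h0 : I 0 σ) (hs : ∀ i τ, i < σ.v x → I i τ → I (i + 1) (s.eval τ)) :
    I (σ.v x) ((loop x s).eval σ) := by
  rw [eval]
  have : ∀ m ≤ σ.v x, I m (s.eval^[m] σ) := by
    intro m
    induction m with
    | zero => exact fun _ => h0
    | succ m ih =>
      intro hm
      rw [Function.iterate_succ_apply']
      exact hs m _ hm (ih (by omega))
  exact this _ le_rfl

/-- All loops of the command are governed by variables in `Z`, which are never assigned to. -/
def loopsIn (Z : V → Bool) : Cmd V A → Bool
  | const y _ | copy y _ | succ y | sub y _ _ | load y _ _ => !Z y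
  | seq s t | ifz _ s t => s.loopsIn Z && t.loopsIn Z
  | loop x s => Z x && s.loopsIn Z
  | _ => true

/-- A bound for the running time when no loop is repeated more than `N` times. -/
def bound (N : ℕ) : Cmd V A → ℕ
  | skip => 0
  | const _ c => c + 1
  | seq s t => s.bound N + t.bound N
  | ifz _ s t => 1 + (s.bound N + t.bound N)
  | loop _ s => 1 + N * (1 + s.bound N)
  | _ => 1

theorem writesVar_eq_false_of_loopsIn [DecidableEq V] {Z : V → Bool} {s : Cmd V A}
    (h : s.loopsIn Z = true) {x : V} (hx : Z x = true) : s.writesVar x = false := by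
  induction s with
  | seq s t ihs iht | ifz _ s t ihs iht =>
    simp only [loopsIn, Bool.and_eq_true] at h
    simp [writesVar, ihs h.1, iht h.2]
  | loop y s ih =>
    simp only [loopsIn, Bool.and_eq_true] at h
    exact ih h.2
  | skip => rfl
  | store => rfl
  | _ =>
    simp only [loopsIn, Bool.not_eq_true'] at h
    simp only [writesVar, decide_eq_false_iff_not]
    rintro rfl
    simp [h] at hx

/-- The variables in `Z` are never assigned, so one bound `N` on their initial values limits the
number of passes of every loop, however deeply nested. -/
theorem steps_le_bound [DecidableEq V] [DecidableEq A] {Z : V → Bool} {N : ℕ} {s : Cmd V A}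
    (h : s.loopsIn Z = true) :
    ∀ σ : Store V A, (∀ x, Z x = true → σ.v x ≤ N) → s.steps σ ≤ s.bound N := by
  induction s with
  | seq s t ihs iht =>
    intro σ hσ
    simp only [loopsIn, Bool.and_eq_true] at h
    refine Nat.add_le_add (ihs h.1 σ hσ) (iht h.2 _ fun x hx => ?_)
    rw [eval_v_of_not_writesVar (writesVar_eq_false_of_loopsIn h.1 hx)]
    exact hσ x hx
  | ifz y s t ihs iht =>
    intro σ hσ
    simp only [loopsIn, Bool.and_eq_true] at h
    have h1 := ihs h.1 σ hσ
    have h2 := iht h.2 σ hσ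
    simp only [steps, bound]
    split_ifs <;> omega
  | loop y s ih =>
    intro σ hσ
    simp only [loopsIn, Bool.and_eq_true] at h
    simp only [steps, bound]
    have hit : ∀ m x, Z x = true → (s.eval^[m] σ).v x ≤ N := by
      intro m x hx
      induction m with
      | zero => exact hσ x hx
      | succ m ihm =>
        rwa [Function.iterate_succ_apply',
          eval_v_of_not_writesVar (writesVar_eq_false_of_loopsIn h.2 hx)]
    refine Nat.add_le_add_left ?_ 1
    calc ∑ i ∈ Finset.range (σ.v y), (1 + s.steps (s.eval^[i] σ))
        ≤ ∑ i ∈ Finset.range (σ.v y), (1 + s.bound N) :=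
          Finset.sum_le_sum fun i _ => Nat.add_le_add_left (ih h.2 _ (hit i)) 1
      _ = σ.v y * (1 + s.bound N) := by simp
      _ ≤ N * (1 + s.bound N) := Nat.mul_le_mul_right _ (hσ y h.1)
  | _ => simp [steps, bound]

theorem exists_bound_le (s : Cmd V A) : ∃ a e : ℕ, ∀ N, s.bound N ≤ a * (N + 1) ^ e := by
  have key : ∀ (a b e f N : ℕ), a * (N + 1) ^ e + b * (N + 1) ^ f ≤ (a + b) * (N + 1) ^ (e + f) := by
    intro a b e f N
    have h1 : (N + 1) ^ e ≤ (N + 1) ^ (e + f) := Nat.pow_le_pow_right (by omega) (by omega)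
    have h2 : (N + 1) ^ f ≤ (N + 1) ^ (e + f) := Nat.pow_le_pow_right (by omega) (by omega)
    nlinarith [Nat.mul_le_mul_left a h1, Nat.mul_le_mul_left b h2]
  induction s with
  | skip => exact ⟨0, 0, fun N => by simp [bound]⟩
  | const x c => exact ⟨c + 1, 0, fun N => by simp [bound]⟩
  | seq s t ihs iht =>
    obtain ⟨a, e, h1⟩ := ihs
    obtain ⟨b, f, h2⟩ := iht
    exact ⟨a + b, e + f, fun N => (Nat.add_le_add (h1 N) (h2 N)).trans (key ..)⟩
  | ifz x s t ihs iht =>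
    obtain ⟨a, e, h1⟩ := ihs
    obtain ⟨b, f, h2⟩ := iht
    refine ⟨1 + (a + b), 0 + (e + f), fun N => ?_⟩
    refine le_trans (Nat.add_le_add_left ((Nat.add_le_add (h1 N) (h2 N)).trans (key ..)) 1) ?_
    simpa using key 1 (a + b) 0 (e + f) N
  | loop x s ih =>
    obtain ⟨a, e, h1⟩ := ih
    refine ⟨1 + (1 + a), 0 + (e + 1), fun N => ?_⟩
    have h2 : 1 + s.bound N ≤ (1 + a) * (N + 1) ^ e := by
      have := Nat.one_le_pow e (N + 1) (by omega)
      nlinarith [h1 N]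
    calc 1 + N * (1 + s.bound N) ≤ 1 * (N + 1) ^ 0 + (1 + a) * (N + 1) ^ (e + 1) := by
          rw [pow_succ]
          nlinarith [Nat.mul_le_mul_left N h2]
      _ ≤ _ := key ..
  | _ => exact ⟨1, 0, fun N => by simp [bound]⟩

end Cmd

/-! ### Runs of bounded cost -/

namespace RAM

theorem len_mono {x y : ℕ} (h : x ≤ y) : len x ≤ len y :=
  Nat.add_le_add_right (Nat.size_le_size h) 1

theorem Runs.trans {P : Program} {c c' c'' : Config} {t t' : ℕ} (h : Runs P c t c')
    (h' : Runs P c' t' c'') : Runs P c (t + t') c'' := by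
  induction h with
  | refl c => simpa using h'
  | step hi _ ih =>
    rw [add_assoc]
    exact Runs.step hi (ih h')

/-- `P` leads from `c` to `c'` with total cost at most `T`. -/
def RunsLe (P : Program) (c : Config) (T : ℕ) (c' : Config) : Prop := ∃ t ≤ T, Runs P c t c'

namespace RunsLe

variable {P : Program} {c c' c'' : Config} {T T' : ℕ}

theorem refl (P : Program) (c : Config) : RunsLe P c 0 c := ⟨0, le_rfl, Runs.refl c⟩

theorem mono (h : RunsLe P c T c') (hT : T ≤ T') : RunsLe P c T' c' := by
  obtain ⟨t, ht, h⟩ := h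
  exact ⟨t, ht.trans hT, h⟩

theorem trans (h : RunsLe P c T c') (h' : RunsLe P c' T' c'') : RunsLe P c (T + T') c'' := by
  obtain ⟨t, ht, h⟩ := h
  obtain ⟨t', ht', h'⟩ := h'
  exact ⟨t + t', Nat.add_le_add ht ht', h.trans h'⟩

end RunsLe

/-- The sum of the numbers that occur in an instruction. -/
def Instr.weight : Instr → ℕ
  | .const d v => d + v
  | .copy d s => d + s
  | .succ d => d
  | .add d a b => d + a + b
  | .sub d a b => d + a + b
  | .load d a => d + a
  | .store a s => a + s
  | .jump l => l
  | .jzero a l => a + l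

/-- The factor 5 is the largest number of lengths charged to one instruction, attained by `add` and
`sub`. -/
theorem Instr.cost_le {i : Instr} {c : Config} {U : ℕ} (hi : i.weight ≤ U)
    (hc : ∀ r, c.reg r ≤ U) : i.cost c ≤ 5 * len U := by
  have h : ∀ x, x ≤ U → len x ≤ len U := fun x => len_mono
  have h' := fun r => len_mono (hc r)
  cases i with
  | const d v =>
    simp only [weight] at hi
    have := h d (by omega); have := h v (by omega)
    simp only [cost]; omega
  | copy d s =>
    simp only [weight] at hi
    have := h d (by omega); have := h s (by omega); have := h' s
    simp only [cost]; omega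
  | succ d =>
    simp only [weight] at hi
    have := h d (by omega); have := h' d
    simp only [cost]; omega
  | add d a b | sub d a b =>
    simp only [weight] at hi
    have := h d (by omega); have := h a (by omega); have := h b (by omega)
    have := h' a; have := h' b
    simp only [cost]; omega
  | load d a =>
    simp only [weight] at hi
    have := h d (by omega); have := h a (by omega); have := h' a; have := h' (c.reg a)
    simp only [cost]; omega
  | store a s =>
    simp only [weight] at hi
    have := h a (by omega); have := h s (by omega); have := h' a; have := h' s
    simp only [cost]; omega
  | jump l =>
    simp only [weight] at hi
    have := h l (by omega)
    simp only [cost]; omega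
  | jzero a l =>
    simp only [weight] at hi
    have := h a (by omega); have := h l (by omega); have := h' a
    simp only [cost]; omega

theorem RunsLe.one {P : Program} {U o : ℕ} {reg : ℕ → ℕ} {i : Instr} (hi : P[o]? = some i)
    (hP : ∀ i ∈ P, i.weight ≤ U) (hreg : ∀ r, reg r ≤ U) :
    RunsLe P ⟨o, reg⟩ (5 * len U) (i.exec ⟨o, reg⟩) :=
  ⟨_, Instr.cost_le (hP i (List.mem_of_getElem? hi)) hreg, by
    simpa using Runs.step (c := ⟨o, reg⟩) hi (Runs.refl _)⟩

/-- The instructions `l` stand in the program `P` from number `o` on. -/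
def CodeAt (P : Program) (o : ℕ) (l : List Instr) : Prop :=
  ∃ l₁ l₂, P = l₁ ++ l ++ l₂ ∧ l₁.length = o

theorem CodeAt.left {P : Program} {o : ℕ} {l l' : List Instr} (h : CodeAt P o (l ++ l')) :
    CodeAt P o l := by
  obtain ⟨l₁, l₂, rfl, rfl⟩ := h
  exact ⟨l₁, l' ++ l₂, by simp, rfl⟩

theorem CodeAt.right {P : Program} {o : ℕ} {l l' : List Instr} (h : CodeAt P o (l ++ l')) :
    CodeAt P (o + l.length) l' := by
  obtain ⟨l₁, l₂, rfl, rfl⟩ := h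
  exact ⟨l₁ ++ l, l₂, by simp, by simp⟩

theorem CodeAt.head {P : Program} {o : ℕ} {i : Instr} {l : List Instr} (h : CodeAt P o (i :: l)) :
    P[o]? = some i := by
  obtain ⟨l₁, l₂, rfl, rfl⟩ := h
  simp

theorem CodeAt.tail {P : Program} {o : ℕ} {i : Instr} {l : List Instr} (h : CodeAt P o (i :: l)) :
    CodeAt P (o + 1) l :=
  CodeAt.right (l := [i]) h

theorem le_update {U d x : ℕ} {reg : ℕ → ℕ} (h : ∀ r, reg r ≤ U) (hx : x ≤ U) :
    ∀ r, Function.update reg d x r ≤ U := by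
  intro r
  by_cases e : r = d
  · subst e; simpa
  · simpa [e] using h r

/-! ### Compiling commands -/

/-- Numberings of variables and arrays. -/
structure Layout (V A : Type) : Type where
  var : V → ℕ
  arr : A → ℕ
  var_inj : Function.Injective var
  arr_inj : Function.Injective arr
  arr_lt : ∀ c, arr c < 13

namespace Layout

variable {V A : Type} (Λ : Layout V A)

/-- The values stored in the registers: variables have addresses `0` modulo `16`, arrays have
addresses `3, …, 15` modulo `16`. Of the other registers, those with address `1` modulo `16` are
loop counters, and `2` and `18` are for auxiliary calculations. -/
def view (reg : ℕ → ℕ) : Store V A :=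
  ⟨fun x => reg (16 * Λ.var x), fun c i => reg (16 * i + 3 + Λ.arr c)⟩

/-- Compute the address of `c[i]` in register `2`. -/
def address (c : A) (i : V) : List Instr :=
  [.copy 2 (16 * Λ.var i), .add 2 2 2, .add 2 2 2, .add 2 2 2, .add 2 2 2,
    .const 18 (3 + Λ.arr c), .add 2 2 18]

/-- The number of instructions of a compiled command. -/
def size : Cmd V A → ℕ
  | .skip => 0
  | .load _ _ _ | .store _ _ _ => 8
  | .seq s t => size s + size t
  | .ifz _ s t => size t + size s + 2
  | .loop _ s => size s + 5
  | _ => 1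

/-- The code for a command inside `d` loops, to be placed from instruction number `o` on. -/
def code : Cmd V A → ℕ → ℕ → List Instr
  | .skip, _, _ => []
  | .const x c, _, _ => [.const (16 * Λ.var x) c]
  | .copy x y, _, _ => [.copy (16 * Λ.var x) (16 * Λ.var y)]
  | .succ x, _, _ => [.succ (16 * Λ.var x)]
  | .sub x y z, _, _ => [.sub (16 * Λ.var x) (16 * Λ.var y) (16 * Λ.var z)]
  | .load x c i, _, _ => Λ.address c i ++ [.load (16 * Λ.var x) 2]
  | .store c i y, _, _ => Λ.address c i ++ [.store 2 (16 * Λ.var y)]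
  | .seq s t, d, o => code s d o ++ code t d (o + size s)
  | .ifz x s t, d, o => .jzero (16 * Λ.var x) (o + size t + 2) :: code t d (o + 1) ++
      .jump (o + size t + size s + 2) :: code s d (o + size t + 2)
  | .loop x s, d, o => .copy (16 * d + 1) (16 * Λ.var x) :: .jzero (16 * d + 1) (o + size s + 5) ::
      code s (d + 1) (o + 2) ++ [.const 2 1, .sub (16 * d + 1) (16 * d + 1) 2, .jump (o + 1)]

theorem length_code (s : Cmd V A) : ∀ d o, (Λ.code s d o).length = size s := by
  induction s with
  | seq s t ihs iht => intro d o; simp [code, size, ihs, iht]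
  | ifz x s t ihs iht => intro d o; simp [code, size, ihs, iht]; omega
  | loop x s ih => intro d o; simp [code, size, ih]
  | _ => intro d o; simp [code, size, address]

/-- Registers other than the auxiliary ones hold at most `v`. -/
structure Small (v : ℕ) (reg : ℕ → ℕ) : Prop where
  main : ∀ r, r ≠ 2 → r ≠ 18 → reg r ≤ v
  aux : reg 2 ≤ 16 * v + 16
  aux' : reg 18 ≤ 16 * v + 16

theorem Small.le {v : ℕ} {reg : ℕ → ℕ} (h : Small v reg) (r : ℕ) : reg r ≤ 16 * v + 16 := by
  by_cases h2 : r = 2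
  · rw [h2]; exact h.aux
  by_cases h18 : r = 18
  · rw [h18]; exact h.aux'
  · exact (h.main r h2 h18).trans (by omega)

theorem Small.mono {v v' : ℕ} {reg : ℕ → ℕ} (h : Small v reg) (hv : v ≤ v') : Small v' reg :=
  ⟨fun r h2 h18 => (h.main r h2 h18).trans hv, h.aux.trans (by omega), h.aux'.trans (by omega)⟩

theorem Small.update {v d x : ℕ} {reg : ℕ → ℕ} (h : Small v reg) (h2 : d ≠ 2) (h18 : d ≠ 18)
    (hx : x ≤ v) : Small v (Function.update reg d x) where
  main r hr hr' := by
    by_cases e : r = d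
    · subst e; simpa
    · simpa [e] using h.main r hr hr'
  aux := by simpa [h2.symm] using h.aux
  aux' := by simpa [h18.symm] using h.aux'

theorem Small.update_two {v x : ℕ} {reg : ℕ → ℕ} (h : Small v reg) (hx : x ≤ 16 * v + 16) :
    Small v (Function.update reg 2 x) where
  main r hr hr' := by simpa [hr] using h.main r hr hr'
  aux := by simpa using hx
  aux' := by simpa using h.aux'

theorem Small.update_eighteen {v x : ℕ} {reg : ℕ → ℕ} (h : Small v reg) (hx : x ≤ 16 * v + 16) :
    Small v (Function.update reg 18 x) where
  main r hr hr' := by simpa [hr'] using h.main r hr hr'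
  aux := by simpa using h.aux
  aux' := by simpa using hx

theorem view_update_two (reg : ℕ → ℕ) (x : ℕ) : Λ.view (Function.update reg 2 x) = Λ.view reg := by
  ext y
  · simp only [view]
    rw [Function.update_of_ne (by omega)]
  · simp only [view]
    rw [Function.update_of_ne (by have := Λ.arr_lt y; omega)]

theorem view_update_eighteen (reg : ℕ → ℕ) (x : ℕ) :
    Λ.view (Function.update reg 18 x) = Λ.view reg := by
  ext y
  · simp only [view]
    rw [Function.update_of_ne (by omega)]
  · simp only [view]
    rw [Function.update_of_ne (by have := Λ.arr_lt y; omega)]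

theorem view_update_counter (reg : ℕ → ℕ) (d x : ℕ) :
    Λ.view (Function.update reg (16 * d + 1) x) = Λ.view reg := by
  ext y
  · simp only [view]
    rw [Function.update_of_ne (by omega)]
  · simp only [view]
    rw [Function.update_of_ne (by have := Λ.arr_lt y; omega)]

theorem view_update_var [DecidableEq V] (reg : ℕ → ℕ) (x : V) (m : ℕ) :
    Λ.view (Function.update reg (16 * Λ.var x) m) =
      ⟨Function.update (Λ.view reg).v x m, (Λ.view reg).a⟩ := by
  ext y
  · by_cases e : y = x
    · subst e; simp [view]
    · have : Λ.var y ≠ Λ.var x := fun h => e (Λ.var_inj h)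
      simp only [view, Function.update_of_ne e]
      rw [Function.update_of_ne (by omega)]
  · simp only [view]
    rw [Function.update_of_ne (by have := Λ.arr_lt y; omega)]

theorem view_update_arr [DecidableEq A] (reg : ℕ → ℕ) (c : A) (i m : ℕ) :
    Λ.view (Function.update reg (16 * i + 3 + Λ.arr c) m) =
      ⟨(Λ.view reg).v, Function.update (Λ.view reg).a c
        (Function.update ((Λ.view reg).a c) i m)⟩ := by
  have h1 := Λ.arr_lt c
  ext y j
  · simp only [view]
    rw [Function.update_of_ne (by omega)]
  · have h2 := Λ.arr_lt y
    by_cases e : y = c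
    · subst e
      by_cases e' : j = i
      · subst e'; simp [view]
      · simp only [view, Function.update_self, Function.update_of_ne e']
        rw [Function.update_of_ne (by omega)]
    · have : Λ.arr y ≠ Λ.arr c := fun h => e (Λ.arr_inj h)
      simp only [view, Function.update_of_ne e]
      rw [Function.update_of_ne (by omega)]

/-- Four doublings multiply the index by 16. The intermediate values are at most `16 * v + 16`,
which is why `Small` allows that much in registers 2 and 18. -/
theorem runsLe_address {P : Program} {U v o : ℕ} {reg : ℕ → ℕ} {c : A} {i : V}
    (hP : ∀ i ∈ P, i.weight ≤ U) (hU : 16 * v + 16 ≤ U) (hcode : CodeAt P o (Λ.address c i))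
    (hreg : Small v reg) :
    ∃ reg', RunsLe P ⟨o, reg⟩ (7 * (5 * len U)) ⟨o + 7, reg'⟩ ∧ Λ.view reg' = Λ.view reg ∧
      Small v reg' ∧ reg' 2 = 16 * (Λ.view reg).v i + 3 + Λ.arr c ∧
      ∀ d, reg' (16 * d + 1) = reg (16 * d + 1) := by
  have hi : (Λ.view reg).v i ≤ v := hreg.main _ (by omega) (by omega)
  have hc := Λ.arr_lt c
  set x := (Λ.view reg).v i with hx
  have hx' : reg (16 * Λ.var i) = x := rfl
  have h1 := hreg.update_two (x := x) (by omega)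
  have h2 := hreg.update_two (x := 2 * x) (by omega)
  have h3 := hreg.update_two (x := 2 * (2 * x)) (by omega)
  have h4 := hreg.update_two (x := 2 * (2 * (2 * x))) (by omega)
  have h5 := hreg.update_two (x := 2 * (2 * (2 * (2 * x)))) (by omega)
  have h6 := h5.update_eighteen (x := 3 + Λ.arr c) (by omega)
  have h7 := h6.update_two (x := 2 * (2 * (2 * (2 * x))) + (3 + Λ.arr c)) (by omega)
  have hone : ∀ {o reg i}, P[o]? = some i → Small v reg →
      RunsLe P ⟨o, reg⟩ (5 * len U) (i.exec ⟨o, reg⟩) := fun hi h =>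
    RunsLe.one hi hP fun r => (h.le r).trans hU
  have r1 := hone hcode.head hreg
  have r2 := hone hcode.tail.head h1
  have r3 := hone hcode.tail.tail.head h2
  have r4 := hone hcode.tail.tail.tail.head h3
  have r5 := hone hcode.tail.tail.tail.tail.head h4
  have r6 := hone hcode.tail.tail.tail.tail.tail.head h5
  have r7 := hone hcode.tail.tail.tail.tail.tail.tail.head h6
  simp only [Instr.exec, Function.update_self, Function.update_idem, hx', ← two_mul]
    at r1 r2 r3 r4 r5 r6 r7
  rw [Function.update_of_ne (by norm_num), Function.update_self] at r7
  refine ⟨_, (r1.trans (r2.trans (r3.trans (r4.trans (r5.trans (r6.trans r7)))))).mono (by omega),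
    ?_, h7, ?_, ?_⟩
  · simp only [view_update_two, view_update_eighteen]
  · rw [Function.update_self]
    omega
  · intro d
    rw [Function.update_of_ne (by omega), Function.update_of_ne (by omega),
      Function.update_of_ne (by omega)]

/-- A compiled command has the effect of the command, at a cost which is proportional to its
running time. -/
theorem runsLe_code [DecidableEq V] [DecidableEq A] {P : Program} {U : ℕ}
    (hP : ∀ i ∈ P, i.weight ≤ U) (s : Cmd V A) :
    ∀ (d o v : ℕ) (reg : ℕ → ℕ), CodeAt P o (Λ.code s d o) → Small v reg →
      16 * (v + s.steps (Λ.view reg)) + 16 ≤ U →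
      ∃ reg', RunsLe P ⟨o, reg⟩ (s.steps (Λ.view reg) * (8 * (5 * len U))) ⟨o + size s, reg'⟩ ∧
        Λ.view reg' = s.eval (Λ.view reg) ∧ Small (v + s.steps (Λ.view reg)) reg' ∧
        ∀ d' < d, reg' (16 * d' + 1) = reg (16 * d' + 1) := by
  have hone : ∀ {v o reg i}, 16 * v + 16 ≤ U → P[o]? = some i → Small v reg →
      RunsLe P ⟨o, reg⟩ (5 * len U) (i.exec ⟨o, reg⟩) := fun hU hi h =>
    RunsLe.one hi hP fun r => (h.le r).trans hU
  -- An assignment raises the largest value by at most 1 per step: the commands have no addition,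
  -- and a constant `c` is charged `c + 1` steps. Hence `v` plus the running time bounds all main
  -- registers. The factor 8 is the length of the longest simple command, an array access.
  have hassign : ∀ {v o reg i x m}, 16 * v + 16 ≤ U → P[o]? = some i → Small v reg →
      i.exec ⟨o, reg⟩ = ⟨o + 1, Function.update reg (16 * Λ.var x) m⟩ → m ≤ v + 1 →
      ∃ reg', RunsLe P ⟨o, reg⟩ (1 * (8 * (5 * len U))) ⟨o + 1, reg'⟩ ∧
        Λ.view reg' = ⟨Function.update (Λ.view reg).v x m, (Λ.view reg).a⟩ ∧ Small (v + 1) reg' ∧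
        ∀ d', reg' (16 * d' + 1) = reg (16 * d' + 1) := by
    intro v o reg i x m hU hi hreg hex hm
    refine ⟨_, hex ▸ (hone hU hi hreg).mono (by omega), Λ.view_update_var _ _ _,
      (hreg.mono (by omega)).update (by omega) (by omega) hm, fun d' => ?_⟩
    rw [Function.update_of_ne (by omega)]
  have hvar : ∀ {v reg}, Small v reg → ∀ x, reg (16 * Λ.var x) ≤ v := fun h x =>
    h.main _ (by omega) (by omega)
  induction s with
  | skip =>
    intro d o v reg _ hreg _
    exact ⟨reg, by simpa [Cmd.steps, size] using RunsLe.refl P _, rfl, by simpa [Cmd.steps] using hreg,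
      fun _ _ => rfl⟩
  | const x c =>
    intro d o v reg hcode hreg hU
    simp only [Cmd.steps] at hU ⊢
    have r := hone (by omega) hcode.head hreg
    refine ⟨_, r.mono (by nlinarith [Nat.zero_le (len U), Nat.zero_le c]), Λ.view_update_var _ _ _,
      (hreg.mono (by omega)).update (by omega) (by omega) (by omega), fun d' _ => ?_⟩
    rw [Function.update_of_ne (by omega)]
  | copy x y =>
    intro d o v reg hcode hreg hU
    simp only [Cmd.steps] at hU ⊢
    obtain ⟨reg', h1, h2, h3, h4⟩ := hassign (by omega) hcode.head hreg rfl
      ((hvar hreg y).trans (by omega))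
    exact ⟨reg', h1, h2, h3, fun d' _ => h4 d'⟩
  | succ x =>
    intro d o v reg hcode hreg hU
    simp only [Cmd.steps] at hU ⊢
    obtain ⟨reg', h1, h2, h3, h4⟩ := hassign (by omega) hcode.head hreg rfl
      (Nat.add_le_add_right (hvar hreg x) 1)
    exact ⟨reg', h1, h2, h3, fun d' _ => h4 d'⟩
  | sub x y z =>
    intro d o v reg hcode hreg hU
    simp only [Cmd.steps] at hU ⊢
    obtain ⟨reg', h1, h2, h3, h4⟩ := hassign (by omega) hcode.head hreg rfl
      ((Nat.sub_le _ _).trans ((hvar hreg y).trans (by omega)))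
    exact ⟨reg', h1, h2, h3, fun d' _ => h4 d'⟩
  | load x c i =>
    intro d o v reg hcode hreg hU
    simp only [Cmd.steps] at hU ⊢
    obtain ⟨reg₁, h1, h2, h3, h4, h5⟩ := Λ.runsLe_address hP (by omega) hcode.left hreg
    have r := hone (by omega) hcode.right.head h3
    have hval : reg₁ (reg₁ 2) = (Λ.view reg).a c ((Λ.view reg).v i) := by
      rw [h4, ← h2]; rfl
    simp only [Instr.exec, hval] at r
    have hc := Λ.arr_lt c
    refine ⟨_, (h1.trans r).mono (by omega), ?_, ?_, fun d' _ => ?_⟩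
    · rw [view_update_var, h2]; rfl
    · refine (h3.mono (by omega)).update (by omega) (by omega) ?_
      exact (hreg.main _ (by omega) (by omega)).trans (Nat.le_succ v)
    · rw [Function.update_of_ne (by omega), h5]
  | store c i y =>
    intro d o v reg hcode hreg hU
    simp only [Cmd.steps] at hU ⊢
    obtain ⟨reg₁, h1, h2, h3, h4, h5⟩ := Λ.runsLe_address hP (by omega) hcode.left hreg
    have r := hone (by omega) hcode.right.head h3
    have hval : reg₁ (16 * Λ.var y) = (Λ.view reg).v y := by
      rw [← h2]; rfl
    simp only [Instr.exec, hval, h4] at r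
    have hc := Λ.arr_lt c
    refine ⟨_, (h1.trans r).mono (by omega), ?_, ?_, fun d' _ => ?_⟩
    · rw [view_update_arr, h2]; rfl
    · refine (h3.mono (by omega)).update (by omega) (by omega) ?_
      exact (hvar hreg y).trans (Nat.le_succ v)
    · rw [Function.update_of_ne (by omega), h5]
  | seq s t ihs iht =>
    intro d o v reg hcode hreg hU
    simp only [Cmd.steps] at hU ⊢
    obtain ⟨reg₁, h1, h2, h3, h4⟩ := ihs d o v reg hcode.left hreg (by omega)
    have hc := hcode.right
    rw [length_code] at hc
    obtain ⟨reg₂, k1, k2, k3, k4⟩ := iht d _ _ reg₁ hc h3 (by rw [h2]; omega)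
    rw [h2] at k1 k2 k3
    refine ⟨reg₂, ?_, k2, by rwa [← add_assoc], fun d' hd => (k4 d' hd).trans (h4 d' hd)⟩
    rw [add_mul, size, ← add_assoc]
    exact h1.trans k1
  | ifz x s t ihs iht =>
    intro d o v reg hcode hreg hU
    simp only [Cmd.steps] at hU ⊢
    rw [code, List.cons_append] at hcode
    have r := hone (by omega) hcode.head hreg
    have hct := hcode.tail.left
    have hcj := hcode.tail.right
    rw [length_code] at hcj
    have hcs := hcj.tail
    by_cases hx : (Λ.view reg).v x = 0
    · have hx' : reg (16 * Λ.var x) = 0 := hx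
      simp only [Cmd.eval, hx, if_true] at hU ⊢
      simp only [Instr.exec, hx', if_true] at r
      have e : o + 1 + size t + 1 = o + size t + 2 := by omega
      rw [e] at hcs
      obtain ⟨reg₁, h1, h2, h3, h4⟩ := ihs d _ v reg hcs hreg (by omega)
      refine ⟨reg₁, ?_, h2, h3.mono (by omega), h4⟩
      have e' : o + size (.ifz x s t) = o + size t + 2 + size s := by simp only [size]; omega
      rw [e', add_mul]
      exact (r.trans h1).mono (by omega)
    · have hx' : ¬ reg (16 * Λ.var x) = 0 := hx
      simp only [Cmd.eval, hx, if_false] at hU ⊢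
      simp only [Instr.exec, hx', if_false] at r
      obtain ⟨reg₁, h1, h2, h3, h4⟩ := iht d _ v reg hct hreg (by omega)
      have r' := hone (by omega) hcj.head h3
      simp only [Instr.exec] at r'
      refine ⟨reg₁, ?_, h2, h3.mono (by omega), h4⟩
      have e' : o + size (.ifz x s t) = o + size t + size s + 2 := by simp only [size]; omega
      rw [e', add_mul]
      exact (r.trans (h1.trans r')).mono (by omega)
  | loop x s ih =>
    intro d o v reg hcode hreg hU
    simp only [Cmd.steps] at hU ⊢
    rw [code, List.cons_append, List.cons_append] at hcode
    have hcb := hcode.tail.tail.left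
    have hcr := hcode.tail.tail.right
    rw [length_code] at hcr
    set σ := Λ.view reg with hσ
    set m := σ.v x with hm
    have hmv : m ≤ v := hvar hreg x
    -- Invariant at the loop test, after `j` passes. The term `5 * len U` pays for copying the
    -- counter. In each pass the extra unit pays for four instructions: the test, loading 1, the
    -- subtraction and the jump back.
    have key : ∀ j ≤ m, ∃ reg', RunsLe P ⟨o, reg⟩
        (5 * len U + (∑ i ∈ Finset.range j, (1 + s.steps (s.eval^[i] σ))) * (8 * (5 * len U)))
        ⟨o + 1, reg'⟩ ∧ Λ.view reg' = s.eval^[j] σ ∧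
        Small (v + ∑ i ∈ Finset.range j, (1 + s.steps (s.eval^[i] σ))) reg' ∧
        reg' (16 * d + 1) = m - j ∧ ∀ d' < d, reg' (16 * d' + 1) = reg (16 * d' + 1) := by
      intro j
      induction j with
      | zero =>
        intro _
        have r := hone (by omega) hcode.head hreg
        refine ⟨_, r.mono (by simp), Λ.view_update_counter _ _ _, ?_, by simp; rfl, ?_⟩
        · simpa using hreg.update (x := reg (16 * Λ.var x)) (by omega) (by omega) hmv
        · intro d' hd'
          simp only
          rw [Function.update_of_ne (by omega)]
      | succ j ihj =>
        intro hj
        obtain ⟨reg₁, h1, h2, h3, h4, h5⟩ := ihj (by omega)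
        have hle : ∑ i ∈ Finset.range (j + 1), (1 + s.steps (s.eval^[i] σ)) ≤
            ∑ i ∈ Finset.range m, (1 + s.steps (s.eval^[i] σ)) :=
          Finset.sum_le_sum_of_subset (Finset.range_subset_range.2 hj)
        rw [Finset.sum_range_succ] at hle ⊢
        set q := ∑ i ∈ Finset.range j, (1 + s.steps (s.eval^[i] σ))
        set q' := ∑ i ∈ Finset.range m, (1 + s.steps (s.eval^[i] σ))
        have r1 := hone (by omega) hcode.tail.head h3
        have hne : ¬ reg₁ (16 * d + 1) = 0 := by omega
        simp only [Instr.exec, hne, if_false] at r1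
        obtain ⟨reg₂, k1, k2, k3, k4⟩ := ih (d + 1) _ _ reg₁ hcb h3 (by rw [h2]; omega)
        rw [h2] at k1 k2 k3
        have k5 := k3.update_two (x := 1) (by omega)
        -- The body is compiled at depth `d + 1`, so the loops inside it use other counters and this
        -- one survives.
        have hcnt : reg₂ (16 * d + 1) = m - j := by rw [k4 d (by omega), h4]
        have k6 := k5.update (d := 16 * d + 1) (x := m - j - 1) (by omega) (by omega) (by omega)
        have r2 := hone (by omega) hcr.head k3
        have r3 := hone (by omega) hcr.tail.head k5
        have r4 := hone (by omega) hcr.tail.tail.head k6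
        simp only [Instr.exec] at r2 r3 r4
        rw [Function.update_self, Function.update_of_ne (by omega), hcnt] at r3
        refine ⟨_, (h1.trans (r1.trans (k1.trans (r2.trans (r3.trans r4))))).mono ?_, ?_, ?_, ?_, ?_⟩
        · rw [add_mul, add_mul]
          omega
        · rw [view_update_counter, view_update_two, k2, Function.iterate_succ_apply']
        · exact k6.mono (by omega)
        · rw [Function.update_self]; omega
        · intro d' hd'
          rw [Function.update_of_ne (by omega), Function.update_of_ne (by omega),
            k4 d' (by omega), h5 d' hd']
    obtain ⟨reg', h1, h2, h3, h4, h5⟩ := key m le_rfl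
    have r := hone (by omega) hcode.tail.head h3
    have h0 : reg' (16 * d + 1) = 0 := by omega
    simp only [Instr.exec, h0, if_true] at r
    refine ⟨reg', ?_, h2, h3.mono (by omega), h5⟩
    have e' : o + size (.loop x s) = o + size s + 5 := by simp only [size]; omega
    rw [e', add_mul]
    exact (h1.trans r).mono (by omega)

end Layout

end RAM

/-! ### Spreading out the input -/

namespace RAM

/-- The registers `0, …, 3` hold `a`, `b`, `c`, `d`, and the others are as in `f`. -/
def quad (a b c d : ℕ) (f : ℕ → ℕ) : ℕ → ℕ
  | 0 => a
  | 1 => b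
  | 2 => c
  | 3 => d
  | r => f r

section

variable {a b c d x : ℕ} {f : ℕ → ℕ}

theorem quad_zero : quad a b c d f 0 = a := rfl
theorem quad_one : quad a b c d f 1 = b := rfl
theorem quad_two : quad a b c d f 2 = c := rfl
theorem quad_three : quad a b c d f 3 = d := rfl

theorem quad_of_le {r : ℕ} (h : 4 ≤ r) : quad a b c d f r = f r := by
  unfold quad
  split <;> omega

theorem update_quad_one : Function.update (quad a b c d f) 1 x = quad a x c d f := by
  funext r
  unfold quad
  rcases r with _ | _ | _ | _ | r <;> simp

theorem update_quad_two : Function.update (quad a b c d f) 2 x = quad a b x d f := by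
  funext r
  unfold quad
  rcases r with _ | _ | _ | _ | r <;> simp

theorem update_quad_three : Function.update (quad a b c d f) 3 x = quad a b c x f := by
  funext r
  unfold quad
  rcases r with _ | _ | _ | _ | r <;> simp

theorem update_quad_of_le {r : ℕ} (h : 4 ≤ r) :
    Function.update (quad a b c d f) r x = quad a b c d (Function.update f r x) := by
  funext q
  by_cases e : q = r
  · subst e; simp [quad_of_le h]
  · rw [Function.update_of_ne e]
    unfold quad
    split <;> simp [e]

theorem quad_le {U : ℕ} (ha : a ≤ U) (hb : b ≤ U) (hc : c ≤ U) (hd : d ≤ U) (hf : ∀ r, f r ≤ U) :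
    ∀ r, quad a b c d f r ≤ U := by
  intro r
  unfold quad
  split <;> first | assumption | exact hf _

theorem quad_self : quad (f 0) (f 1) (f 2) (f 3) f = f := by
  funext r
  unfold quad
  split <;> rfl

end

/-- Started with `n` in register `0`, put the contents of register `3 + i` into register
`16 * i + 3`, for a range of numbers `i` which includes `0, …, n * n`. The contents of the registers
`1` and `2` are treated as if they stood in the registers `n + 4` and `2 * n + 5`. -/
def spread : List Instr :=
  [.copy 3 0, .succ 3, .succ 3, .succ 3, .succ 3, .store 3 1, .add 3 3 0, .succ 3, .store 3 2,
    .copy 1 0,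
    .jzero 1 15, .add 3 3 0, .const 2 1, .sub 1 1 2, .jump 10,
    .jzero 3 31, .const 2 3, .add 2 2 3, .load 1 2, .copy 2 3, .add 2 2 2, .add 2 2 2, .add 2 2 2,
    .add 2 2 2, .succ 2, .succ 2, .succ 2, .store 2 1, .const 2 1, .sub 3 3 2, .jump 15]

-- Matrix entry `i` stands in register `3 + i`, so `B` and `k` move to the matrix positions `n + 1`
-- and `2 * n + 2`. These have the form `c * n + c`: they lie on the diagonal, where the entries are
-- known to be zero, or beyond the end. This frees registers 1 and 2 for the calculation. The bound
-- `N` reaches past the matrix and past both positions. Index 0 is excluded from the conclusion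
-- because its target, register 3, is the loop counter.
set_option maxHeartbeats 1000000 in
theorem runsLe_spread {P : Program} {l : List Instr} {U n B k v N : ℕ} {f : ℕ → ℕ}
    (hPl : P = spread ++ l) (hP : ∀ i ∈ P, i.weight ≤ U) (hN : N = n * n + 2 * n + 5)
    (hf : ∀ r, f r ≤ v) (hn : n ≤ v) (hB : B ≤ v) (hk : k ≤ v) (hU : v + 16 * N + 16 ≤ U) :
    ∃ reg, RunsLe P ⟨0, quad n B k 0 f⟩ ((22 * N) * (5 * len U)) ⟨31, reg⟩ ∧
      reg 0 = n ∧ reg 3 = 0 ∧ (∀ r, reg r ≤ v + 16 * N + 16) ∧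
      ∀ i, 1 ≤ i → i ≤ N →
        reg (16 * i + 3) = Function.update (Function.update f (n + 4) B) (2 * n + 5) k (3 + i) := by
  have hget : ∀ {o : ℕ} {i : Instr}, spread[o]? = some i → P[o]? = some i := by
    intro o i h
    rw [hPl, List.getElem?_append_left, h]
    rw [List.getElem?_eq_some_iff] at h
    exact h.1
  set g := Function.update (Function.update f (n + 4) B) (2 * n + 5) k with hg
  have hf1 : ∀ r, Function.update f (n + 4) B r ≤ v := le_update hf hB
  have hg1 : ∀ r, g r ≤ v := le_update hf1 hk
  set W := v + 16 * N + 16 with hW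
  have step : ∀ {o a b c d : ℕ} {f : ℕ → ℕ} {i : Instr}, spread[o]? = some i → a ≤ W → b ≤ W → c ≤ W → d ≤ W →
      (∀ r, f r ≤ W) →
      RunsLe P ⟨o, quad a b c d f⟩ (5 * len U) (i.exec ⟨o, quad a b c d f⟩) := by
    intro o a b c d f i hi ha hb hc hd hf
    exact RunsLe.one (hget hi) hP fun r => (quad_le ha hb hc hd hf r).trans hU
  have phase1 : RunsLe P ⟨0, quad n B k 0 f⟩ (10 * (5 * len U)) ⟨10, quad n n k (2 * n + 5) g⟩ := by
    have hfW : ∀ r, f r ≤ W := fun r => (hf r).trans (by omega)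
    have hfW1 : ∀ r, Function.update f (n + 4) B r ≤ W := fun r => (hf1 r).trans (by omega)
    have hgW : ∀ r, g r ≤ W := fun r => (hg1 r).trans (by omega)
    have r0 := step (o := 0) (a := n) (b := B) (c := k) (d := 0) rfl (by omega) (by omega)
      (by omega) (by omega) hfW
    have r1 := step (o := 1) (a := n) (b := B) (c := k) (d := n) rfl (by omega) (by omega)
      (by omega) (by omega) hfW
    have r2 := step (o := 2) (a := n) (b := B) (c := k) (d := n + 1) rfl (by omega) (by omega)
      (by omega) (by omega) hfW
    have r3 := step (o := 3) (a := n) (b := B) (c := k) (d := n + 1 + 1) rfl (by omega) (by omega)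
      (by omega) (by omega) hfW
    have r4 := step (o := 4) (a := n) (b := B) (c := k) (d := n + 1 + 1 + 1) rfl (by omega)
      (by omega) (by omega) (by omega) hfW
    have r5 := step (o := 5) (a := n) (b := B) (c := k) (d := n + 4) rfl (by omega)
      (by omega) (by omega) (by omega) hfW
    have r6 := step (o := 6) (a := n) (b := B) (c := k) (d := n + 4) rfl (by omega)
      (by omega) (by omega) (by omega) hfW1
    have r7 := step (o := 7) (a := n) (b := B) (c := k) (d := n + 4 + n) rfl (by omega)
      (by omega) (by omega) (by omega) hfW1
    have r8 := step (o := 8) (a := n) (b := B) (c := k) (d := 2 * n + 5) rfl (by omega)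
      (by omega) (by omega) (by omega) hfW1
    have r9 := step (o := 9) (a := n) (b := B) (c := k) (d := 2 * n + 5) rfl (by omega)
      (by omega) (by omega) (by omega) hgW
    simp only [Instr.exec, quad_zero, quad_one, quad_two, quad_three, update_quad_one,
      update_quad_three] at r0 r1 r2 r3 r4 r5 r6 r7 r8 r9
    rw [update_quad_of_le (by omega)] at r5 r8
    rw [show n + 4 + n + 1 = 2 * n + 5 by omega] at r7
    exact (r0.trans (r1.trans (r2.trans (r3.trans (r4.trans (r5.trans (r6.trans (r7.trans
      (r8.trans r9))))))))).mono (by omega)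
  have hgW : ∀ r, g r ≤ W := fun r => (hg1 r).trans (by omega)
  -- Without multiplication, `n * n` is obtained by adding `n` in each of `n` passes; `2 * n + 5` is
  -- already in register 3, so the result is `N`.
  have phase2 : ∀ j ≤ n, ∃ c ≤ W, RunsLe P ⟨10, quad n n k (2 * n + 5) g⟩ (j * (5 * (5 * len U)))
      ⟨10, quad n (n - j) c (2 * n + 5 + j * n) g⟩ := by
    intro j
    induction j with
    | zero => exact fun _ => ⟨k, by omega, by simpa using RunsLe.refl P _⟩
    | succ j ih =>
      intro hj
      obtain ⟨c, hc, h⟩ := ih (by omega)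
      have hjn : (j + 1) * n ≤ n * n := Nat.mul_le_mul_right n hj
      have e : (j + 1) * n = j * n + n := by ring
      have r0 := step (o := 10) (a := n) (b := n - j) (c := c) (d := 2 * n + 5 + j * n) rfl
        (by omega) (by omega) hc (by omega) hgW
      have r1 := step (o := 11) (a := n) (b := n - j) (c := c) (d := 2 * n + 5 + j * n) rfl
        (by omega) (by omega) hc (by omega) hgW
      have r2 := step (o := 12) (a := n) (b := n - j) (c := c) (d := 2 * n + 5 + j * n + n) rfl
        (by omega) (by omega) hc (by omega) hgW
      have r3 := step (o := 13) (a := n) (b := n - j) (c := 1) (d := 2 * n + 5 + j * n + n) rfl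
        (by omega) (by omega) (by omega) (by omega) hgW
      have r4 := step (o := 14) (a := n) (b := n - j - 1) (c := 1) (d := 2 * n + 5 + j * n + n) rfl
        (by omega) (by omega) (by omega) (by omega) hgW
      have hne : ¬ n - j = 0 := by omega
      simp only [Instr.exec, quad_zero, quad_one, quad_two, quad_three, update_quad_one,
        update_quad_two, update_quad_three, hne, if_false] at r0 r1 r2 r3 r4
      refine ⟨1, by omega, ?_⟩
      rw [e, ← add_assoc, ← Nat.sub_sub]
      exact (h.trans (r0.trans (r1.trans (r2.trans (r3.trans r4))))).mono
        (by rw [add_mul]; omega)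
  obtain ⟨c₀, hc₀, h2⟩ := phase2 n le_rfl
  have r := step (o := 10) (a := n) (b := 0) (c := c₀) (d := N) rfl
    (by omega) (by omega) hc₀ (by omega) hgW
  simp only [Instr.exec, quad_one, if_true] at r
  rw [Nat.sub_self, show 2 * n + 5 + n * n = N by omega] at h2
  -- The entries are moved from the highest index downwards. The target `16 * q + 3` of index `q ≥
  -- 1` lies above all sources still to be read, so nothing is overwritten too early.
  have phase3 : ∀ j ≤ N, ∃ b c h, b ≤ W ∧ c ≤ W ∧ (∀ r, h r ≤ W) ∧
      RunsLe P ⟨15, quad n 0 c₀ N g⟩ (j * (16 * (5 * len U))) ⟨15, quad n b c (N - j) h⟩ ∧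
      (∀ r, 4 ≤ r → r ≤ 3 + (N - j) → h r = g r) ∧
      ∀ i, N - j < i → i ≤ N → h (16 * i + 3) = g (3 + i) := by
    intro j
    induction j with
    | zero =>
      exact fun _ => ⟨0, c₀, g, by omega, hc₀, hgW, by simpa using RunsLe.refl P _,
        fun _ _ _ => rfl, fun i _ _ => by omega⟩
    | succ j ih =>
      intro hj
      obtain ⟨b, c, h, hb, hc, hh, hrun, hlow, hhigh⟩ := ih (by omega)
      set q := N - j with hq
      have hval : h (3 + q) = g (3 + q) := hlow _ (by omega) (by omega)
      have hgq : g (3 + q) ≤ W := hgW _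
      have r0 := step (o := 15) (a := n) (b := b) (c := c) (d := q) rfl
        (by omega) hb hc (by omega) hh
      have r1 := step (o := 16) (a := n) (b := b) (c := c) (d := q) rfl
        (by omega) hb hc (by omega) hh
      have r2 := step (o := 17) (a := n) (b := b) (c := 3) (d := q) rfl
        (by omega) hb (by omega) (by omega) hh
      have r3 := step (o := 18) (a := n) (b := b) (c := 3 + q) (d := q) rfl
        (by omega) hb (by omega) (by omega) hh
      have r4 := step (o := 19) (a := n) (b := g (3 + q)) (c := 3 + q) (d := q) rfl
        (by omega) hgq (by omega) (by omega) hh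
      have r5 := step (o := 20) (a := n) (b := g (3 + q)) (c := q) (d := q) rfl
        (by omega) hgq (by omega) (by omega) hh
      have r6 := step (o := 21) (a := n) (b := g (3 + q)) (c := q + q) (d := q) rfl
        (by omega) hgq (by omega) (by omega) hh
      have r7 := step (o := 22) (a := n) (b := g (3 + q)) (c := 4 * q) (d := q) rfl
        (by omega) hgq (by omega) (by omega) hh
      have r8 := step (o := 23) (a := n) (b := g (3 + q)) (c := 8 * q) (d := q) rfl
        (by omega) hgq (by omega) (by omega) hh
      have r9 := step (o := 24) (a := n) (b := g (3 + q)) (c := 16 * q) (d := q) rfl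
        (by omega) hgq (by omega) (by omega) hh
      have r10 := step (o := 25) (a := n) (b := g (3 + q)) (c := 16 * q + 1) (d := q) rfl
        (by omega) hgq (by omega) (by omega) hh
      have r11 := step (o := 26) (a := n) (b := g (3 + q)) (c := 16 * q + 1 + 1) (d := q) rfl
        (by omega) hgq (by omega) (by omega) hh
      have r12 := step (o := 27) (a := n) (b := g (3 + q)) (c := 16 * q + 1 + 1 + 1) (d := q) rfl
        (by omega) hgq (by omega) (by omega) hh
      have hh' : ∀ r, Function.update h (16 * q + 1 + 1 + 1) (g (3 + q)) r ≤ W := le_update hh hgq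
      have r13 := step (o := 28) (a := n) (b := g (3 + q)) (c := 16 * q + 1 + 1 + 1) (d := q) rfl
        (by omega) hgq (by omega) (by omega) hh'
      have r14 := step (o := 29) (a := n) (b := g (3 + q)) (c := 1) (d := q) rfl
        (by omega) hgq (by omega) (by omega) hh'
      have r15 := step (o := 30) (a := n) (b := g (3 + q)) (c := 1) (d := q - 1) rfl
        (by omega) hgq (by omega) (by omega) hh'
      have hne : ¬ q = 0 := by omega
      simp only [Instr.exec, quad_one, quad_two, quad_three, update_quad_one, update_quad_two,
        update_quad_three, hne, if_false]
        at r0 r1 r2 r3 r4 r5 r6 r7 r8 r9 r10 r11 r12 r13 r14 r15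
      rw [quad_of_le (by omega), hval] at r3
      rw [update_quad_of_le (by omega)] at r12
      rw [show q + q + (q + q) = 4 * q by omega] at r6
      rw [show 4 * q + 4 * q = 8 * q by omega] at r7
      rw [show 8 * q + 8 * q = 16 * q by omega] at r8
      refine ⟨_, 1, _, hgq, by omega, hh', ?_, ?_, ?_⟩
      · rw [← Nat.sub_sub]
        exact (hrun.trans (r0.trans (r1.trans (r2.trans (r3.trans (r4.trans (r5.trans (r6.trans
          (r7.trans (r8.trans (r9.trans (r10.trans (r11.trans (r12.trans (r13.trans
          (r14.trans r15)))))))))))))))).mono (by rw [add_mul]; omega)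
      · intro r hr hr'
        rw [Function.update_of_ne (by omega)]
        exact hlow r hr (by omega)
      · intro i hi hi'
        by_cases e : i = q
        · rw [e]; exact Function.update_self ..
        · rw [Function.update_of_ne (by omega)]
          exact hhigh i (by omega) hi'
  obtain ⟨b, c, h, hb, hc, hh, hrun, -, hres⟩ := phase3 N le_rfl
  rw [Nat.sub_self] at hrun hres
  have r' := step (o := 15) (a := n) (b := b) (c := c) (d := 0) rfl (by omega) hb hc (by omega) hh
  simp only [Instr.exec, quad_three, if_true] at r'
  refine ⟨_, (phase1.trans (h2.trans (r.trans (hrun.trans r')))).mono ?_, rfl, rfl,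
    quad_le (by omega) hb hc (by omega) hh, fun i hi hi' => ?_⟩
  -- The phases and the two final tests take `10 + 5 * n + 1 + 16 * N + 1` instructions, which is at
  -- most `22 * N`.
  · have : n * 5 + 12 ≤ 6 * N := by nlinarith
    nlinarith [Nat.mul_le_mul_right (5 * len U) this]
  · rw [quad_of_le (by omega)]
    exact hres i (by omega) hi'

end RAM

/-! ### The program -/

namespace VCL1.Algorithm

/-- The variables of the program. -/
inductive Var : Type
  | n | B | k | zero | one | level | rounds | twice | r | b | ans | bitCount | count | aux
  | s | t | w | ptr | cur | active | best | price | old | tau | u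
  | v | c | out | cOut | gain | pos | tau₀ | tau₁ | carry
  deriving DecidableEq

/-- The arrays of the program. -/
inductive Arr : Type
  | adj | row | S | T | price | mate | bits
  deriving DecidableEq

open Cmd

/-- Compare the price of `w`, if it is a neighbour of `cur` in `T`, with the least price found. -/
def compare : Cmd Var Arr := block [
  load .t .adj .ptr,
  ifz .t skip (block [
    load .t .T .w,
    ifz .t skip (block [
      load .t .price .w,
      sub .s .price .t,
      ifz .s skip (block [copy .price .t, copy .best .w])])]),
  succ .w, succ .ptr]

/-- Find the cheapest neighbour of `cur` in `T` whose price is below `level`. -/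
def findMin : Cmd Var Arr := block [
  copy .price .level, const .w 0, load .ptr .row .cur, loop .n compare]

/-- Let `cur` bid for the vertex `best`. -/
def bid : Cmd Var Arr := block [
  sub .s .level .price,
  ifz .s (const .active 0) (block [
    load .old .mate .best,
    store .mate .best .cur,
    copy .t .price, succ .t,
    store .price .best .t,
    ifz .price (block [const .active 0, succ .tau]) (copy .cur .old)])]

/-- Let `cur` bid, if it is active. -/
def round : Cmd Var Arr := ifz .active skip (block [findMin, bid])

/-- Let `u`, if it is in `T`, join the auction. -/
def place : Cmd Var Arr := block [
  load .t .T .u,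
  ifz .t skip (block [copy .cur .u, const .active 1, loop .rounds round]),
  succ .u]

/-- Assign the value of `x` to the first `m` entries of the array `c`. -/
def fill (m : Var) (c : Arr) (x : Var) : Cmd Var Arr := block [
  const .w 0, loop m (block [store c .w x, succ .w])]

/-- Compute twice the least weight of a half-integral cover of the graph induced on `T`. -/
def auction : Cmd Var Arr := block [
  const .tau 0, fill .n .price .zero, const .u 0, loop .n place]

/-- Copy the array `d` to the array `c`. -/
def copyArr (c d : Arr) : Cmd Var Arr := block [
  const .w 0, loop .n (block [load .t d .w, store c .w .t, succ .w])]

/-- Remove the neighbours of `v` from `T`. -/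
def removeNbrs : Cmd Var Arr := block [
  const .w 0, load .ptr .row .v, const .gain 0, copy .cOut .c,
  loop .n (block [
    load .t .adj .ptr,
    ifz .t skip (block [
      load .t .T .w,
      ifz .t skip (block [store .T .w .zero, succ .gain, succ .gain, succ .cOut])]),
    succ .w, succ .ptr])]

/-- Compute the values `tau₀`, `tau₁` and `tau` for the graphs on `S`, on `S` without `v`, and on
`S` without `v` and its neighbours. -/
def evaluate : Cmd Var Arr := block [
  copyArr .T .S,
  auction, copy .tau₀ .tau,
  store .T .v .zero,
  auction, copy .tau₁ .tau,
  removeNbrs, auction]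

/-- Decide whether `v` stays out of the cover. -/
def choose : Cmd Var Arr := block [
  sub .t .tau₀ .tau₁, sub .t .t .one,
  sub .s .tau₀ .tau, sub .s .gain .s,
  ifz .t (ifz .s (const .out 1) (block [load .out .bits .pos, succ .pos])) (const .out 0)]

/-- Put `v` or its neighbours in `S` into the cover. -/
def update : Cmd Var Arr :=
  ifz .out (block [store .S .v .zero, succ .c]) (block [copyArr .S .T, copy .c .cOut])

/-- Deal with `v`, if it is in `S`. -/
def visit : Cmd Var Arr := block [
  load .t .S .v,
  ifz .t skip (block [evaluate, choose, update]),
  succ .v]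

/-- Construct a cover following the answers in `bits`. -/
def attempt : Cmd Var Arr := block [
  fill .n .S .one,
  const .c 0, const .pos 0, const .v 0,
  loop .n visit,
  sub .t .c .b, ifz .t (const .ans 1) skip]

/-- Add one to the binary number in `bits`. -/
def increment : Cmd Var Arr := block [
  const .carry 1, const .w 0,
  loop .bitCount (block [
    ifz .carry skip (block [
      load .t .bits .w,
      ifz .t (block [store .bits .w .one, const .carry 0]) (store .bits .w .zero)]),
    succ .w])]

/-- Try all answers. -/
def search : Cmd Var Arr := block [
  const .ans 0,
  fill .bitCount .bits .zero,
  loop .count (block [attempt, increment])]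

/-- Compute `bitCount = 2 * k` and `count = 2 ^ bitCount`. -/
def prepare : Cmd Var Arr := block [
  const .bitCount 0, loop .k (block [succ .bitCount, succ .bitCount]),
  const .count 1, loop .bitCount (block [copy .aux .count, loop .aux (succ .count)])]

/-- Read `B` and `k` from the diagonal of the matrix. -/
def readParams : Cmd Var Arr := block [
  const .zero 0, const .one 1,
  copy .t .n, succ .t, load .B .adj .t, store .adj .t .zero,
  succ .t, loop .n (succ .t), load .k .adj .t, store .adj .t .zero]

/-- Compute the parameters of the auction and the positions of the rows of the matrix. -/
def initRows : Cmd Var Arr := block [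
  copy .level .n, succ .level,
  const .rounds 1, loop .n (block [succ .rounds, loop .n (succ .rounds)]),
  const .t 0, const .w 0, loop .n (block [store .row .w .t, succ .w, loop .n (succ .t)])]

/-- Count the nonzero entries of the matrix. -/
def countEntries : Cmd Var Arr := block [
  const .ptr 0, const .twice 0,
  loop .n (loop .n (block [load .t .adj .ptr, ifz .t skip (succ .twice), succ .ptr]))]

/-- Compute the largest size `b` allowed for a cover, and compare it with the number of edges. -/
def computeBound : Cmd Var Arr := block [
  copy .b .k, copy .r .twice,
  loop .n (loop .n (block [
    copy .t .r, succ .t, sub .t .t .B, sub .t .t .B,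
    ifz .t skip (block [sub .r .t .one, succ .b])])),
  sub .t .twice .b, sub .t .t .b]

/-- Read the input and compute the parameters of the search. -/
def setup : Cmd Var Arr := block [readParams, initRows, countEntries, computeBound]

/-- The whole program, to be started with `n` in the variable `n` and `B`, `k` and the adjacency
matrix in the array `adj`. The answer is left in the variable `n`. -/
def program : Cmd Var Arr := block [
  setup,
  ifz .t (const .ans 1) (block [prepare, search]),
  copy .n .ans]

/-! ### Correctness of the auction -/

open HalfCover

/-- The vertices below `n` marked in the array `f`. -/
def supp (n : ℕ) (f : ℕ → ℕ) : Finset ℕ := (Finset.range n).filter (fun w => f w ≠ 0)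

theorem mem_supp {n : ℕ} {f : ℕ → ℕ} {w : ℕ} : w ∈ supp n f ↔ w < n ∧ f w ≠ 0 := by
  simp [supp]

theorem supp_update_zero (n : ℕ) (f : ℕ → ℕ) (v : ℕ) :
    supp n (Function.update f v 0) = (supp n f).erase v := by
  ext w
  by_cases h : w = v
  · subst h; simp [mem_supp]
  · simp [mem_supp, h]

theorem supp_congr {n : ℕ} {f g : ℕ → ℕ} (h : ∀ w < n, f w = g w) : supp n f = supp n g := by
  ext w
  simp only [mem_supp]
  constructor
  · exact fun hw => ⟨hw.1, h w hw.1 ▸ hw.2⟩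
  · exact fun hw => ⟨hw.1, (h w hw.1).symm ▸ hw.2⟩

/-- The data which remain unchanged after the setup. -/
structure Env (n : ℕ) (E : ℕ → ℕ → Prop) (σ : Store Var Arr) : Prop where
  n_eq : σ.v .n = n
  zero_eq : σ.v .zero = 0
  one_eq : σ.v .one = 1
  level_eq : σ.v .level = n + 1
  rounds_eq : σ.v .rounds = n * (n + 1) + 1
  row_eq : ∀ u < n, σ.a .row u = u * n
  adj_iff : ∀ u < n, ∀ w < n, σ.a .adj (u * n + w) ≠ 0 ↔ E u w

variable {n : ℕ} {E : ℕ → ℕ → Prop} {σ : Store Var Arr}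

theorem Env.congr {σ' : Store Var Arr} (h : Env n E σ)
    (hv : ∀ x ∈ [Var.n, .zero, .one, .level, .rounds], σ'.v x = σ.v x)
    (ha : ∀ c ∈ [Arr.row, .adj], σ'.a c = σ.a c) : Env n E σ' := by
  constructor
  · rw [hv _ (by simp), h.n_eq]
  · rw [hv _ (by simp), h.zero_eq]
  · rw [hv _ (by simp), h.one_eq]
  · rw [hv _ (by simp), h.level_eq]
  · rw [hv _ (by simp), h.rounds_eq]
  · rw [ha _ (by simp)]; exact h.row_eq
  · rw [ha _ (by simp)]; exact h.adj_iff

theorem Env.eval {s : Cmd Var Arr} (h : Env n E σ)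
    (hv : ∀ x ∈ [Var.n, .zero, .one, .level, .rounds], s.writesVar x = false)
    (ha : ∀ c ∈ [Arr.row, .adj], s.writesArr c = false) : Env n E (s.eval σ) :=
  h.congr (fun x hx => eval_v_of_not_writesVar (hv x hx) σ)
    (fun c hc => eval_a_of_not_writesArr (ha c hc) σ)

/-- Loop invariant: `price` is the least price among the neighbours in `T` seen so far, capped at
the level `n + 1`, and `best` attains it once it is below the cap. Above that, `best` may be stale
and nothing is claimed about it. -/
theorem loop_compare (h : Env n E σ) (hcur : σ.v .cur < n) (hw : σ.v .w = 0)
    (hptr : σ.v .ptr = σ.v .cur * n) (hp : σ.v .price = n + 1) {σ' : Store Var Arr}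
    (hσ' : σ' = (loop .n compare).eval σ) :
    σ'.v .price ≤ n + 1 ∧
    (∀ w ∈ supp n (σ.a .T), E (σ.v .cur) w → σ'.v .price ≤ σ.a .price w) ∧
    (σ'.v .price < n + 1 → σ'.v .best ∈ supp n (σ.a .T) ∧ E (σ.v .cur) (σ'.v .best) ∧
      σ.a .price (σ'.v .best) = σ'.v .price) := by
  have key := eval_loop_induction (x := .n) (s := compare) (σ := σ) (fun i σ' =>
    σ'.a = σ.a ∧ σ'.v .w = i ∧ σ'.v .ptr = σ.v .cur * n + i ∧ σ'.v .price ≤ n + 1 ∧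
    (∀ w ∈ supp n (σ.a .T), w < i → E (σ.v .cur) w → σ'.v .price ≤ σ.a .price w) ∧
    (σ'.v .price < n + 1 → σ'.v .best ∈ supp n (σ.a .T) ∧ E (σ.v .cur) (σ'.v .best) ∧
      σ.a .price (σ'.v .best) = σ'.v .price)) ⟨rfl, hw, hptr, hp.le, by simp, by omega⟩ ?_
  · rw [h.n_eq, ← hσ'] at key
    obtain ⟨-, -, -, h1, h2, h3⟩ := key
    exact ⟨h1, fun w hw => h2 w hw (mem_supp.1 hw).1, h3⟩
  · rintro i τ hi ⟨ha, hiw, hip, h1, h2, h3⟩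
    rw [h.n_eq] at hi
    have hE := h.adj_iff _ hcur i hi
    have hT : i ∈ supp n (σ.a .T) ↔ σ.a .T i ≠ 0 := by simp [mem_supp, hi]
    have hle : τ.v .price ≤ σ.a .price i ∨ ¬ (E (σ.v .cur) i ∧ i ∈ supp n (σ.a .T)) →
        ∀ w ∈ supp n (σ.a .T), w ≤ i → E (σ.v .cur) w → τ.v .price ≤ σ.a .price w := by
      intro hor w hw hwi hEw
      by_cases e : w = i
      · subst e; tauto
      · exact h2 w hw (by omega) hEw
    rw [Nat.lt_succ_iff] at h3
    by_cases c1 : σ.a .adj (σ.v .cur * n + i) = 0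
    · simp [compare, ha, hiw, hip, c1]
      exact ⟨by omega, h1, hle (by tauto), h3⟩
    by_cases c2 : σ.a .T i = 0
    · simp [compare, ha, hiw, hip, c1, c2]
      exact ⟨by omega, h1, hle (by tauto), h3⟩
    by_cases c3 : τ.v .price - σ.a .price i = 0
    · simp [compare, ha, hiw, hip, c1, c2, c3]
      exact ⟨by omega, h1, hle (by omega), h3⟩
    · simp [compare, ha, hiw, hip, c1, c2, c3]
      refine ⟨by omega, by omega, fun w hw hwi hEw => ?_, fun _ => ⟨hT.2 c2, hE.1 c1⟩⟩
      by_cases e : w = i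
      · rw [e]
      · exact (by omega : σ.a .price i ≤ τ.v .price).trans (h2 w hw (by omega) hEw)

theorem findMin_spec (h : Env n E σ) (hcur : σ.v .cur < n) :
    (findMin.eval σ).v .price ≤ n + 1 ∧
    (∀ w ∈ supp n (σ.a .T), E (σ.v .cur) w → (findMin.eval σ).v .price ≤ σ.a .price w) ∧
    ((findMin.eval σ).v .price < n + 1 → (findMin.eval σ).v .best ∈ supp n (σ.a .T) ∧
      E (σ.v .cur) ((findMin.eval σ).v .best) ∧
      σ.a .price ((findMin.eval σ).v .best) = (findMin.eval σ).v .price) := by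
  refine loop_compare (σ := (block [copy .price .level, const .w 0, load .ptr .row .cur]).eval σ)
    (h.eval (by decide) (by decide)) (by simpa) (by simp) ?_ ?_ rfl
  · simpa using h.row_eq _ hcur
  · simpa using h.level_eq

/-- The entries of `c` below `σ.v m` are assigned `σ.v x`. -/
theorem fill_spec {m x : Var} {c : Arr} (hm : m ≠ .w) (hx : x ≠ .w) :
    ∀ w < σ.v m, ((fill m c x).eval σ).a c w = σ.v x := by
  have key := eval_loop_induction (x := m) (s := block [store c .w x, succ .w])
    (σ := (const Var.w 0 : Cmd Var Arr).eval σ) (fun i σ' =>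
    σ'.v .w = i ∧ σ'.v x = σ.v x ∧ ∀ w < i, σ'.a c w = σ.v x) ⟨by simp, by simp [hx], by simp⟩ ?_
  · simp only [eval_const, Function.update_of_ne hm] at key
    exact key.2.2
  · rintro i τ - ⟨h1, h2, h3⟩
    refine ⟨by simp [h1], by simp [h2, hx], fun w hw => ?_⟩
    by_cases e : w = i
    · simp [h1, h2, e]
    · simpa [h1, h2, e] using h3 w (by omega)

theorem findMin_a : (findMin.eval σ).a = σ.a := by
  funext c
  exact eval_a_of_not_writesArr (by cases c <;> rfl) σ

/-- The state of the auction after some rounds. The vertices `W` have joined, and `m` bids have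
been made if the auction has not yet come to a halt. -/
structure Rounds (n : ℕ) (E : ℕ → ℕ → Prop) (T W : Finset ℕ) (m : ℕ) (σ : Store Var Arr) :
    Prop where
  env : Env n E σ
  supp_eq : supp n (σ.a .T) = T
  tau_eq : σ.v .tau = (T.filter (fun w => 0 < σ.a .price w)).card
  halted : σ.v .active = 0 → Auction E T (n + 1) (σ.a .price) (σ.a .mate) W
  cur_mem : σ.v .active ≠ 0 → σ.v .cur ∈ W
  le_sum : σ.v .active ≠ 0 → m ≤ ∑ w ∈ T, σ.a .price w
  running : σ.v .active ≠ 0 →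
    Auction E T (n + 1) (σ.a .price) (σ.a .mate) (W.erase (σ.v .cur))

/-- Three outcomes: all neighbours are at the top level and `cur` gives up; an unsold vertex is
bought, which halts this auction and raises `tau`; or a sold vertex changes hands and its previous
owner becomes `cur`. While the auction is active, every round adds exactly one to the sum of the
prices. -/
theorem Rounds.round {T W : Finset ℕ} {m : ℕ} (h : Rounds n E T W m σ) (hW : W ⊆ T) :
    Rounds n E T W (m + 1) (round.eval σ) := by
  by_cases ha : σ.v .active = 0
  · have e : Algorithm.round.eval σ = σ := by simp [Algorithm.round, ha]
    rw [e]
    exact ⟨h.env, h.supp_eq, h.tau_eq, h.halted, h.cur_mem, fun h' => absurd ha h', h.running⟩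
  have e : Algorithm.round.eval σ = bid.eval (findMin.eval σ) := by simp [Algorithm.round, ha]
  have hcur := h.cur_mem ha
  have hrun := h.running ha
  have hcurn : σ.v .cur < n := by
    have := hW hcur
    rw [← h.supp_eq] at this
    exact (mem_supp.1 this).1
  have henv : Env n E (Algorithm.round.eval σ) := h.env.eval (by decide) (by decide)
  obtain ⟨h1, h2, h3⟩ := findMin_spec h.env hcurn
  have ea : (findMin.eval σ).a = σ.a := findMin_a
  have ecur : (findMin.eval σ).v .cur = σ.v .cur := eval_v_of_not_writesVar (by decide) σ
  have eact : (findMin.eval σ).v .active = σ.v .active := eval_v_of_not_writesVar (by decide) σ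
  have etau : (findMin.eval σ).v .tau = σ.v .tau := eval_v_of_not_writesVar (by decide) σ
  have elevel : (findMin.eval σ).v .level = n + 1 := by
    rw [← h.env.level_eq]; exact eval_v_of_not_writesVar (by decide) σ
  rw [e] at henv ⊢
  rw [h.supp_eq] at h2 h3
  generalize findMin.eval σ = ρ at *
  by_cases c1 : n + 1 - ρ.v .price = 0
  · have hres : bid.eval ρ = ⟨Function.update (Function.update ρ.v .s 0) .active 0, ρ.a⟩ := by
      simp [bid, elevel, c1]
    have hgive := hrun.give_up (u := σ.v .cur) (fun w hw hEw => by
      have := h2 w hw hEw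
      omega)
    rw [Finset.insert_erase hcur] at hgive
    refine ⟨henv, ?_, ?_, ?_, ?_, ?_, ?_⟩ <;> rw [hres] <;> simp [ea, etau]
    · exact h.supp_eq
    · exact h.tau_eq
    · exact hgive
  · obtain ⟨hbT, hbE, hbp⟩ := h3 (by omega)
    have hbid := fun U' hU' => hrun.bid (u := σ.v .cur) (w := ρ.v .best) (U' := U')
      (Finset.notMem_erase _ _) hbT hbE (by omega) (by rwa [hbp]) hU'
    rw [hbp] at hbid
    have hsum : ∑ w ∈ T, Function.update (σ.a .price) (ρ.v .best) (ρ.v .price + 1) w =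
        ∑ w ∈ T, σ.a .price w + 1 := by
      rw [Finset.sum_update_of_mem hbT, ← Finset.add_sum_erase T _ hbT, hbp,
        Finset.sdiff_singleton_eq_erase]
      omega
    by_cases c2 : ρ.v .price = 0
    · have hU := hbid W (fun x => by
        rw [c2, Finset.mem_erase]
        by_cases e : x = σ.v .cur
        · simp [e, hcur]
        · simp [e])
      refine ⟨henv, ?_, ?_, ?_, ?_, ?_, ?_⟩ <;> simp [bid, elevel, c2, ea, etau, ecur]
      · exact h.supp_eq
      · rw [h.tau_eq, show T.filter (fun w => 0 < Function.update (σ.a .price) (ρ.v .best) 1 w) =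
          insert (ρ.v .best) (T.filter (fun w => 0 < σ.a .price w)) from ?_,
          Finset.card_insert_of_notMem (by simp [hbp, c2])]
        ext w
        by_cases e : w = ρ.v .best
        · simp [e, hbT]
        · simp [e]
      · simpa [c2] using hU
    · have hold := hrun.mate_mem _ hbT (by omega)
      rw [Finset.mem_erase] at hold
      have hU := hbid (W.erase (σ.a .mate (ρ.v .best))) (fun x => by
        rw [Finset.mem_erase, Finset.mem_erase]
        by_cases e : x = σ.v .cur
        · simp [e, hcur, hold.1.symm]
        · have : 0 < ρ.v .price := by omega
          simp only [e, this]
          tauto)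
      have hact : ρ.v .active ≠ 0 := by rwa [eact]
      refine ⟨henv, ?_, ?_, ?_, ?_, ?_, ?_⟩ <;> simp [bid, elevel, c1, c2, ea, etau, ecur]
      · exact h.supp_eq
      · rw [h.tau_eq]
        congr 1
        ext w
        by_cases e : w = ρ.v .best
        · simp [e, hbT, hbp]
          omega
        · simp [e]
      · exact fun h => absurd h hact
      · exact fun _ => hold.2
      · have := h.le_sum ha
        exact fun _ => by omega
      · exact fun _ => hU

theorem place_spec {T : Finset ℕ} {i : ℕ} (h : Env n E σ) (hT : supp n (σ.a .T) = T)
    (htau : σ.v .tau = (T.filter (fun w => 0 < σ.a .price w)).card) (hu : σ.v .u = i) (hi : i < n)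
    (hA : Auction E T (n + 1) (σ.a .price) (σ.a .mate) (T.filter (· < i)))
    {σ' : Store Var Arr} (hσ' : σ' = place.eval σ) :
    σ'.v .tau = (T.filter (fun w => 0 < σ'.a .price w)).card ∧
      Auction E T (n + 1) (σ'.a .price) (σ'.a .mate) (T.filter (· < i + 1)) := by
  by_cases hiT : σ.a .T i = 0
  · have e : T.filter (· < i + 1) = T.filter (· < i) := by
      refine Finset.filter_congr fun w hw => ?_
      have : w ≠ i := by
        rintro rfl
        rw [← hT] at hw
        exact (mem_supp.1 hw).2 hiT
      omega
    rw [e, hσ']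
    simp [place, hu, hiT, htau]
    exact hA
  · have hiT' : i ∈ T := hT ▸ mem_supp.2 ⟨hi, hiT⟩
    have e : T.filter (· < i + 1) = insert i (T.filter (· < i)) := by
      ext w
      simp only [Finset.mem_filter, Finset.mem_insert]
      constructor
      · rintro ⟨h1, h2⟩
        by_cases e : w = i
        · exact Or.inl e
        · exact Or.inr ⟨h1, by omega⟩
      · rintro (rfl | ⟨h1, h2⟩)
        · exact ⟨hiT', by omega⟩
        · exact ⟨h1, by omega⟩
    have key := eval_loop_induction (x := .rounds) (s := round)
      (σ := (block [load .t .T .u, copy .cur .u, const .active 1]).eval σ)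
      (Rounds n E T (T.filter (· < i + 1))) ?_
      (fun m τ _ hτ => hτ.round (Finset.filter_subset _ _))
    · set ρ := (loop .rounds round).eval
        ((block [load .t .T .u, copy .cur .u, const .active 1]).eval σ) with hρ
      have hfin : σ' = (succ .u : Cmd Var Arr).eval ρ := by
        rw [hσ', hρ]
        simp [place, hu, hiT]
      have hr : ((block [load .t .T .u, copy .cur .u, const .active 1]).eval σ).v .rounds =
          n * (n + 1) + 1 := by simp [h.rounds_eq]
      rw [hr] at key
      -- An auction still active after `n * (n + 1) + 1` rounds would have prices summing to more
      -- than `n` times the level `n + 1`.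
      have hact : ρ.v .active = 0 := by
        by_contra hne
        have h1 := key.le_sum hne
        have h2 : ∑ w ∈ T, ρ.a .price w ≤ T.card * (n + 1) :=
          Finset.sum_le_card_nsmul _ _ _ (key.running hne).price_le
        have h3 : T.card ≤ n := by
          rw [← hT]
          exact (Finset.card_filter_le _ _).trans (by simp)
        have := Nat.mul_le_mul_right (n + 1) h3
        omega
      rw [hfin]
      simp only [eval_succ, ne_eq, reduceCtorEq, not_false_eq_true, Function.update_of_ne]
      exact ⟨key.tau_eq, key.halted hact⟩
    · refine ⟨h.eval (by decide) (by decide), ?_, ?_, ?_, ?_, ?_, ?_⟩ <;> simp [hu]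
      · exact hT
      · exact htau
      · exact hiT'
      · simp only [Nat.lt_succ_iff] at e
        rw [e, Finset.erase_insert (by simp)]
        exact hA

/-- Only prices are reset. The array `mate` may hold leftovers of an earlier auction, because an
auction state constrains it only at positive prices. -/
theorem auction_spec (h : Env n E σ) (hsymm : ∀ u w, E u w → E w u) :
    (auction.eval σ).v .tau = tau E (supp n (σ.a .T)) := by
  set T := supp n (σ.a .T) with hT
  set ρ := (block [const .tau 0, fill .n .price .zero, const .u 0]).eval σ with hρ
  have hρenv : Env n E ρ := h.eval (by decide) (by decide)
  have hρT : ρ.a .T = σ.a .T := eval_a_of_not_writesArr (by decide) σ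
  have hprice : ∀ w ∈ T, ρ.a .price w = 0 := by
    intro w hw
    have := fill_spec (σ := (const .tau 0 : Cmd Var Arr).eval σ) (m := .n) (x := .zero)
      (c := .price) (by decide) (by decide) w (by simpa [h.n_eq] using (mem_supp.1 hw).1)
    rw [hρ]
    simpa [h.zero_eq] using this
  have htau : ρ.v .tau = 0 := by
    have : ((fill .n .price .zero).eval ((const .tau 0 : Cmd Var Arr).eval σ)).v .tau = 0 := by
      rw [eval_v_of_not_writesVar (by decide)]
      simp
    rw [hρ]
    simpa using this
  have key := eval_loop_induction (x := .n) (s := place) (σ := ρ) (fun i τ =>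
    Env n E τ ∧ τ.a .T = σ.a .T ∧ τ.v .u = i ∧
    τ.v .tau = (T.filter (fun w => 0 < τ.a .price w)).card ∧
    Auction E T (n + 1) (τ.a .price) (τ.a .mate) (T.filter (· < i))) ?_ ?_
  · rw [hρenv.n_eq] at key
    obtain ⟨-, -, -, h1, h2⟩ := key
    have e : T.filter (· < n) = T := Finset.filter_true_of_mem fun w hw => (mem_supp.1 hw).1
    rw [e] at h2
    have hcard : T.card < n + 1 := by
      have : T.card ≤ n := (Finset.card_filter_le _ _).trans (by simp)
      omega
    rw [← (h2.isTau hsymm hcard).eq_tau, ← h1]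
    rfl
  · refine ⟨hρenv, hρT, by simp [hρ], ?_, ?_⟩
    · rw [htau, eq_comm, Finset.card_eq_zero, Finset.filter_eq_empty_iff]
      intro w hw
      simp [hprice w hw]
    · simpa using Auction.start hprice
  · rintro i τ hi ⟨h1, h2, h3, h4, h5⟩
    rw [hρenv.n_eq] at hi
    refine ⟨h1.eval (by decide) (by decide), ?_, ?_, place_spec h1 (by rw [h2]) h4 h3 hi h5 rfl⟩
    · rw [eval_a_of_not_writesArr (by decide), h2]
    · by_cases c : τ.a .T i = 0
      · simp [place, h3, c]
      · simp [place, h3, c]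
        rw [eval_v_of_not_writesVar (by decide)]
        simp [h3]

end VCL1.Algorithm

namespace VCL1.Algorithm

open Cmd HalfCover

variable {n : ℕ} {E : ℕ → ℕ → Prop} {σ : Store Var Arr}

/-! ### Correctness of the search -/

theorem copyArr_spec {c d : Arr} (hcd : d ≠ c) :
    ∀ w < σ.v .n, ((copyArr c d).eval σ).a c w = σ.a d w := by
  have key := eval_loop_induction (x := .n) (s := block [load .t d .w, store c .w .t, succ .w])
    (σ := (const Var.w 0 : Cmd Var Arr).eval σ) (fun i σ' =>
    σ'.v .w = i ∧ σ'.a d = σ.a d ∧ ∀ w < i, σ'.a c w = σ.a d w) ⟨by simp, by simp, by simp⟩ ?_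
  · simp only [eval_const, ne_eq, reduceCtorEq, not_false_eq_true, Function.update_of_ne] at key
    exact key.2.2
  · rintro i τ - ⟨h1, h2, h3⟩
    refine ⟨by simp [h1], by simp [h2, hcd], fun w hw => ?_⟩
    by_cases e : w = i
    · simp [h1, h2, e]
    · simpa [h1, h2, e] using h3 w (by omega)

theorem removeNbrs_spec (h : Env n E σ) (hv : σ.v .v < n) {S : Finset ℕ}
    (hS : supp n (σ.a .T) = S) {σ' : Store Var Arr} (hσ' : σ' = removeNbrs.eval σ) :
    supp n (σ'.a .T) = S \ nbrs E S (σ.v .v) ∧ σ'.v .gain = 2 * (nbrs E S (σ.v .v)).card ∧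
      σ'.v .cOut = σ.v .c + (nbrs E S (σ.v .v)).card := by
  set v := σ.v .v with hvdef
  set ρ := (block [const .w 0, load .ptr .row .v, const .gain 0, copy .cOut .c]).eval σ with hρ
  set N := nbrs E S v with hN
  have key := eval_loop_induction (x := .n) (s := block [
      load .t .adj .ptr,
      ifz .t skip (block [
        load .t .T .w,
        ifz .t skip (block [store .T .w .zero, succ .gain, succ .gain, succ .cOut])]),
      succ .w, succ .ptr]) (σ := ρ) (fun i τ =>
    τ.a .adj = σ.a .adj ∧ τ.v .zero = 0 ∧ τ.v .w = i ∧ τ.v .ptr = v * n + i ∧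
    (∀ w < n, i ≤ w → τ.a .T w = σ.a .T w) ∧
    supp n (τ.a .T) = S \ (N.filter (· < i)) ∧ τ.v .gain = 2 * (N.filter (· < i)).card ∧
    τ.v .cOut = σ.v .c + (N.filter (· < i)).card) ?_ ?_
  · have hn : ρ.v .n = n := by simp [hρ, h.n_eq]
    rw [hn] at key
    obtain ⟨-, -, -, -, -, h1⟩ := key
    have e : N.filter (· < n) = N := Finset.filter_true_of_mem fun w hw => by
      have := (mem_nbrs.1 hw).1
      rw [← hS] at this
      exact (mem_supp.1 this).1
    rw [e] at h1
    rw [hσ']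
    exact h1
  · refine ⟨by simp [hρ], by simp [hρ, h.zero_eq], by simp [hρ], ?_, ?_, ?_, ?_, ?_⟩ <;>
      simp [hρ]
    · exact h.row_eq _ hv
    · exact hS
  · rintro i τ hi ⟨h1, h2, h3, h4, h5, h6, h7, h8⟩
    have hn : ρ.v .n = n := by simp [hρ, h.n_eq]
    rw [hn] at hi
    have hadj := h.adj_iff v hv i hi
    have hTi := h5 i hi le_rfl
    have hiS : i ∈ S ↔ σ.a .T i ≠ 0 := by rw [← hS, mem_supp]; tauto
    have hstay : i ∉ N → N.filter (· < i + 1) = N.filter (· < i) := by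
      intro hiN
      refine Finset.filter_congr fun w hw => ?_
      have : w ≠ i := fun e => hiN (e ▸ hw)
      omega
    by_cases c1 : σ.a .adj (v * n + i) = 0
    · have hiN : i ∉ N := fun hiN => (hadj.2 (mem_nbrs.1 hiN).2) c1
      rw [hstay hiN]
      simp [h1, h2, h3, h4, h6, h7, h8, c1]
      exact ⟨by omega, fun w hw hiw => h5 w hw (by omega)⟩
    by_cases c2 : σ.a .T i = 0
    · have hiN : i ∉ N := fun hiN => hiS.1 (mem_nbrs.1 hiN).1 c2
      rw [hstay hiN]
      simp [h1, h2, h3, h4, h6, h7, h8, c1, hTi, c2]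
      exact ⟨by omega, fun w hw hiw => h5 w hw (by omega)⟩
    · have hiN : i ∈ N := mem_nbrs.2 ⟨hiS.2 c2, hadj.1 c1⟩
      have e : N.filter (· < i + 1) = insert i (N.filter (· < i)) := by
        ext w
        simp only [Finset.mem_filter, Finset.mem_insert]
        constructor
        · rintro ⟨h1, h2⟩
          by_cases e : w = i
          · exact Or.inl e
          · exact Or.inr ⟨h1, by omega⟩
        · rintro (rfl | ⟨h1, h2⟩)
          · exact ⟨hiN, by omega⟩
          · exact ⟨h1, by omega⟩
      rw [e, Finset.card_insert_of_notMem (by simp)]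
      simp [h1, h2, h3, h4, h7, h8, c1, hTi, c2]
      refine ⟨by omega, ?_, ?_, by omega, by omega⟩
      · intro w hw hiw
        rw [Function.update_of_ne (by omega)]
        exact h5 w hw (by omega)
      · rw [supp_update_zero, h6]
        ext w
        simp only [Finset.mem_erase, Finset.mem_sdiff, Finset.mem_insert]
        tauto

theorem evaluate_spec (h : Env n E σ) (hsymm : ∀ u w, E u w → E w u) (hirr : ∀ v, ¬ E v v)
    (hv : σ.v .v < n) {S : Finset ℕ} {v : ℕ} (hS : supp n (σ.a .S) = S) (hvv : σ.v .v = v)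
    {σ' : Store Var Arr} (hσ' : σ' = evaluate.eval σ) :
    σ'.v .tau₀ = tau E S ∧ σ'.v .tau₁ = tau E (S.erase v) ∧ σ'.v .tau = tau E (rest E S v) ∧
      supp n (σ'.a .T) = rest E S v ∧ σ'.v .gain = 2 * (nbrs E S v).card ∧
      σ'.v .cOut = σ.v .c + (nbrs E S v).card := by
  rw [hvv] at hv
  obtain ⟨σ₁, hσ₁⟩ : ∃ τ, τ = (copyArr .T .S).eval σ := ⟨_, rfl⟩
  have hT₁ : supp n (σ₁.a .T) = S := by
    rw [← hS, hσ₁]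
    exact supp_congr fun w hw => copyArr_spec (by decide) w (by rwa [h.n_eq])
  have henv₁ : Env n E σ₁ := hσ₁ ▸ h.eval (by decide) (by decide)
  have hv₁ : σ₁.v .v = v := by rw [hσ₁, eval_v_of_not_writesVar (by decide), hvv]
  have hc₁ : σ₁.v .c = σ.v .c := by rw [hσ₁, eval_v_of_not_writesVar (by decide)]
  obtain ⟨σ₂, hσ₂⟩ : ∃ τ, τ = auction.eval σ₁ := ⟨_, rfl⟩
  have ht₂ : σ₂.v .tau = tau E S := by rw [hσ₂, auction_spec henv₁ hsymm, hT₁]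
  have hT₂ : σ₂.a .T = σ₁.a .T := by rw [hσ₂, eval_a_of_not_writesArr (by decide)]
  have hv₂ : σ₂.v .v = v := by rw [hσ₂, eval_v_of_not_writesVar (by decide), hv₁]
  have hc₂ : σ₂.v .c = σ.v .c := by rw [hσ₂, eval_v_of_not_writesVar (by decide), hc₁]
  have henv₂ : Env n E σ₂ := hσ₂ ▸ henv₁.eval (by decide) (by decide)
  obtain ⟨σ₃, hσ₃⟩ : ∃ τ, τ = (block [copy .tau₀ .tau, store .T .v .zero]).eval σ₂ := ⟨_, rfl⟩
  have henv₃ : Env n E σ₃ := hσ₃ ▸ henv₂.eval (by decide) (by decide)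
  have hT₃ : supp n (σ₃.a .T) = S.erase v := by
    rw [← hT₁, ← supp_update_zero, ← hT₂, hσ₃]
    simp [hv₂, henv₂.zero_eq]
  have ht₃ : σ₃.v .tau₀ = tau E S := by simp [hσ₃, ht₂]
  have hv₃ : σ₃.v .v = v := by simp [hσ₃, hv₂]
  have hc₃ : σ₃.v .c = σ.v .c := by simp [hσ₃, hc₂]
  obtain ⟨σ₄, hσ₄⟩ : ∃ τ, τ = auction.eval σ₃ := ⟨_, rfl⟩
  have ht₄ : σ₄.v .tau = tau E (S.erase v) := by rw [hσ₄, auction_spec henv₃ hsymm, hT₃]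
  have ht₄' : σ₄.v .tau₀ = tau E S := by rw [hσ₄, eval_v_of_not_writesVar (by decide), ht₃]
  have hT₄ : σ₄.a .T = σ₃.a .T := by rw [hσ₄, eval_a_of_not_writesArr (by decide)]
  have hv₄ : σ₄.v .v = v := by rw [hσ₄, eval_v_of_not_writesVar (by decide), hv₃]
  have hc₄ : σ₄.v .c = σ.v .c := by rw [hσ₄, eval_v_of_not_writesVar (by decide), hc₃]
  have henv₄ : Env n E σ₄ := hσ₄ ▸ henv₃.eval (by decide) (by decide)
  obtain ⟨σ₅, hσ₅⟩ : ∃ τ, τ = (copy .tau₁ .tau : Cmd Var Arr).eval σ₄ := ⟨_, rfl⟩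
  have henv₅ : Env n E σ₅ := hσ₅ ▸ henv₄.eval (by decide) (by decide)
  have hT₅ : supp n (σ₅.a .T) = S.erase v := by rw [← hT₃, ← hT₄, hσ₅]; simp
  have ht₅ : σ₅.v .tau₁ = tau E (S.erase v) := by simp [hσ₅, ht₄]
  have ht₅' : σ₅.v .tau₀ = tau E S := by simp [hσ₅, ht₄']
  have hv₅ : σ₅.v .v = v := by simp [hσ₅, hv₄]
  have hc₅ : σ₅.v .c = σ.v .c := by simp [hσ₅, hc₄]
  obtain ⟨σ₆, hσ₆⟩ : ∃ τ, τ = removeNbrs.eval σ₅ := ⟨_, rfl⟩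
  obtain ⟨hT₆, hg₆, hc₆⟩ := removeNbrs_spec henv₅ (by rwa [hv₅]) hT₅ hσ₆
  -- The neighbours are removed from an array from which `v` is already gone; without a loop at `v`
  -- this makes no difference.
  have hnb : nbrs E (S.erase v) v = nbrs E S v := by
    ext w
    simp only [mem_nbrs, Finset.mem_erase]
    constructor
    · tauto
    · exact fun hw => ⟨⟨fun e => hirr v (e ▸ hw.2), hw.1⟩, hw.2⟩
  rw [hv₅, hnb] at hT₆ hg₆ hc₆
  rw [← rest] at hT₆
  rw [hc₅] at hc₆
  have ht₆ : σ₆.v .tau₁ = tau E (S.erase v) := by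
    rw [hσ₆, eval_v_of_not_writesVar (by decide), ht₅]
  have ht₆' : σ₆.v .tau₀ = tau E S := by rw [hσ₆, eval_v_of_not_writesVar (by decide), ht₅']
  have henv₆ : Env n E σ₆ := hσ₆ ▸ henv₅.eval (by decide) (by decide)
  have hσ₇ : σ' = auction.eval σ₆ := by rw [hσ', hσ₆, hσ₅, hσ₄, hσ₃, hσ₂, hσ₁]; rfl
  refine ⟨?_, ?_, ?_, ?_, ?_, ?_⟩
  · rw [hσ₇, eval_v_of_not_writesVar (by decide), ht₆']
  · rw [hσ₇, eval_v_of_not_writesVar (by decide), ht₆]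
  · rw [hσ₇, auction_spec henv₆ hsymm, hT₆]
  · rw [hσ₇, eval_a_of_not_writesArr (by decide), hT₆]
  · rw [hσ₇, eval_v_of_not_writesVar (by decide), hg₆]
  · rw [hσ₇, eval_v_of_not_writesVar (by decide), hc₆]

theorem update_spec (h : Env n E σ) {S : Finset ℕ} {v : ℕ} (hS : supp n (σ.a .S) = S)
    (hv : σ.v .v = v) {σ' : Store Var Arr} (hσ' : σ' = update.eval σ) :
    (σ.v .out = 0 → supp n (σ'.a .S) = S.erase v ∧ σ'.v .c = σ.v .c + 1) ∧
      (σ.v .out ≠ 0 → supp n (σ'.a .S) = supp n (σ.a .T) ∧ σ'.v .c = σ.v .cOut) := by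
  refine ⟨fun ho => ?_, fun ho => ?_⟩
  · rw [hσ', ← hS, ← hv, ← supp_update_zero]
    simp [update, ho, h.zero_eq]
  · rw [hσ']
    simp only [update, eval_ifz, ho, if_false, eval_block_cons, eval_block_nil, eval_copy,
      Function.update_self]
    refine ⟨supp_congr fun w hw => copyArr_spec (by decide) w (by rwa [h.n_eq]), ?_⟩
    exact eval_v_of_not_writesVar (by decide) _

/-- One visit unfolds `branch` once. The remaining answers are the suffix of `bits` from `pos` on,
so consuming an answer amounts to advancing `pos`. -/
theorem visit_spec (h : Env n E σ) (hsymm : ∀ u w, E u w → E w u) (hirr : ∀ v, ¬ E v v)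
    (hv : σ.v .v < n) (vs : List ℕ) {σ' : Store Var Arr} (hσ' : σ' = visit.eval σ) :
    branch E (tau E) (σ.v .v :: vs) (supp n (σ.a .S)) (σ.v .c)
        (fun j => σ.a .bits (σ.v .pos + j) ≠ 0) =
      branch E (tau E) vs (supp n (σ'.a .S)) (σ'.v .c)
        (fun j => σ.a .bits (σ'.v .pos + j) ≠ 0) ∧ σ'.v .v = σ.v .v + 1 := by
  obtain ⟨v, hvdef⟩ : ∃ v, v = σ.v .v := ⟨_, rfl⟩
  obtain ⟨S, hS⟩ : ∃ S, S = supp n (σ.a .S) := ⟨_, rfl⟩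
  rw [← hvdef, ← hS]
  rw [← hvdef] at hv
  by_cases hvS : σ.a .S v = 0
  · have h1 : v ∉ S := fun hmem => (mem_supp.1 (hS ▸ hmem)).2 hvS
    rw [hσ', branch, if_neg h1]
    simp [visit, ← hvdef, hvS, hS]
  have hvS' : v ∈ S := hS ▸ mem_supp.2 ⟨hv, hvS⟩
  obtain ⟨σ₀, hσ₀⟩ : ∃ τ, τ = (load .t .S .v : Cmd Var Arr).eval σ := ⟨_, rfl⟩
  have henv₀ : Env n E σ₀ := hσ₀ ▸ h.eval (by decide) (by decide)
  have hv₀ : σ₀.v .v = v := by simp [hσ₀, hvdef]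
  obtain ⟨σ₁, hσ₁⟩ : ∃ τ, τ = evaluate.eval σ₀ := ⟨_, rfl⟩
  obtain ⟨ht₀, ht₁, ht₂, hT, hg, hc⟩ := evaluate_spec henv₀ hsymm hirr (by rwa [hv₀])
    (S := S) (by simp [hσ₀, hS]) hv₀ hσ₁
  have henv₁ : Env n E σ₁ := hσ₁ ▸ henv₀.eval (by decide) (by decide)
  have hkeep : ∀ x ∈ [Var.v, .c, .pos], σ₁.v x = σ.v x := by
    intro x hx
    rw [hσ₁, hσ₀, eval_v_of_not_writesVar (by revert x; decide),
      eval_v_of_not_writesVar (by revert x; decide)]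
  have hS₁ : supp n (σ₁.a .S) = S := by
    rw [hσ₁, eval_a_of_not_writesArr (by decide), hσ₀, hS]
    simp
  have hb₁ : σ₁.a .bits = σ.a .bits := by
    rw [hσ₁, eval_a_of_not_writesArr (by decide), hσ₀]
    simp
  obtain ⟨σ₂, hσ₂⟩ : ∃ τ, τ = choose.eval σ₁ := ⟨_, rfl⟩
  have henv₂ : Env n E σ₂ := hσ₂ ▸ henv₁.eval (by decide) (by decide)
  have hkeep₂ : ∀ x ∈ [Var.v, .c, .cOut], σ₂.v x = σ₁.v x := by
    intro x hx
    rw [hσ₂, eval_v_of_not_writesVar (by revert x; decide)]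
  have ha₂ : ∀ c, σ₂.a c = σ₁.a c := by
    intro c
    rw [hσ₂, eval_a_of_not_writesArr (by revert c; intro c; cases c <;> rfl)]
  have hfin : σ' = (succ .v : Cmd Var Arr).eval (update.eval σ₂) := by
    have e1 : σ₀.v .t ≠ 0 := by simpa [hσ₀, ← hvdef] using hvS
    rw [hσ', visit, eval_block_cons, eval_block_cons, ← hσ₀, eval_ifz, if_neg e1, hσ₂, hσ₁]
    simp only [eval_block_cons, eval_block_nil]
  obtain ⟨hu₀, hu₁⟩ := update_spec henv₂ (S := S) (v := v) (by rw [ha₂, hS₁])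
    (by rw [hkeep₂ _ (by decide), hkeep _ (by decide), hvdef]) rfl
  have hpos : σ'.v .pos = σ₂.v .pos := by
    rw [hfin, eval_succ]
    simp only [ne_eq, reduceCtorEq, not_false_eq_true, Function.update_of_ne]
    exact eval_v_of_not_writesVar (by decide) _
  have hSc : σ'.a .S = (update.eval σ₂).a .S ∧ σ'.v .c = (update.eval σ₂).v .c := by
    rw [hfin]; simp
  rw [ha₂, hT, hkeep₂ .cOut (by decide), hc] at hu₁
  rw [hkeep₂ .c (by decide), hkeep _ (by decide)] at hu₀
  rw [hSc.1, hSc.2, hpos]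
  have hσ₀c : σ₀.v .c = σ.v .c := by simp [hσ₀]
  rw [hσ₀c] at hu₁
  refine ⟨?_, ?_⟩
  swap
  · rw [hfin, eval_succ]
    simp only [Function.update_self]
    rw [eval_v_of_not_writesVar (by decide), hkeep₂ _ (by decide), hkeep _ (by decide), hvdef]
  have hp₁ := hkeep .pos (by decide)
  have hone := henv₁.one_eq
  rw [branch, if_pos hvS']
  by_cases c1 : tau E (S.erase v) + 2 ≤ tau E S
  · have : ¬ tau E S - tau E (S.erase v) - 1 = 0 := by omega
    have ho : σ₂.v .out = 0 ∧ σ₂.v .pos = σ.v .pos := by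
      simp [hσ₂, choose, ht₀, ht₁, hone, this, hp₁]
    rw [if_pos c1, (hu₀ ho.1).1, (hu₀ ho.1).2, ho.2]
  have h1 : tau E S - tau E (S.erase v) - 1 = 0 := by omega
  rw [if_neg c1]
  -- With truncated subtraction, the test `gain - (tau₀ - tau) = 0` expresses the intended
  -- inequality only if `tau ≤ tau₀`.
  have hmono : tau E (rest E S v) ≤ tau E S := (isTau_tau E S).mono (isTau_tau E _)
    fun w hw => (mem_rest.1 hw).1
  by_cases c2 : tau E (rest E S v) + 2 * (nbrs E S v).card ≤ tau E S
  · have h2 : 2 * (nbrs E S v).card - (tau E S - tau E (rest E S v)) = 0 := by omega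
    have ho : σ₂.v .out ≠ 0 ∧ σ₂.v .pos = σ.v .pos := by
      simp [hσ₂, choose, ht₀, ht₁, ht₂, hg, hone, h1, h2, hp₁]
    rw [if_pos c2, (hu₁ ho.1).1, (hu₁ ho.1).2, ho.2]
  have h2 : ¬ 2 * (nbrs E S v).card - (tau E S - tau E (rest E S v)) = 0 := by omega
  have ho : σ₂.v .out = σ.a .bits (σ.v .pos) ∧ σ₂.v .pos = σ.v .pos + 1 := by
    simp [hσ₂, choose, ht₀, ht₁, ht₂, hg, hone, h1, h2, hp₁, hb₁]
  rw [if_neg c2, ho.2]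
  have hshift : (fun j => σ.a .bits (σ.v .pos + (j + 1)) ≠ 0) =
      fun j => σ.a .bits (σ.v .pos + 1 + j) ≠ 0 := by
    funext j
    rw [add_assoc, add_comm 1 j]
  rw [hshift, add_zero]
  by_cases c3 : σ.a .bits (σ.v .pos) = 0
  · rw [if_neg (not_not.2 c3), (hu₀ (ho.1.trans c3)).1, (hu₀ (ho.1.trans c3)).2]
  · have ho' : σ₂.v .out ≠ 0 := by rwa [ho.1]
    rw [if_pos c3, (hu₁ ho').1, (hu₁ ho').2]

/-- The size of the cover found by following the answers `b`. -/
noncomputable def coverSize (n : ℕ) (E : ℕ → ℕ → Prop) (b : ℕ → Prop) : ℕ :=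
  branch E (tau E) (List.range n) (Finset.range n) 0 b

theorem attempt_spec (h : Env n E σ) (hsymm : ∀ u w, E u w → E w u) (hirr : ∀ v, ¬ E v v) :
    (attempt.eval σ).v .ans = if coverSize n E (fun j => σ.a .bits j ≠ 0) ≤ σ.v .b then 1
      else σ.v .ans := by
  obtain ⟨ρ, hρ⟩ : ∃ ρ, ρ = (block [fill .n .S .one, const .c 0, const .pos 0, const .v 0]).eval σ :=
    ⟨_, rfl⟩
  have henv : Env n E ρ := hρ ▸ h.eval (by decide) (by decide)
  have hS : supp n (ρ.a .S) = Finset.range n := by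
    ext w
    rw [mem_supp, Finset.mem_range]
    refine ⟨fun hw => hw.1, fun hw => ⟨hw, ?_⟩⟩
    have := fill_spec (σ := σ) (m := .n) (x := .one) (c := .S) (by decide) (by decide) w
      (by rwa [h.n_eq])
    simp [hρ, this, h.one_eq]
  have hb : ρ.a .bits = σ.a .bits := by rw [hρ, eval_a_of_not_writesArr (by decide)]
  have key := eval_loop_induction (x := .n) (s := visit) (σ := ρ) (fun i τ =>
    Env n E τ ∧ τ.v .v = i ∧ τ.a .bits = σ.a .bits ∧
    branch E (tau E) (List.range' i (n - i)) (supp n (τ.a .S)) (τ.v .c)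
        (fun j => σ.a .bits (τ.v .pos + j) ≠ 0) =
      coverSize n E (fun j => σ.a .bits j ≠ 0)) ?_ ?_
  · rw [henv.n_eq] at key
    obtain ⟨-, -, -, h1⟩ := key
    obtain ⟨τ, hτ⟩ : ∃ τ, τ = (loop .n visit).eval ρ := ⟨_, rfl⟩
    rw [← hτ, Nat.sub_self, List.range'_zero, branch] at h1
    have e : attempt.eval σ = (block [sub .t .c .b, ifz .t (const .ans 1) skip]).eval τ := by
      rw [hτ, hρ]; rfl
    have hτb : τ.v .b = σ.v .b := by
      rw [hτ, eval_v_of_not_writesVar (by decide), hρ, eval_v_of_not_writesVar (by decide)]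
    have hτa : τ.v .ans = σ.v .ans := by
      rw [hτ, eval_v_of_not_writesVar (by decide), hρ, eval_v_of_not_writesVar (by decide)]
    rw [e, ← h1]
    by_cases c : τ.v .c ≤ σ.v .b
    · simp [hτb, c, Nat.sub_eq_zero_of_le c]
    · have : τ.v .c - σ.v .b ≠ 0 := by omega
      simp [hτb, hτa, c, this]
  · refine ⟨henv, by simp [hρ], hb, ?_⟩
    rw [hS, coverSize, Nat.sub_zero, ← List.range_eq_range']
    simp [hρ]
  · rintro i τ hi ⟨h1, h2, h3, h4⟩
    rw [henv.n_eq] at hi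
    obtain ⟨h5, h6⟩ := visit_spec h1 hsymm hirr (by rwa [h2]) (List.range' (i + 1) (n - (i + 1))) rfl
    rw [h2] at h5 h6
    rw [h3] at h5
    refine ⟨h1.eval (by decide) (by decide), h6, ?_, ?_⟩
    · rw [eval_a_of_not_writesArr (by decide), h3]
    · rw [← h4, ← h5, show n - i = n - (i + 1) + 1 by omega, List.range'_succ]

/-- The carry into position `i` is 1 exactly when `2 ^ i` divides `x + 1`. A carry out of the last
position is lost, which matters only after the last attempt. -/
theorem increment_spec (h0 : σ.v .zero = 0) (h1 : σ.v .one = 1) {m x : ℕ}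
    (hm : σ.v .bitCount = m) (hx : ∀ w < m, σ.a .bits w = x / 2 ^ w % 2) :
    ∀ w < m, (increment.eval σ).a .bits w = (x + 1) / 2 ^ w % 2 := by
  obtain ⟨ρ, hρ⟩ : ∃ ρ, ρ = (block [const .carry 1, const .w 0]).eval σ := ⟨_, rfl⟩
  have hdiv : ∀ i, (x + 1) / 2 ^ i = x / 2 ^ i + (if (x + 1) % 2 ^ i = 0 then 1 else 0) := by
    intro i
    rw [Nat.succ_div]
    simp only [Nat.dvd_iff_mod_eq_zero]
  have hmod : ∀ i, (x + 1) % 2 ^ (i + 1) = 0 ↔ (x + 1) % 2 ^ i = 0 ∧ x / 2 ^ i % 2 = 1 := by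
    intro i
    rw [pow_succ, Nat.mod_mul, hdiv]
    have := Nat.two_pow_pos i
    split_ifs with hc
    · simp only [hc, zero_add, true_and]
      rw [mul_eq_zero]
      omega
    · simp [hc]
  have key := eval_loop_induction (x := .bitCount) (s := block [
      ifz .carry skip (block [
        load .t .bits .w,
        ifz .t (block [store .bits .w .one, const .carry 0]) (store .bits .w .zero)]),
      succ .w]) (σ := ρ) (fun i τ =>
    τ.v .zero = 0 ∧ τ.v .one = 1 ∧ τ.v .w = i ∧
    τ.v .carry = (if (x + 1) % 2 ^ i = 0 then 1 else 0) ∧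
    (∀ w < m, i ≤ w → τ.a .bits w = x / 2 ^ w % 2) ∧
    ∀ w < i, τ.a .bits w = (x + 1) / 2 ^ w % 2) ?_ ?_
  · have : ρ.v .bitCount = m := by simp [hρ, hm]
    rw [this] at key
    obtain ⟨-, -, -, -, -, h⟩ := key
    rw [hρ] at h
    exact h
  · refine ⟨by simp [hρ, h0], by simp [hρ, h1], by simp [hρ], by simp [hρ, Nat.mod_one], ?_, by simp⟩
    simpa [hρ] using hx
  · rintro i τ hi ⟨h2, h3, h4, h5, h6, h7⟩
    have : ρ.v .bitCount = m := by simp [hρ, hm]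
    rw [this] at hi
    have hbit := h6 i hi le_rfl
    have hlow : ∀ y, y = (x + 1) / 2 ^ i % 2 → ∀ w < i + 1,
        Function.update (τ.a .bits) i y w = (x + 1) / 2 ^ w % 2 := by
      intro y hy w hw
      by_cases e : w = i
      · rw [e, Function.update_self, hy]
      · rw [Function.update_of_ne e]
        exact h7 w (by omega)
    have hhigh : ∀ y, ∀ w < m, i + 1 ≤ w → Function.update (τ.a .bits) i y w = x / 2 ^ w % 2 := by
      intro y w hw hiw
      rw [Function.update_of_ne (by omega)]
      exact h6 w hw (by omega)
    by_cases c1 : (x + 1) % 2 ^ i = 0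
    · rw [if_pos c1] at h5
      have hd := hdiv i
      rw [if_pos c1] at hd
      by_cases c2 : x / 2 ^ i % 2 = 0
      · have c3 : ¬ (x + 1) % 2 ^ (i + 1) = 0 := by rw [hmod]; omega
        simp only [c3]
        refine ⟨?_, ?_, ?_, ?_, ?_, ?_⟩ <;> simp [h2, h3, h4, h5, hbit, c2]
        · exact hhigh 1
        · intro w hw; exact hlow 1 (by omega) w (by omega)
      · have c3 : (x + 1) % 2 ^ (i + 1) = 0 := by rw [hmod]; omega
        simp only [c3]
        refine ⟨?_, ?_, ?_, ?_, ?_, ?_⟩ <;> simp [h2, h3, h4, h5, hbit, c2]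
        · exact hhigh 0
        · intro w hw; exact hlow 0 (by omega) w (by omega)
    · rw [if_neg c1] at h5
      have hd := hdiv i
      rw [if_neg c1] at hd
      have c3 : ¬ (x + 1) % 2 ^ (i + 1) = 0 := by rw [hmod]; tauto
      simp only [c3]
      refine ⟨?_, ?_, ?_, ?_, ?_, ?_⟩ <;> simp [h2, h3, h4, h5]
      · exact fun w hw hiw => h6 w hw (by omega)
      · intro w hw
        have := hlow _ rfl w (by omega)
        by_cases e : w = i
        · rw [e, hbit, hd, add_zero]
        · exact h7 w (by omega)

theorem exists_bits (m : ℕ) : ∀ g : ℕ → Prop, ∃ x < 2 ^ m, ∀ i < m, (x / 2 ^ i % 2 ≠ 0 ↔ g i) := by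
  classical
  induction m with
  | zero => exact fun g => ⟨0, by simp, by simp⟩
  | succ m ih =>
    intro g
    obtain ⟨x, hx, h⟩ := ih fun i => g (i + 1)
    refine ⟨2 * x + (if g 0 then 1 else 0), ?_, ?_⟩
    · rw [pow_succ]
      split_ifs <;> omega
    · intro i hi
      cases i with
      | zero =>
        simp only [pow_zero, Nat.div_one]
        split_ifs with h0 <;> simp [h0]
      | succ i =>
        rw [← h i (by omega), pow_succ', ← Nat.div_div_eq_div_mul]
        have : (2 * x + (if g 0 then 1 else 0)) / 2 = x := by split_ifs <;> omega
        rw [this]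

/-- The loop counter `i`, written in binary, is the string tried in pass `i`, so all strings of
length `m` occur. An attempt may read beyond position `m`, where the array is arbitrary;
completeness therefore asks for an answer string whose first `m` entries alone guarantee success. -/
theorem search_spec (h : Env n E σ) (hsymm : ∀ u w, E u w → E w u) (hirr : ∀ v, ¬ E v v) {m b : ℕ}
    (hm : σ.v .bitCount = m) (hcount : σ.v .count = 2 ^ m) (hb : σ.v .b = b) :
    ((search.eval σ).v .ans = 0 ∨ (search.eval σ).v .ans = 1) ∧
    ((search.eval σ).v .ans = 1 → ∃ g, coverSize n E g ≤ b) ∧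
    ((∃ g : ℕ → Prop, ∀ g' : ℕ → Prop, (∀ i < m, g' i ↔ g i) → coverSize n E g' ≤ b) →
      (search.eval σ).v .ans = 1) := by
  obtain ⟨ρ, hρ⟩ : ∃ ρ, ρ = (block [const .ans 0, fill .bitCount .bits .zero]).eval σ := ⟨_, rfl⟩
  have hv : ∀ x ∈ [Var.bitCount, .count, .b], ρ.v x = σ.v x := by
    intro x hx
    rw [hρ, eval_v_of_not_writesVar (by revert x; decide)]
  have hans : ρ.v .ans = 0 := by
    rw [hρ, eval_block_cons, eval_block_cons, eval_block_nil, eval_v_of_not_writesVar (by decide)]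
    simp
  have hbits : ∀ w < m, ρ.a .bits w = 0 := by
    intro w hw
    have := fill_spec (σ := (const .ans 0 : Cmd Var Arr).eval σ) (m := .bitCount) (x := .zero)
      (c := .bits) (by decide) (by decide) w (by simpa [hm] using hw)
    rw [hρ]
    simpa [h.zero_eq] using this
  have key := eval_loop_induction (x := .count) (s := block [attempt, increment]) (σ := ρ)
    (fun i τ => Env n E τ ∧ τ.v .bitCount = m ∧ τ.v .b = b ∧
      (∀ w < m, τ.a .bits w = i / 2 ^ w % 2) ∧ (τ.v .ans = 0 ∨ τ.v .ans = 1) ∧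
      (τ.v .ans = 1 → ∃ g, coverSize n E g ≤ b) ∧
      ((∃ j < i, ∀ g : ℕ → Prop, (∀ w < m, (g w ↔ j / 2 ^ w % 2 ≠ 0)) → coverSize n E g ≤ b) →
        τ.v .ans = 1)) ?_ ?_
  · rw [hv _ (by decide), hcount] at key
    obtain ⟨-, -, -, -, h1, h2, h3⟩ := key
    rw [hρ] at h1 h2 h3
    refine ⟨h1, h2, ?_⟩
    rintro ⟨g, hg⟩
    obtain ⟨x, hx, hxg⟩ := exists_bits m g
    exact h3 ⟨x, hx, fun g' hg' => hg g' fun i hi => (hg' i hi).trans (hxg i hi)⟩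
  · refine ⟨hρ ▸ h.eval (by decide) (by decide), by rw [hv _ (by decide), hm],
      by rw [hv _ (by decide), hb], by simpa using hbits, Or.inl hans, by simp [hans], by simp⟩
  · rintro i τ - ⟨h1, h2, h3, h4, h5, h6, h7⟩
    have hatt := attempt_spec h1 hsymm hirr
    obtain ⟨τ', hτ'⟩ : ∃ τ', τ' = attempt.eval τ := ⟨_, rfl⟩
    rw [← hτ', h3] at hatt
    have henv' : Env n E τ' := hτ' ▸ h1.eval (by decide) (by decide)
    have hbits' : τ'.a .bits = τ.a .bits := by rw [hτ', eval_a_of_not_writesArr (by decide)]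
    have hm' : τ'.v .bitCount = m := by rw [hτ', eval_v_of_not_writesVar (by decide), h2]
    have e : (block [attempt, increment]).eval τ = increment.eval τ' := by rw [hτ']; rfl
    have hans' : (increment.eval τ').v .ans = τ'.v .ans := eval_v_of_not_writesVar (by decide) _
    rw [e]
    refine ⟨henv'.eval (by decide) (by decide), ?_, ?_, ?_, ?_, ?_, ?_⟩
    · rw [eval_v_of_not_writesVar (by decide), hm']
    · rw [eval_v_of_not_writesVar (by decide), hτ', eval_v_of_not_writesVar (by decide), h3]
    · exact increment_spec henv'.zero_eq henv'.one_eq hm' (by rwa [hbits'])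
    · rw [hans', hatt]
      split_ifs
      · exact Or.inr rfl
      · exact h5
    · rw [hans', hatt]
      split_ifs with hc
      · exact fun _ => ⟨_, hc⟩
      · exact h6
    · rintro ⟨j, hj, hg⟩
      rw [hans', hatt]
      split_ifs with hc
      · rfl
      · refine h7 ⟨j, ?_, hg⟩
        by_contra hji
        have : j = i := by omega
        subst this
        exact hc (hg _ fun w hw => by rw [h4 w hw])

end VCL1.Algorithm

/-! ### Repeated increments and nested loops -/

namespace Cmd

variable {V A : Type} [DecidableEq V] [DecidableEq A]

theorem eval_loop_succ (σ : Store V A) (x y : V) :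
    (loop y (succ x)).eval σ = ⟨Function.update σ.v x (σ.v x + σ.v y), σ.a⟩ :=
  eval_loop_induction (x := y) (s := succ x) (σ := σ)
    (fun i τ => τ = ⟨Function.update σ.v x (σ.v x + i), σ.a⟩) (by simp) (by
      rintro i τ - rfl
      simp [add_assoc])

/-- A double loop over the same unchanged variable is treated as one loop of `m * m` passes, so that
the invariant needs a single index. -/
theorem eval_loop_loop_induction {x : V} {s : Cmd V A} (I : ℕ → Store V A → Prop) {σ : Store V A}
    {m : ℕ} (hm : σ.v x = m) (hx : s.writesVar x = false) (h0 : I 0 σ)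
    (hs : ∀ i τ, i < m * m → I i τ → I (i + 1) (s.eval τ)) :
    I (m * m) ((loop x (loop x s)).eval σ) := by
  have key := eval_loop_induction (x := x) (s := loop x s) (σ := σ)
    (fun i τ => τ.v x = m ∧ I (i * m) τ) ⟨hm, by simpa⟩ ?_
  · rw [hm] at key
    exact key.2
  · rintro i τ hi ⟨h1, h2⟩
    have := eval_loop_induction (x := x) (s := s) (σ := τ)
      (fun j τ' => I (i * m + j) τ') h2 (fun j τ' hj h => hs _ _ ?_ h)
    · rw [h1] at this
      refine ⟨?_, by rwa [add_mul, one_mul]⟩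
      rw [eval_v_of_not_writesVar (s := loop x s) hx, h1]
    · rw [hm] at hi
      rw [h1] at hj
      calc i * m + j < (i + 1) * m := by rw [add_mul]; omega
        _ ≤ m * m := Nat.mul_le_mul_right m hi

end Cmd

namespace VCL1.Algorithm

open Cmd HalfCover

variable {n : ℕ} {E : ℕ → ℕ → Prop} {σ : Store Var Arr}

/-! ### Correctness of the setup -/

/-- Used with `c = 1` and `c = 2`: the places where `B` and `k` are kept never collide with an
off-diagonal entry. The point is that `c < n` follows from the position lying inside the matrix,
after which quotient and remainder are unique. -/
theorem eq_of_mul_add_eq {u w c : ℕ} (hu : u < n) (hw : w < n) (h : u * n + w = c * n + c) :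
    u = w := by
  have hc : c < n := by
    have h1 : u * n + w < n * n := by
      calc u * n + w < (u + 1) * n := by rw [add_mul]; omega
        _ ≤ n * n := Nat.mul_le_mul_right n hu
    exact Nat.lt_of_mul_lt_mul_right (a := n) (by omega)
  have hwc : w = c := by
    rw [← Nat.mul_add_mod_of_lt (a := u) hw, h, Nat.mul_add_mod_of_lt hc]
  subst hwc
  exact Nat.eq_of_mul_eq_mul_right (by omega) (Nat.add_right_cancel h)

theorem readParams_spec (hn : σ.v .n = n) (hirr : ∀ v, ¬ E v v) {B k : ℕ}
    (hB : σ.a .adj (n + 1) = B) (hk : σ.a .adj (2 * n + 2) = k)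
    (hadj : ∀ u < n, ∀ w < n, u ≠ w → (σ.a .adj (u * n + w) ≠ 0 ↔ E u w))
    (hdiag : ∀ u < n, u * n + u ≠ n + 1 → u * n + u ≠ 2 * n + 2 → σ.a .adj (u * n + u) = 0)
    {σ' : Store Var Arr} (hσ' : σ' = readParams.eval σ) :
    σ'.v .n = n ∧ σ'.v .zero = 0 ∧ σ'.v .one = 1 ∧ σ'.v .B = B ∧ σ'.v .k = k ∧
      ∀ u < n, ∀ w < n, σ'.a .adj (u * n + w) ≠ 0 ↔ E u w := by
  have e : n + 1 + 1 + n = 2 * n + 2 := by omega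
  have e' : 2 * n + 2 ≠ n + 1 := by omega
  have ha : σ'.a .adj = Function.update (Function.update (σ.a .adj) (n + 1) 0) (2 * n + 2) 0 := by
    rw [hσ']
    simp [readParams, eval_loop_succ, hn, e]
  refine ⟨?_, ?_, ?_, ?_, ?_, ?_⟩
  · simp [hσ', readParams, eval_loop_succ, hn]
  · simp [hσ', readParams, eval_loop_succ]
  · simp [hσ', readParams, eval_loop_succ]
  · simp [hσ', readParams, eval_loop_succ, hn, hB]
  · simp [hσ', readParams, eval_loop_succ, hn, e, e', hk]
  intro u hu w hw
  rw [ha]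
  by_cases huw : u = w
  · subst huw
    have : Function.update (Function.update (σ.a .adj) (n + 1) 0) (2 * n + 2) 0 (u * n + u) = 0 := by
      by_cases h1 : u * n + u = 2 * n + 2
      · rw [h1, Function.update_self]
      rw [Function.update_of_ne h1]
      by_cases h2 : u * n + u = n + 1
      · rw [h2, Function.update_self]
      rw [Function.update_of_ne h2]
      exact hdiag u hu h2 h1
    simp [this, hirr]
  · rw [Function.update_of_ne, Function.update_of_ne]
    · exact hadj u hu w hw huw
    · exact fun h => huw (eq_of_mul_add_eq (c := 1) hu hw (by omega))
    · exact fun h => huw (eq_of_mul_add_eq (c := 2) hu hw (by omega))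

theorem initRows_spec (hn : σ.v .n = n) (hz : σ.v .zero = 0) (ho : σ.v .one = 1)
    (hadj : ∀ u < n, ∀ w < n, σ.a .adj (u * n + w) ≠ 0 ↔ E u w) : Env n E (initRows.eval σ) := by
  obtain ⟨σ₁, hσ₁⟩ : ∃ τ, τ = (block [copy .level .n, succ .level, const .rounds 1,
    loop .n (block [succ .rounds, loop .n (succ .rounds)])]).eval σ := ⟨_, rfl⟩
  have h₁ : σ₁.v .n = n ∧ σ₁.v .level = n + 1 ∧ σ₁.v .rounds = 1 + n * (n + 1) := by
    have := eval_loop_induction (x := .n) (s := block [succ .rounds, loop .n (succ .rounds)])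
      (σ := (block [copy .level .n, succ .level, const .rounds 1]).eval σ)
      (fun i τ => τ.v .n = n ∧ τ.v .level = n + 1 ∧ τ.v .rounds = 1 + i * (n + 1))
      (by simp [hn]) (by
        rintro i τ - ⟨h1, h2, h3⟩
        simp [eval_loop_succ, h1, h2, h3]
        ring)
    have e : ((block [copy .level .n, succ .level, const .rounds 1]).eval σ).v .n = n := by simp [hn]
    rw [e] at this
    rw [hσ₁]
    exact this
  have h₁' : σ₁.v .zero = 0 ∧ σ₁.v .one = 1 := by
    rw [hσ₁, eval_v_of_not_writesVar (by decide), eval_v_of_not_writesVar (by decide)]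
    exact ⟨hz, ho⟩
  have hrow := eval_loop_induction (x := .n)
    (s := block [store .row .w .t, succ .w, loop .n (succ .t)])
    (σ := (block [const .t 0, const .w 0]).eval σ₁)
    (fun i τ => τ.v .n = n ∧ τ.v .t = i * n ∧ τ.v .w = i ∧ ∀ u < i, τ.a .row u = u * n)
    (by simp [h₁.1]) (by
      rintro i τ - ⟨h1, h2, h3, h4⟩
      simp [eval_loop_succ, h1, h2, h3]
      refine ⟨by ring, fun u hu => ?_⟩
      by_cases e : u = i
      · simp [e]
      · rw [Function.update_of_ne e]
        exact h4 u (by omega))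
  have e : ((block [const .t 0, const .w 0]).eval σ₁).v .n = n := by simp [h₁.1]
  rw [e] at hrow
  have e' : initRows.eval σ = (block [const .t 0, const .w 0,
      loop .n (block [store .row .w .t, succ .w, loop .n (succ .t)])]).eval σ₁ := by
    rw [hσ₁]; rfl
  constructor
  · rw [eval_v_of_not_writesVar (by decide), hn]
  · rw [eval_v_of_not_writesVar (by decide), hz]
  · rw [eval_v_of_not_writesVar (by decide), ho]
  · rw [e', eval_v_of_not_writesVar (by decide), h₁.2.1]
  · rw [e', eval_v_of_not_writesVar (by decide), h₁.2.2]
    ring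
  · rw [e']
    exact hrow.2.2.2
  · rw [eval_a_of_not_writesArr (by decide)]
    exact hadj

theorem sum_range_mul_self (f : ℕ → ℕ) (m : ℕ) :
    ∑ i ∈ Finset.range (m * n), f i = ∑ u ∈ Finset.range m, ∑ w ∈ Finset.range n, f (u * n + w) := by
  induction m with
  | zero => simp
  | succ m ih => rw [add_mul, one_mul, Finset.sum_range_add, ih, Finset.sum_range_succ]

open scoped Classical in
/-- The number of pairs of adjacent vertices below `n`. -/
noncomputable def pairs (n : ℕ) (E : ℕ → ℕ → Prop) : ℕ :=
  ∑ u ∈ Finset.range n, ∑ w ∈ Finset.range n, if E u w then 1 else 0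

theorem countEntries_spec (h : Env n E σ) : (countEntries.eval σ).v .twice = pairs n E := by
  classical
  have key := eval_loop_loop_induction (x := .n) (m := n)
    (s := block [load .t .adj .ptr, ifz .t skip (succ .twice), succ .ptr])
    (σ := (block [const .ptr 0, const .twice 0]).eval σ)
    (fun i τ => τ.a .adj = σ.a .adj ∧ τ.v .ptr = i ∧
      τ.v .twice = ∑ j ∈ Finset.range i, if σ.a .adj j ≠ 0 then 1 else 0)
    (by simp [h.n_eq]) (by decide) (by simp) (by
      rintro i τ - ⟨h1, h2, h3⟩
      rw [Finset.sum_range_succ]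
      by_cases c : σ.a .adj i = 0
      · simp [h1, h2, h3, c]
      · simp [h1, h2, h3, c])
  refine key.2.2.trans ?_
  rw [sum_range_mul_self, pairs]
  refine Finset.sum_congr rfl fun u hu => Finset.sum_congr rfl fun w hw => ?_
  rw [Finset.mem_range] at hu hw
  simp only [h.adj_iff u hu w hw]

/-- Division by repeated subtraction of `2 * B`. In the invariant, either the remainder is already
below `2 * B` or every pass so far has subtracted. -/
theorem computeBound_spec (h : Env n E σ) {B k m : ℕ} (hB : σ.v .B = B) (hk : σ.v .k = k)
    (hm : σ.v .twice = m) (hB0 : 0 < B) (hmn : m ≤ n * n)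
    {σ' : Store Var Arr} (hσ' : σ' = computeBound.eval σ) :
    σ'.v .b = k + m / (2 * B) ∧ σ'.v .t = m - 2 * (k + m / (2 * B)) := by
  obtain ⟨ρ, hρ⟩ : ∃ ρ, ρ = (block [copy .b .k, copy .r .twice, loop .n (loop .n (block [
    copy .t .r, succ .t, sub .t .t .B, sub .t .t .B,
    ifz .t skip (block [sub .r .t .one, succ .b])]))]).eval σ := ⟨_, rfl⟩
  have key := eval_loop_loop_induction (x := .n) (m := n) (s := block [
      copy .t .r, succ .t, sub .t .t .B, sub .t .t .B,
      ifz .t skip (block [sub .r .t .one, succ .b])])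
    (σ := (block [copy .b .k, copy .r .twice]).eval σ)
    (fun i τ => τ.v .one = 1 ∧ τ.v .B = B ∧ ∃ q, τ.v .b = k + q ∧ τ.v .r + 2 * B * q = m ∧
      (τ.v .r < 2 * B ∨ q = i))
    (by simp [h.n_eq]) (by decide) (by simp [h.one_eq, hB, hk, hm]) (by
      rintro i τ - ⟨h1, h2, q, h3, h4, h5⟩
      by_cases c : τ.v .r + 1 - B - B = 0
      · simp [h1, h2, c]
        exact ⟨q, h3, h4, by omega⟩
      · simp [h1, h2, c]
        refine ⟨q + 1, by omega, ?_, by omega⟩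
        rw [mul_add]
        omega)
  have e : (loop .n (loop .n (block [
      copy .t .r, succ .t, sub .t .t .B, sub .t .t .B,
      ifz .t skip (block [sub .r .t .one, succ .b])]))).eval
      ((block [copy .b .k, copy .r .twice]).eval σ) = ρ := by rw [hρ]; rfl
  rw [e] at key
  obtain ⟨-, -, q, h3, h4, h5⟩ := key
  -- The `n * n` passes are enough because `m ≤ n * n`: if all of them subtracted and a remainder of
  -- at least `2 * B` were left, `m` would be too large.
  have hr : ρ.v .r < 2 * B := by
    rcases h5 with h5 | h5
    · exact h5
    · subst h5
      by_contra hcon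
      nlinarith
  have hq : q = m / (2 * B) := by
    rw [← h4, Nat.add_mul_div_left _ _ (by omega), Nat.div_eq_of_lt hr, zero_add]
  rw [← hq]
  have ht : ρ.v .twice = m := by rw [hρ, eval_v_of_not_writesVar (by decide), hm]
  have hfin : σ' = (block [sub .t .twice .b, sub .t .t .b]).eval ρ := by rw [hσ', hρ]; rfl
  rw [hfin]
  simp [h3, ht]
  omega

theorem prepare_spec {k : ℕ} (hk : σ.v .k = k) :
    (prepare.eval σ).v .bitCount = 2 * k ∧ (prepare.eval σ).v .count = 2 ^ (2 * k) := by
  obtain ⟨ρ, hρ⟩ : ∃ ρ, ρ = (block [const .bitCount 0,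
    loop .k (block [succ .bitCount, succ .bitCount])]).eval σ := ⟨_, rfl⟩
  have h1 := eval_loop_induction (x := .k) (s := block [succ .bitCount, succ .bitCount])
    (σ := (const .bitCount 0 : Cmd Var Arr).eval σ) (fun i τ => τ.v .bitCount = 2 * i)
    (by simp) (by
      rintro i τ - h
      simp [h]
      ring)
  have e : ((const .bitCount 0 : Cmd Var Arr).eval σ).v .k = k := by simp [hk]
  rw [e] at h1
  have hb : ρ.v .bitCount = 2 * k := by rw [hρ]; exact h1
  have h2 := eval_loop_induction (x := .bitCount) (s := block [copy .aux .count,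
    loop .aux (succ .count)]) (σ := (const .count 1 : Cmd Var Arr).eval ρ)
    (fun i τ => τ.v .count = 2 ^ i) (by simp) (by
      rintro i τ - h
      simp [eval_loop_succ, h]
      ring)
  have e : ((const .count 1 : Cmd Var Arr).eval ρ).v .bitCount = 2 * k := by simp [hb]
  rw [e] at h2
  have e2 : prepare.eval σ = (block [const .count 1, loop .bitCount (block [copy .aux .count,
    loop .aux (succ .count)])]).eval ρ := by rw [hρ]; rfl
  rw [e2]
  refine ⟨?_, h2⟩
  rw [eval_v_of_not_writesVar (by decide), hb]

end VCL1.Algorithm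

/-! ### Step counts of loops whose body varies in cost -/

namespace Cmd

variable {V A : Type} [DecidableEq V] [DecidableEq A]

theorem steps_block_nil (σ : Store V A) : (block ([] : List (Cmd V A))).steps σ = 0 := rfl

theorem steps_block_cons (σ : Store V A) (s : Cmd V A) (l : List (Cmd V A)) :
    (block (s :: l)).steps σ = s.steps σ + (block l).steps (s.eval σ) := rfl

theorem steps_loop_le {x : V} {s : Cmd V A} {σ : Store V A} {m : ℕ} (hm : σ.v x = m)
    (I : ℕ → Store V A → Prop) (f : ℕ → ℕ) (h0 : I 0 σ)
    (hs : ∀ i τ, I i τ → I (i + 1) (s.eval τ)) (hf : ∀ i τ, I i τ → s.steps τ ≤ f i) :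
    (loop x s).steps σ ≤ 1 + ∑ i ∈ Finset.range m, (1 + f i) := by
  have hI : ∀ i, I i (s.eval^[i] σ) := by
    intro i
    induction i with
    | zero => exact h0
    | succ i ih => rw [Function.iterate_succ_apply']; exact hs i _ ih
  rw [steps, hm]
  exact Nat.add_le_add_left (Finset.sum_le_sum fun i _ => Nat.add_le_add_left (hf i _ (hI i)) 1) 1

end Cmd

namespace VCL1.Algorithm

open Cmd HalfCover

variable {n : ℕ} {E : ℕ → ℕ → Prop} {σ : Store Var Arr}

/-! ### Correctness and running time of the program -/

/-- The input of the program: `n` in the variable `n`, and the adjacency matrix in the array `adj`,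
with `B` and `k` at two positions which are on the diagonal or beyond the end. -/
structure Input (n B k : ℕ) (E : ℕ → ℕ → Prop) (σ : Store Var Arr) : Prop where
  n_eq : σ.v .n = n
  B_eq : σ.a .adj (n + 1) = B
  k_eq : σ.a .adj (2 * n + 2) = k
  adj_iff : ∀ u < n, ∀ w < n, u ≠ w → (σ.a .adj (u * n + w) ≠ 0 ↔ E u w)
  diag : ∀ u < n, u * n + u ≠ n + 1 → u * n + u ≠ 2 * n + 2 → σ.a .adj (u * n + u) = 0

theorem pairs_le (n : ℕ) (E : ℕ → ℕ → Prop) : pairs n E ≤ n * n := by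
  classical
  calc pairs n E ≤ ∑ u ∈ Finset.range n, ∑ w ∈ Finset.range n, 1 :=
        Finset.sum_le_sum fun u _ => Finset.sum_le_sum fun w _ => by split_ifs <;> omega
    _ = n * n := by simp

variable {B k : ℕ}

theorem setup_spec (h : Input n B k E σ) (hirr : ∀ v, ¬ E v v) (hB : 0 < B)
    {σ' : Store Var Arr} (hσ' : σ' = setup.eval σ) :
    Env n E σ' ∧ σ'.v .k = k ∧ σ'.v .b = k + pairs n E / (2 * B) ∧
      σ'.v .t = pairs n E - 2 * (k + pairs n E / (2 * B)) := by
  obtain ⟨σ₁, hσ₁⟩ : ∃ τ, τ = readParams.eval σ := ⟨_, rfl⟩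
  obtain ⟨h1, h2, h3, h4, h5, h6⟩ :=
    readParams_spec h.n_eq hirr h.B_eq h.k_eq h.adj_iff h.diag hσ₁
  obtain ⟨σ₂, hσ₂⟩ : ∃ τ, τ = initRows.eval σ₁ := ⟨_, rfl⟩
  have env₂ : Env n E σ₂ := hσ₂ ▸ initRows_spec h1 h2 h3 h6
  obtain ⟨σ₃, hσ₃⟩ : ∃ τ, τ = countEntries.eval σ₂ := ⟨_, rfl⟩
  have hm := countEntries_spec env₂
  rw [← hσ₃] at hm
  have env₃ : Env n E σ₃ := hσ₃ ▸ env₂.eval (by decide) (by decide)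
  have hB₃ : σ₃.v .B = B := by
    rw [hσ₃, eval_v_of_not_writesVar (by decide), hσ₂, eval_v_of_not_writesVar (by decide), h4]
  have hk₃ : σ₃.v .k = k := by
    rw [hσ₃, eval_v_of_not_writesVar (by decide), hσ₂, eval_v_of_not_writesVar (by decide), h5]
  have e : σ' = computeBound.eval σ₃ := by rw [hσ', hσ₃, hσ₂, hσ₁]; rfl
  refine ⟨?_, ?_, computeBound_spec env₃ hB₃ hk₃ hm hB (pairs_le n E) e⟩
  · rw [e]; exact env₃.eval (by decide) (by decide)
  · rw [e, eval_v_of_not_writesVar (by decide), hk₃]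

/-- Sum `2 ≤ z u + z w` over all ordered pairs of adjacent vertices. By symmetry both terms have the
same sum, in which each `z u` occurs degree many times. -/
theorem pairs_le_mul_tau (hsymm : ∀ u w, E u w → E w u)
    (hdeg : ∀ u < n, (nbrs E (Finset.range n) u).card ≤ B) :
    pairs n E ≤ B * tau E (Finset.range n) := by
  classical
  obtain ⟨⟨z, hz, hzt⟩, -⟩ := isTau_tau E (Finset.range n)
  rw [← hzt]
  have h1 : ∑ u ∈ Finset.range n, ∑ w ∈ Finset.range n, (if E u w then z u else 0) ≤
      B * ∑ u ∈ Finset.range n, z u := by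
    rw [Finset.mul_sum]
    refine Finset.sum_le_sum fun u hu => ?_
    rw [← Finset.sum_filter, Finset.sum_const, smul_eq_mul]
    refine Nat.mul_le_mul_right _ ((le_of_eq ?_).trans (hdeg u (Finset.mem_range.1 hu)))
    rfl
  have h2 : ∑ u ∈ Finset.range n, ∑ w ∈ Finset.range n, (if E u w then z w else 0) =
      ∑ u ∈ Finset.range n, ∑ w ∈ Finset.range n, (if E u w then z u else 0) := by
    rw [Finset.sum_comm]
    refine Finset.sum_congr rfl fun u _ => Finset.sum_congr rfl fun w _ => ?_
    have : E w u ↔ E u w := ⟨hsymm _ _, hsymm _ _⟩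
    simp only [this]
  have h3 : 2 * pairs n E ≤
      ∑ u ∈ Finset.range n, ∑ w ∈ Finset.range n, (if E u w then z u else 0) +
      ∑ u ∈ Finset.range n, ∑ w ∈ Finset.range n, (if E u w then z w else 0) := by
    rw [pairs, Finset.mul_sum, ← Finset.sum_add_distrib]
    refine Finset.sum_le_sum fun u hu => ?_
    rw [Finset.mul_sum, ← Finset.sum_add_distrib]
    refine Finset.sum_le_sum fun w hw => ?_
    split_ifs with hE
    · exact hz u hu w hw hE
    · simp
  omega

-- The initial test answers yes when a cover with one vertex per edge fits into the budget; `hsmall`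
-- supplies it. Otherwise `2 * k` answers suffice: by `pairs_le_mul_tau`, twice the rounded quotient
-- is at most tau, so the initial potential is at most `2 * k`.
open scoped Classical in
theorem program_spec (h : Input n B k E σ) (hsymm : ∀ u w, E u w → E w u) (hirr : ∀ v, ¬ E v v)
    (hB : 0 < B) (hdeg : ∀ u < n, (nbrs E (Finset.range n) u).card ≤ B)
    (hsmall : ∃ C, Covers E (Finset.range n) C ∧ 2 * C.card ≤ pairs n E) :
    (program.eval σ).v .n =
      if ∃ C, Covers E (Finset.range n) C ∧ C.card ≤ k + pairs n E / (2 * B) then 1 else 0 := by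
  obtain ⟨σ₁, hσ₁⟩ : ∃ τ, τ = setup.eval σ := ⟨_, rfl⟩
  obtain ⟨env, hk, hb, ht⟩ := setup_spec h hirr hB hσ₁
  set b := k + pairs n E / (2 * B) with hbdef
  by_cases c : pairs n E - 2 * b = 0
  · have e : (program.eval σ).v .n = 1 := by
      rw [program, eval_block_cons, eval_block_cons, ← hσ₁, eval_ifz, ht, if_pos c]
      simp
    obtain ⟨C, hC, hcard⟩ := hsmall
    rw [e, if_pos ⟨C, hC, by omega⟩]
  obtain ⟨σ₂, hσ₂⟩ : ∃ τ, τ = prepare.eval σ₁ := ⟨_, rfl⟩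
  obtain ⟨hbits, hcount⟩ := prepare_spec hk
  rw [← hσ₂] at hbits hcount
  have env₂ : Env n E σ₂ := hσ₂ ▸ env.eval (by decide) (by decide)
  have hb₂ : σ₂.v .b = b := by rw [hσ₂, eval_v_of_not_writesVar (by decide), hb]
  obtain ⟨h1, h2, h3⟩ := search_spec env₂ hsymm hirr hbits hcount hb₂
  have e : (program.eval σ).v .n = (search.eval σ₂).v .ans := by
    rw [program, eval_block_cons, eval_block_cons, ← hσ₁, eval_ifz, ht, if_neg c]
    simp only [eval_block_cons, eval_block_nil, eval_copy, ← hσ₂, Function.update_self]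
  rw [e]
  split_ifs with hC
  · apply h3
    obtain ⟨C, hC, hcard⟩ := hC
    refine branch_complete (isTau_tau E) hsymm hirr b (List.range n) (Finset.range n) C 0 (2 * k) hC
      (by omega) ?_
    have hle := pairs_le_mul_tau hsymm hdeg
    have hdiv : 2 * (pairs n E / (2 * B)) ≤ tau E (Finset.range n) := by
      have h4 := Nat.div_mul_le_self (pairs n E) (2 * B)
      have h5 : B * (2 * (pairs n E / (2 * B))) ≤ B * tau E (Finset.range n) := by
        refine le_trans (le_of_eq ?_) (h4.trans hle)
        ring
      exact Nat.le_of_mul_le_mul_left h5 hB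
    omega
  · refine h1.resolve_right fun h1 => hC ?_
    obtain ⟨g, hg⟩ := h2 h1
    obtain ⟨C, hC, hcard⟩ := branch_sound (τ := tau E) hsymm (List.range n) (Finset.range n) 0 g
      (by simp)
    exact ⟨C, hC, by rw [coverSize] at hg; omega⟩

/-- The doubling in unary costs a geometric sum, of the same order as the final value `4 ^ k`. -/
theorem steps_prepare_le (hk : σ.v .k = k) : prepare.steps σ ≤ 20 * 4 ^ k := by
  have hk4 : k < 4 ^ k := Nat.lt_pow_self (by norm_num)
  obtain ⟨ρ, hρ⟩ : ∃ ρ, ρ = (block [const .bitCount 0,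
    loop .k (block [succ .bitCount, succ .bitCount])]).eval σ := ⟨_, rfl⟩
  have h1 : (loop .k (block [succ .bitCount, succ .bitCount])).steps
      ((const .bitCount 0 : Cmd Var Arr).eval σ) ≤ 1 + ∑ i ∈ Finset.range k, (1 + 2) :=
    steps_loop_le (by simp [hk]) (fun _ _ => True) (fun _ => 2) trivial (fun _ _ _ => trivial)
      (fun _ _ _ => le_rfl)
  have hb : ρ.v .bitCount = 2 * k := by
    have := (prepare_spec hk).1
    have e : prepare.eval σ = (block [const .count 1, loop .bitCount (block [copy .aux .count,
      loop .aux (succ .count)])]).eval ρ := by rw [hρ]; rfl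
    rwa [e, eval_v_of_not_writesVar (by decide)] at this
  have h2 : (loop .bitCount (block [copy .aux .count, loop .aux (succ .count)])).steps
      ((const .count 1 : Cmd Var Arr).eval ρ) ≤
        1 + ∑ i ∈ Finset.range (2 * k), (1 + (2 + 2 ^ i * 2)) := by
    refine steps_loop_le (by simp [hb]) (fun i τ => τ.v .count = 2 ^ i) (fun i => 2 + 2 ^ i * 2)
      (by simp) ?_ ?_
    · rintro i τ h
      simp [eval_loop_succ, h]
      ring
    · rintro i τ h
      simp [steps_block_cons, steps_block_nil, Cmd.steps, h]
      omega
  have e : prepare.steps σ = 1 + ((loop .k (block [succ .bitCount, succ .bitCount])).steps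
      ((const .bitCount 0 : Cmd Var Arr).eval σ) + (2 + ((loop .bitCount (block [copy .aux .count,
      loop .aux (succ .count)])).steps ((const .count 1 : Cmd Var Arr).eval ρ) + 0))) := by
    rw [hρ]; rfl
  rw [Finset.sum_const, Finset.card_range, smul_eq_mul] at h1
  rw [Finset.sum_add_distrib, Finset.sum_add_distrib, ← Finset.sum_mul, Nat.geomSum_eq le_rfl,
    Finset.sum_const, Finset.sum_const, Finset.card_range, smul_eq_mul, smul_eq_mul, pow_mul] at h2
  rw [show (2 : ℕ) ^ 2 = 4 by norm_num, show 2 - 1 = 1 by norm_num, Nat.div_one] at h2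
  omega

/-- The variables which govern the loops of an attempt. -/
def isLoopVar : Var → Bool
  | .n | .rounds | .bitCount => true
  | _ => false

/-- The variable `count` is kept out of the uniform loop bound: its value `4 ^ k` enters once as a
factor, while all loops inside an attempt are polynomial in `N`. -/
theorem steps_search_le (h : Env n E σ) (hbits : σ.v .bitCount = 2 * k)
    (hcount : σ.v .count = 2 ^ (2 * k)) {N : ℕ} (hN : n * (n + 1) + 1 ≤ N) (hkN : 2 * k ≤ N) :
    search.steps σ ≤ 4 ^ k * (3 + (fill .bitCount .bits .zero).bound N +
      (block [attempt, increment]).bound N) := by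
  have hnN : n ≤ N := by nlinarith
  have hlv : ∀ τ : Store Var Arr, Env n E τ → τ.v .bitCount = 2 * k →
      ∀ x, isLoopVar x = true → τ.v x ≤ N := by
    intro τ hτ hb x hx
    cases x <;> simp only [isLoopVar, Bool.false_eq_true] at hx
    · rw [hτ.n_eq]; exact hnN
    · rw [hτ.rounds_eq]; exact hN
    · rw [hb]; exact hkN
  obtain ⟨σ₀, hσ₀⟩ : ∃ τ, τ = (const .ans 0 : Cmd Var Arr).eval σ := ⟨_, rfl⟩
  have env₀ : Env n E σ₀ := hσ₀ ▸ h.eval (by decide) (by decide)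
  have hb₀ : σ₀.v .bitCount = 2 * k := by simp [hσ₀, hbits]
  have h1 : (fill .bitCount .bits .zero).steps σ₀ ≤ (fill .bitCount .bits .zero).bound N :=
    steps_le_bound (Z := isLoopVar) (by decide) σ₀ (hlv σ₀ env₀ hb₀)
  obtain ⟨σ₁, hσ₁⟩ : ∃ τ, τ = (fill .bitCount .bits .zero).eval σ₀ := ⟨_, rfl⟩
  have env₁ : Env n E σ₁ := hσ₁ ▸ env₀.eval (by decide) (by decide)
  have hb₁ : σ₁.v .bitCount = 2 * k := by rw [hσ₁, eval_v_of_not_writesVar (by decide), hb₀]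
  have hc₁ : σ₁.v .count = 4 ^ k := by
    rw [hσ₁, eval_v_of_not_writesVar (by decide), hσ₀, eval_v_of_not_writesVar (by decide), hcount,
      pow_mul, show (2 : ℕ) ^ 2 = 4 by norm_num]
  have h2 : (loop .count (block [attempt, increment])).steps σ₁ ≤
      1 + ∑ _i ∈ Finset.range (4 ^ k), (1 + (block [attempt, increment]).bound N) := by
    refine steps_loop_le hc₁ (fun _ τ => Env n E τ ∧ τ.v .bitCount = 2 * k)
      (fun _ => (block [attempt, increment]).bound N) ⟨env₁, hb₁⟩ ?_ ?_
    · rintro i τ ⟨h3, h4⟩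
      exact ⟨h3.eval (by decide) (by decide), by rw [eval_v_of_not_writesVar (by decide), h4]⟩
    · rintro i τ ⟨h3, h4⟩
      exact steps_le_bound (Z := isLoopVar) (by decide) τ (hlv τ h3 h4)
  have e : search.steps σ = 1 + ((fill .bitCount .bits .zero).steps σ₀ +
      ((loop .count (block [attempt, increment])).steps σ₁ + 0)) := by
    rw [hσ₁, hσ₀]; rfl
  rw [Finset.sum_const, Finset.card_range, smul_eq_mul] at h2
  have h4 : 1 ≤ 4 ^ k := Nat.one_le_pow _ _ (by norm_num)
  rw [e]
  nlinarith [Nat.mul_le_mul_right (2 + (fill .bitCount .bits .zero).bound N) h4]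

theorem exists_steps_program_le : ∃ a e : ℕ, ∀ (n B k : ℕ) (E : ℕ → ℕ → Prop)
    (σ : Store Var Arr), Input n B k E σ → (∀ v, ¬ E v v) → 0 < B →
    program.steps σ ≤ a * (n + 1) ^ e *
      (if pairs n E ≤ 2 * (k + pairs n E / (2 * B)) then 1 else 4 ^ k) := by
  obtain ⟨a₁, e₁, h₁⟩ := setup.exists_bound_le
  obtain ⟨a₂, e₂, h₂⟩ :=
    (seq (fill .bitCount .bits .zero) (block [attempt, increment])).exists_bound_le
  refine ⟨a₁ + a₂ * 2 ^ e₂ + 30, e₁ + 2 * e₂, ?_⟩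
  intro n B k E σ h hirr hB
  obtain ⟨σ₁, hσ₁⟩ : ∃ τ, τ = setup.eval σ := ⟨_, rfl⟩
  obtain ⟨env, hk, hb, ht⟩ := setup_spec h hirr hB hσ₁
  set b := k + pairs n E / (2 * B) with hbdef
  have hp1 : (n + 1) ^ e₁ ≤ (n + 1) ^ (e₁ + 2 * e₂) := Nat.pow_le_pow_right (by omega) (by omega)
  have hp2 : (n + 1) ^ (2 * e₂) ≤ (n + 1) ^ (e₁ + 2 * e₂) :=
    Nat.pow_le_pow_right (by omega) (by omega)
  have hp3 : 1 ≤ (n + 1) ^ (e₁ + 2 * e₂) := Nat.one_le_pow _ _ (by omega)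
  set p := (n + 1) ^ (e₁ + 2 * e₂)
  have hsetup : setup.steps σ ≤ a₁ * p := by
    refine le_trans (steps_le_bound (Z := fun x => decide (x = .n)) (N := n) (by decide) σ ?_)
      ((h₁ n).trans (Nat.mul_le_mul_left _ hp1))
    intro x hx
    rw [decide_eq_true_eq] at hx
    rw [hx, h.n_eq]
  have e : program.steps σ = setup.steps σ + ((1 + if σ₁.v .t = 0 then 2 else
      (block [prepare, search]).steps σ₁) + (1 + 0)) := by rw [hσ₁]; rfl
  rw [e, ht]
  by_cases c : pairs n E ≤ 2 * b
  · rw [if_pos c, if_pos (by omega)]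
    nlinarith [Nat.zero_le (a₂ * 2 ^ e₂ * p)]
  rw [if_neg c, if_neg (by omega)]
  obtain ⟨σ₂, hσ₂⟩ : ∃ τ, τ = prepare.eval σ₁ := ⟨_, rfl⟩
  obtain ⟨hbits, hcount⟩ := prepare_spec hk
  rw [← hσ₂] at hbits hcount
  have env₂ : Env n E σ₂ := hσ₂ ▸ env.eval (by decide) (by decide)
  have hpairs := pairs_le n E
  have hkb : k ≤ b := Nat.le_add_right _ _
  -- The failed test gives `2 * k ≤ 2 * b < pairs n E ≤ n * n`, so the loops over `bitCount` are
  -- polynomial in `n` as well.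
  have hkn : 2 * k ≤ n * n := by omega
  have hsearch := steps_search_le env₂ hbits hcount (N := (n + 1) ^ 2) (by nlinarith)
    (by nlinarith)
  have hbd : (fill .bitCount .bits .zero).bound ((n + 1) ^ 2) +
      (block [attempt, increment]).bound ((n + 1) ^ 2) ≤ a₂ * 2 ^ e₂ * p := by
    refine (h₂ ((n + 1) ^ 2)).trans ?_
    rw [mul_assoc]
    refine Nat.mul_le_mul_left _ ?_
    calc ((n + 1) ^ 2 + 1) ^ e₂ ≤ (2 * (n + 1) ^ 2) ^ e₂ :=
          Nat.pow_le_pow_left (by have := Nat.one_le_pow 2 (n + 1) (by omega); omega) _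
      _ = 2 ^ e₂ * (n + 1) ^ (2 * e₂) := by rw [mul_pow, ← pow_mul]
      _ ≤ 2 ^ e₂ * p := Nat.mul_le_mul_left _ hp2
  have hprep := steps_prepare_le hk
  have e' : (block [prepare, search]).steps σ₁ = prepare.steps σ₁ + (search.steps σ₂ + 0) := by
    rw [hσ₂]; rfl
  rw [e']
  have h4 : 1 ≤ 4 ^ k := Nat.one_le_pow _ _ (by norm_num)
  set q := a₂ * 2 ^ e₂
  calc _ ≤ a₁ * p * 4 ^ k + (20 * 4 ^ k + 4 ^ k * (3 + q * p) + 2) := by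
        have h5 : a₁ * p ≤ a₁ * p * 4 ^ k := Nat.le_mul_of_pos_right _ (by omega)
        have h6 := Nat.mul_le_mul_left (4 ^ k) (Nat.add_le_add_left hbd 3)
        rw [← add_assoc] at h6
        omega
    _ ≤ a₁ * p * 4 ^ k + (25 * 4 ^ k + 4 ^ k * (q * p)) := by
        rw [mul_add]
        omega
    _ ≤ a₁ * p * 4 ^ k + (25 * (p * 4 ^ k) + 4 ^ k * (q * p)) := by
        have : 4 ^ k ≤ p * 4 ^ k := Nat.le_mul_of_pos_left _ (by omega)
        omega
    _ ≤ (a₁ + q + 30) * p * 4 ^ k := by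
        have : (a₁ + q + 30) * p * 4 ^ k =
          a₁ * p * 4 ^ k + (30 * (p * 4 ^ k) + 4 ^ k * (q * p)) := by ring
        omega

end VCL1.Algorithm

/-! ### Instances as relations on the natural numbers, and their encoding -/

namespace VCL1

open Finset HalfCover VCL1.Algorithm

/-- The adjacency relation of an instance as a relation on the natural numbers. -/
def edge (x : VCL1) (u w : ℕ) : Prop :=
  ∃ (hu : u < x.n) (hw : w < x.n), x.G.Adj ⟨u, hu⟩ ⟨w, hw⟩

theorem edge_val {x : VCL1} {u w : Fin x.n} : x.edge u w ↔ x.G.Adj u w :=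
  ⟨fun ⟨_, _, h⟩ => h, fun h => ⟨u.2, w.2, h⟩⟩

theorem edge_symm {x : VCL1} {u w : ℕ} (h : x.edge u w) : x.edge w u :=
  let ⟨hu, hw, h⟩ := h; ⟨hw, hu, h.symm⟩

theorem not_edge_self (x : VCL1) (u : ℕ) : ¬ x.edge u u :=
  fun ⟨_, _, h⟩ => x.G.loopless.irrefl _ h

open scoped Classical in
theorem card_nbrs_edge (x : VCL1) (u : Fin x.n) :
    (nbrs x.edge (range x.n) u).card = x.G.degree u := by
  rw [← SimpleGraph.card_neighborFinset_eq_degree, ← Finset.card_map Fin.valEmbedding]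
  congr 1
  ext w
  simp only [mem_nbrs, mem_range, mem_map, SimpleGraph.mem_neighborFinset, Fin.valEmbedding_apply]
  constructor
  · rintro ⟨-, _, hw, h⟩
    exact ⟨⟨w, hw⟩, h, rfl⟩
  · rintro ⟨w, h, rfl⟩
    exact ⟨w.2, edge_val.2 h⟩

open scoped Classical in
theorem pairs_edge (x : VCL1) : pairs x.n x.edge = 2 * x.G.edgeFinset.card := by
  rw [← SimpleGraph.sum_degrees_eq_twice_card_edges, pairs, Finset.sum_range]
  refine Finset.sum_congr rfl fun u _ => ?_
  rw [← card_nbrs_edge, nbrs, Finset.card_filter]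

/-- Vertex covers as sets of vertices and as sets of natural numbers. -/
theorem exists_isVertexCover_iff (x : VCL1) (c : ℕ) :
    (∃ C : Finset (Fin x.n), x.G.IsVertexCover (C : Set (Fin x.n)) ∧ C.card ≤ c) ↔
      ∃ C : Finset ℕ, Covers x.edge (range x.n) C ∧ C.card ≤ c := by
  classical
  constructor
  · rintro ⟨C, hC, hc⟩
    refine ⟨C.map Fin.valEmbedding, ?_, by rwa [Finset.card_map]⟩
    rintro u - w - ⟨hu, hw, h⟩
    refine (hC h).imp (fun h => ?_) fun h => ?_
    · exact Finset.mem_map.2 ⟨_, h, rfl⟩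
    · exact Finset.mem_map.2 ⟨_, h, rfl⟩
  · rintro ⟨C, hC, hc⟩
    refine ⟨univ.filter fun i => (i : ℕ) ∈ C, ?_, le_trans ?_ hc⟩
    · intro u w h
      simpa using hC u (mem_range.2 u.2) w (mem_range.2 w.2) (edge_val.2 h)
    · rw [← Finset.card_map Fin.valEmbedding]
      refine Finset.card_le_card fun i hi => ?_
      obtain ⟨j, hj, rfl⟩ := Finset.mem_map.1 hi
      exact (Finset.mem_filter.1 hj).2

/-- The size of a cover is an integer, so the rational bound may be rounded down; the factor 2 comes
from counting each edge in both directions. -/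
theorem isYes_iff (x : VCL1) : x.IsYes ↔ ∃ C : Finset ℕ, Covers x.edge (range x.n) C ∧
    C.card ≤ x.k + pairs x.n x.edge / (2 * x.B) := by
  rw [← exists_isVertexCover_iff, pairs_edge, Nat.mul_div_mul_left _ _ (by norm_num), IsYes]
  refine exists_congr fun C => and_congr_right fun _ => ?_
  have hB : (0 : ℚ) < x.B := by exact_mod_cast x.B_pos
  rw [← sub_le_iff_le_add, le_div_iff₀ hB, ← Nat.sub_le_iff_le_add', Nat.le_div_iff_mul_le x.B_pos]
  rcases le_total x.k C.card with h | h
  · rw [← Nat.cast_sub h]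
    exact_mod_cast Iff.rfl
  · rw [Nat.sub_eq_zero_of_le h, zero_mul]
    refine iff_of_true ?_ (Nat.zero_le _)
    have h' : (C.card : ℚ) ≤ x.k := by exact_mod_cast h
    exact (mul_nonpos_of_nonpos_of_nonneg (by linarith) hB.le).trans (Nat.cast_nonneg _)

/-- Choose the smaller endpoint of every edge. -/
theorem exists_small_cover (x : VCL1) :
    ∃ C, Covers x.edge (range x.n) C ∧ 2 * C.card ≤ pairs x.n x.edge := by
  classical
  obtain ⟨C, hC, hc⟩ := (x.exists_isVertexCover_iff x.G.edgeFinset.card).1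
    ⟨x.G.edgeFinset.image fun s => s.inf, by
      intro u w h
      have hm : min u w ∈ x.G.edgeFinset.image fun s => s.inf :=
        Finset.mem_image.2 ⟨s(u, w), SimpleGraph.mem_edgeFinset.2 h, rfl⟩
      rcases min_choice u w with e | e
      · exact .inl (e ▸ hm)
      · exact .inr (e ▸ hm), Finset.card_image_le⟩
  refine ⟨C, hC, ?_⟩
  rw [pairs_edge]
  exact Nat.mul_le_mul_left 2 (hc.trans (le_of_eq (by congr)))

theorem getElem?_flatMap_of_length {α β : Type*} {g : α → List β} {m w : ℕ}
    (hg : ∀ a, (g a).length = m) (hw : w < m) (l : List α) (u : ℕ) :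
    (l.flatMap g)[u * m + w]? = l[u]?.bind fun a => (g a)[w]? := by
  induction l generalizing u with
  | nil => simp
  | cons a l ih =>
    rw [List.flatMap_cons]
    cases u with
    | zero => rw [List.getElem?_append_left (by rw [hg]; omega)]; simp
    | succ u =>
      rw [List.getElem?_append_right (by rw [hg, add_mul]; omega), hg,
        show (u + 1) * m + w - m = u * m + w by rw [add_mul]; omega, ih]
      simp

open scoped Classical in
theorem encode_matrix (x : VCL1) {u w : ℕ} (hu : u < x.n) (hw : w < x.n) :
    x.encode.getD (3 + (u * x.n + w)) 0 = if x.edge u w then 1 else 0 := by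
  rw [encode, List.getD_eq_getElem?_getD, List.getElem?_append_right (by simp),
    show 3 + (u * x.n + w) - [x.n, x.B, x.k].length = u * x.n + w by simp,
    getElem?_flatMap_of_length (by simp) hw]
  have e : x.edge u w ↔ x.G.Adj ⟨u, hu⟩ ⟨w, hw⟩ := edge_val (u := ⟨u, hu⟩) (w := ⟨w, hw⟩)
  simp [hu, hw, e]

theorem encode_le (x : VCL1) (r : ℕ) : x.encode.getD r 0 ≤ x.n + x.B + x.k + 1 := by
  have h : ∀ a ∈ x.encode, a ≤ x.n + x.B + x.k + 1 := by
    intro a ha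
    simp only [encode, List.mem_append, List.mem_cons, List.not_mem_nil, or_false,
      List.mem_flatMap, List.mem_map] at ha
    rcases ha with (rfl | rfl | rfl) | ⟨i, -, j, -, rfl⟩
    · omega
    · omega
    · omega
    · split_ifs <;> omega
  rw [List.getD_eq_getElem?_getD]
  by_cases hr : r < x.encode.length
  · simpa [hr] using h _ (List.getElem_mem hr)
  · simp [hr]

theorem length_encode (x : VCL1) : x.encode.length = 3 + x.n * x.n := by
  simp [encode, List.length_flatMap]
  omega

theorem encode_three (x : VCL1) : x.encode.getD 3 0 = 0 := by
  classical
  rcases Nat.eq_zero_or_pos x.n with h | h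
  · rw [List.getD_eq_getElem?_getD, List.getElem?_eq_none (by rw [length_encode, h])]
    rfl
  · have := x.encode_matrix h h
    rwa [if_neg (x.not_edge_self 0), zero_mul] at this

theorem init_encode (x : VCL1) :
    RAM.init x.encode = ⟨0, RAM.quad x.n x.B x.k 0 fun r => x.encode.getD r 0⟩ := by
  have h : RAM.quad x.n x.B x.k (x.encode.getD 3 0) (fun r => x.encode.getD r 0) =
      fun r => x.encode.getD r 0 := RAM.quad_self (f := fun r => x.encode.getD r 0)
  rw [encode_three] at h
  exact congrArg (RAM.Config.mk 0) h.symm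

theorem succ_n_le_inputSize (x : VCL1) : x.n + 1 ≤ RAM.inputSize x.encode := by
  have h : x.encode.length ≤ RAM.inputSize x.encode := by
    rw [RAM.inputSize]
    generalize x.encode = l
    induction l with
    | nil => simp
    | cons a l ih => rw [List.map_cons, List.sum_cons, List.length_cons, RAM.len]; omega
  rw [length_encode] at h
  nlinarith

end VCL1

/-! ### Bit lengths and the numbers occurring in a program -/

theorem Nat.size_mul_le (x y : ℕ) : (x * y).size ≤ x.size + y.size := by
  rw [Nat.size_le, pow_add]
  exact Nat.mul_lt_mul'' (Nat.lt_size_self x) (Nat.lt_size_self y)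

theorem Nat.size_le_self (x : ℕ) : x.size ≤ x := Nat.size_le.2 Nat.lt_two_pow_self

theorem RAM.exists_weight_le (P : Program) : ∃ W, ∀ i ∈ P, i.weight ≤ W := by
  refine ⟨(P.map Instr.weight).sum, fun i hi => ?_⟩
  exact List.single_le_sum (fun _ _ => Nat.zero_le _) _ (List.mem_map_of_mem hi)

/-! ### The machine program and its total cost -/

namespace VCL1.Algorithm

open Finset HalfCover Cmd

/-- The placement of the variables and the arrays of the algorithm in the registers. -/
def layout : RAM.Layout Var Arr where
  var := Var.ctorIdx
  arr := Arr.ctorIdx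
  var_inj := Function.LeftInverse.injective Var.ofNat_ctorIdx
  arr_inj := Function.LeftInverse.injective Arr.ofNat_ctorIdx
  arr_lt c := by cases c <;> decide

/-- The machine program. -/
def code : RAM.Program := RAM.spread ++ layout.code program 0 31

/-- The registers after the matrix is spread out present the instance to the algorithm. -/
theorem input_view (x : VCL1) {reg : ℕ → ℕ} (h0 : reg 0 = x.n) (h3 : reg 3 = 0)
    (h : ∀ i, 1 ≤ i → i ≤ x.n * x.n + 2 * x.n + 5 → reg (16 * i + 3) = Function.update
      (Function.update (fun r => x.encode.getD r 0) (x.n + 4) x.B) (2 * x.n + 5) x.k (3 + i)) :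
    Input x.n x.B x.k x.edge (layout.view reg) := by
  classical
  have ha : ∀ i, (layout.view reg).a .adj i = reg (16 * i + 3) := fun _ => rfl
  have hlt : ∀ {u w}, u < x.n → w < x.n → u * x.n + w < x.n * x.n := by
    intro u w hu hw
    have := Nat.mul_le_mul_right x.n (Nat.succ_le_of_lt hu)
    rw [Nat.succ_mul] at this
    omega
  have hm : ∀ {u w}, u < x.n → w < x.n → u * x.n + w ≠ x.n + 1 → u * x.n + w ≠ 2 * x.n + 2 →
      (layout.view reg).a .adj (u * x.n + w) = if x.edge u w then 1 else 0 := by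
    intro u w hu hw h1 h2
    rw [ha, ← x.encode_matrix hu hw]
    have hi := hlt hu hw
    -- Position 0 is register 3, which `spread` leaves at 0; this is the right value since the entry
    -- is on the diagonal.
    rcases Nat.eq_zero_or_pos (u * x.n + w) with e | e
    · rw [e, x.encode_three]
      exact h3
    · rw [h _ e (by omega), Function.update_of_ne (by omega), Function.update_of_ne (by omega)]
  refine ⟨h0, ?_, ?_, ?_, ?_⟩
  · rw [ha, h _ (by omega) (by nlinarith), Function.update_of_ne (by omega),
      show 3 + (x.n + 1) = x.n + 4 by omega, Function.update_self]
  · rw [ha, h _ (by omega) (by nlinarith), show 3 + (2 * x.n + 2) = 2 * x.n + 5 by omega,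
      Function.update_self]
  · intro u hu w hw huw
    rw [hm hu hw (fun e => huw (eq_of_mul_add_eq hu hw (c := 1) (by omega)))
      (fun e => huw (eq_of_mul_add_eq hu hw (c := 2) (by omega)))]
    simp
  · intro u hu h1 h2
    rw [hm hu hu h1 h2, if_neg (x.not_edge_self u)]

/-- The number of rounds of the search. -/
noncomputable def rounds (x : VCL1) : ℕ :=
  if pairs x.n x.edge ≤ 2 * (x.k + pairs x.n x.edge / (2 * x.B)) then 1 else 4 ^ x.k

theorem rounds_pos (x : VCL1) : 1 ≤ rounds x := by
  rw [rounds]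
  split_ifs
  · exact le_rfl
  · exact Nat.one_le_pow _ _ (by norm_num)

theorem size_rounds_le (x : VCL1) : (rounds x).size ≤ 2 * x.k + 1 := by
  have h : rounds x ≤ 2 ^ (2 * x.k) := by
    rw [rounds, pow_mul]
    split_ifs
    · exact Nat.one_le_pow _ _ (by norm_num)
    · exact le_rfl
  rw [Nat.size_le]
  exact h.trans_lt (Nat.pow_lt_pow_right (by norm_num) (by omega))

/-- The factor `n + B + k + 1` pays for the lengths of the numbers. If no search takes place, `B + k
+ 1` itself is at most `3 * 2 ^ (k * B)`. Otherwise `k` is polynomial in `n`, and `B` is absorbed by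
the surplus `2 ^ (k * (B - 2))` of `2 ^ (k * B)` over `4 ^ k`, up to a factor 4. -/
theorem mul_rounds_le (x : VCL1) :
    (x.n + x.B + x.k + 1) * rounds x ≤ 8 * (x.n + 1) ^ 2 * 2 ^ (x.k * x.B) := by
  have hB := x.B_pos
  have hk := x.k_pos
  rw [rounds]
  split_ifs with h
  · have h1 : x.B ≤ x.k * x.B := Nat.le_mul_of_pos_left _ hk
    have h2 : x.k ≤ x.k * x.B := Nat.le_mul_of_pos_right _ hB
    have h3 : x.k * x.B < 2 ^ (x.k * x.B) := Nat.lt_two_pow_self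
    have h4 : x.B + x.k + 1 ≤ 3 * 2 ^ (x.k * x.B) := by omega
    generalize 2 ^ (x.k * x.B) = t at *
    nlinarith [Nat.zero_le (x.n * t), Nat.zero_le (x.n ^ 2 * t), Nat.zero_le (x.n * (t - 1))]
  · have hp := pairs_le x.n x.edge
    -- For `B = 1` the budget is at least the number of edges, so the test would have succeeded.
    have hB2 : 2 ≤ x.B := by
      by_contra hB1
      have : x.B = 1 := by omega
      rw [this] at h
      omega
    have hkn : 2 * x.k ≤ x.n * x.n := by
      have : x.k ≤ x.k + pairs x.n x.edge / (2 * x.B) := Nat.le_add_right _ _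
      omega
    have hv : x.n + x.B + x.k + 1 ≤ 2 * (x.n + 1) ^ 2 * x.B := by
      have : x.n + x.k + 1 ≤ (x.n + 1) ^ 2 := by nlinarith
      have h1 : 1 ≤ (x.n + 1) ^ 2 := Nat.one_le_pow _ _ (by omega)
      generalize (x.n + 1) ^ 2 = p at *
      nlinarith
    obtain ⟨d, hd⟩ := Nat.exists_eq_add_of_le hB2
    have hpow : 4 ^ x.k * x.B ≤ 4 * 2 ^ (x.k * x.B) := by
      have h1 : x.B ≤ 4 * 2 ^ (x.k * d) := by
        calc x.B ≤ 2 ^ x.B := Nat.lt_two_pow_self.le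
          _ = 4 * 2 ^ d := by rw [hd, pow_add]; norm_num
          _ ≤ 4 * 2 ^ (x.k * d) := Nat.mul_le_mul_left _
              (Nat.pow_le_pow_right (by norm_num) (Nat.le_mul_of_pos_left _ hk))
      calc 4 ^ x.k * x.B ≤ 4 ^ x.k * (4 * 2 ^ (x.k * d)) := Nat.mul_le_mul_left _ h1
        _ = 4 * (2 ^ (2 * x.k) * 2 ^ (x.k * d)) := by
          rw [pow_mul 2 2, show (2 : ℕ) ^ 2 = 4 from rfl]; ring
        _ = 4 * 2 ^ (x.k * x.B) := by rw [← pow_add, hd]; congr 2; ring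
    calc (x.n + x.B + x.k + 1) * 4 ^ x.k ≤ 2 * (x.n + 1) ^ 2 * x.B * 4 ^ x.k :=
          Nat.mul_le_mul_right _ hv
      _ = 2 * (x.n + 1) ^ 2 * (4 ^ x.k * x.B) := by ring
      _ ≤ 2 * (x.n + 1) ^ 2 * (4 * 2 ^ (x.k * x.B)) := Nat.mul_le_mul_left _ hpow
      _ = _ := by ring

/-- The number of rounds `F` may enter the product only once. In the length of the largest number it
occurs through its bit length, at most `2 * k + 1`, which is covered by `v`. The constants come from
`N ≤ 5 * q`: `110 = 22 * 5` and `1568 = 16 + 256 * 5 + 272`. -/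
theorem cost_le_mul {a s N v q F k W : ℕ} (hN : N ≤ 5 * q) (hs : s ≤ a * q * F) (hv : 1 ≤ v)
    (hq : 1 ≤ q) (hF : 1 ≤ F) (hk : k + 1 ≤ v) (hsize : F.size ≤ 2 * k + 1) :
    22 * N * (5 * RAM.len (16 * (v + 16 * N + 16 + s) + 16 + W)) +
      s * (8 * (5 * RAM.len (16 * (v + 16 * N + 16 + s) + 16 + W))) ≤
        (110 + 8 * a) * (5 * (1568 + 16 * a + W + 4)) * q ^ 2 * (v * F) := by
  obtain ⟨c, hc⟩ : ∃ c, c = 1568 + 16 * a + W := ⟨_, rfl⟩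
  have hvq : 1 ≤ v * q := Nat.mul_pos hv hq
  have hqF : 1 ≤ q * F := Nat.mul_pos hq hF
  have h1 : 1 ≤ v * q * F := Nat.mul_pos hvq hF
  have hU : 16 * (v + 16 * N + 16 + s) + 16 + W ≤ c * (v * q * F) := by
    have e1 : v ≤ v * q * F := by rw [mul_assoc]; exact Nat.le_mul_of_pos_right _ hqF
    have e2 : q ≤ v * q * F := by
      rw [mul_right_comm]; exact Nat.le_mul_of_pos_left _ (Nat.mul_pos hv hF)
    have e3 : a * q * F ≤ a * (v * q * F) := by
      rw [mul_assoc]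
      exact Nat.mul_le_mul_left _ (by rw [mul_assoc]; exact Nat.le_mul_of_pos_left _ hv)
    have e4 : W ≤ W * (v * q * F) := Nat.le_mul_of_pos_right _ h1
    rw [hc, add_mul, add_mul, mul_assoc 16 a]
    omega
  have hlen : RAM.len (16 * (v + 16 * N + 16 + s) + 16 + W) ≤ (c + 4) * (v * q) := by
    have e0 := Nat.size_le_size hU
    have e1 := Nat.size_mul_le c (v * q * F)
    have e2 := Nat.size_mul_le (v * q) F
    have e3 := Nat.size_le_self c
    have e4 := Nat.size_le_self (v * q)
    have e5 : c ≤ c * (v * q) := Nat.le_mul_of_pos_right _ hvq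
    have e6 : v ≤ v * q := Nat.le_mul_of_pos_right _ hq
    rw [RAM.len, add_mul]
    omega
  generalize RAM.len (16 * (v + 16 * N + 16 + s) + 16 + W) = l at *
  have hsum : 22 * N + 8 * s ≤ (110 + 8 * a) * (q * F) := by
    have : q ≤ q * F := Nat.le_mul_of_pos_right _ hF
    rw [add_mul, mul_assoc 8 a, ← mul_assoc a]
    omega
  calc 22 * N * (5 * l) + s * (8 * (5 * l)) = (22 * N + 8 * s) * (5 * l) := by ring
    _ ≤ ((110 + 8 * a) * (q * F)) * (5 * ((c + 4) * (v * q))) :=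
        Nat.mul_le_mul hsum (Nat.mul_le_mul_left _ hlen)
    _ = _ := by rw [hc]; ring

theorem exists_decidesWithin : ∃ a e : ℕ, ∀ x : VCL1,
    RAM.DecidesWithin code x.encode x.IsYes (a * 2 ^ (x.k * x.B) * (x.n + 1) ^ e) := by
  classical
  obtain ⟨a, e, hsteps⟩ := exists_steps_program_le
  obtain ⟨W, hW⟩ := RAM.exists_weight_le code
  -- With `q = (n + 1) ^ (e + 2)`, both `N` and the polynomial part of the running time are at most
  -- constant multiples of `q`. The cost contains `q ^ 2`, and `mul_rounds_le` contributes the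
  -- factor 8 and two more powers of `n + 1`.
  refine ⟨(110 + 8 * a) * (5 * (1568 + 16 * a + W + 4)) * 8, 2 * (e + 2) + 2, fun x => ?_⟩
  obtain ⟨N, hN⟩ : ∃ N, N = x.n * x.n + 2 * x.n + 5 := ⟨_, rfl⟩
  obtain ⟨v, hv⟩ : ∃ v, v = x.n + x.B + x.k + 1 := ⟨_, rfl⟩
  obtain ⟨q, hq⟩ : ∃ q, q = (x.n + 1) ^ (e + 2) := ⟨_, rfl⟩
  obtain ⟨S, hS⟩ : ∃ S, S = a * q * rounds x := ⟨_, rfl⟩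
  obtain ⟨U, hU⟩ : ∃ U, U = 16 * (v + 16 * N + 16 + S) + 16 + W := ⟨_, rfl⟩
  have hWU : ∀ i ∈ code, i.weight ≤ U := fun i hi => (hW i hi).trans (by omega)
  obtain ⟨reg, hrun, h0, h3, hle, hreg⟩ := RAM.runsLe_spread (P := code) (l := _) (v := v)
    (B := x.B) (k := x.k) (f := fun r => x.encode.getD r 0) rfl hWU hN
    (fun r => hv ▸ x.encode_le r) (by omega) (by omega) (by omega) (by omega)
  have hin := input_view x h0 h3 (hN ▸ hreg)
  have hst : program.steps (layout.view reg) ≤ S := by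
    refine (hsteps _ _ _ _ _ hin x.not_edge_self x.B_pos).trans ?_
    rw [hS, hq, rounds]
    exact Nat.mul_le_mul_right _
      (Nat.mul_le_mul_left _ (Nat.pow_le_pow_right (by omega) (by omega)))
  have hsmall : RAM.Layout.Small (v + 16 * N + 16) reg :=
    ⟨fun r _ _ => hle r, (hle 2).trans (by omega), (hle 18).trans (by omega)⟩
  obtain ⟨reg', hrun', hview, -, -⟩ := layout.runsLe_code hWU program 0 31 (v + 16 * N + 16) reg
    ⟨RAM.spread, [], by rw [code, List.append_nil], rfl⟩ hsmall (by omega)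
  obtain ⟨t, ht, hruns⟩ := hrun.trans hrun'
  rw [← x.init_encode] at hruns
  have hans : reg' 0 = if x.IsYes then 1 else 0 := by
    have e1 : reg' 0 = (layout.view reg').v .n := rfl
    rw [e1, hview, program_spec hin (fun _ _ => edge_symm) x.not_edge_self x.B_pos
      (fun u hu => (x.card_nbrs_edge ⟨u, hu⟩).trans_le (x.degree_le _)) x.exists_small_cover]
    exact if_congr x.isYes_iff.symm rfl rfl
  refine ⟨t, _, hruns, ?_, ?_, ?_⟩
  · rw [code, List.length_append, layout.length_code]
    exact le_rfl
  · have hq1 : (x.n + 1) ^ 2 ≤ q := hq ▸ Nat.pow_le_pow_right (by omega) (by omega)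
    have hcost := cost_le_mul (W := W) (k := x.k) (v := v) (N := N) (q := q) (a := a) (s := S)
      (F := rounds x) (by nlinarith) hS.le (by omega) (hq ▸ Nat.one_le_pow _ _ (by omega))
      (rounds_pos x) (by omega) (size_rounds_le x)
    rw [← hU] at hcost
    calc t ≤ _ := ht
      _ ≤ _ := Nat.add_le_add_left (Nat.mul_le_mul_right _ hst) _
      _ ≤ _ := hcost
      _ ≤ _ := Nat.mul_le_mul_left _ (hv ▸ mul_rounds_le x)
      _ = _ := by rw [hq]; ring
  · change _ ∧ reg' 0 = 1 ∨ _ ∧ reg' 0 = 0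
    rw [hans]
    by_cases h : x.IsYes <;> simp [h]

end VCL1.Algorithm

/-! ### Fixed-parameter tractability -/

theorem computable_two_pow_mul : Computable fun p : ℕ × ℕ => 2 ^ (p.1 * p.2) := by
  have h : Primrec₂ fun a b : ℕ => a ^ b := Primrec₂.unpaired'.1 Nat.Primrec.pow
  exact (h.comp (Primrec.const 2) (Primrec.nat_mul.comp Primrec.fst Primrec.snd)).to_comp

theorem theorem1 :
    (∃ (P : RAM.Program) (a e : ℕ), ∀ x : VCL1,
      RAM.DecidesWithin P x.encode x.IsYes (a * 2 ^ (x.k * x.B) * (x.n + 1) ^ e)) ∧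
    RAM.FPT VCL1.encode (fun x => (x.k, x.B)) VCL1.IsYes := by
  obtain ⟨a, e, h⟩ := VCL1.Algorithm.exists_decidesWithin
  -- The same program serves for both claims, with `2 ^ (k * B)` as the parameter function: the
  -- adjacency matrix makes the input size at least `n + 1`.
  refine ⟨⟨_, a, e, h⟩, _, computable_two_pow_mul, VCL1.Algorithm.code, a, e, fun x => ?_⟩
  obtain ⟨t, c, hr, hl, ht, hA⟩ := h x
  exact ⟨t, c, hr, hl, ht.trans (Nat.mul_le_mul_left _
    (Nat.pow_le_pow_left x.succ_n_le_inputSize _)), hA⟩
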